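/- For $\nu>0$ consider on $\mathbb R^n$, $n\ge 1$, the following probability distributions: the standard Gaussian distribution (Gaussian model); the distribution on the open unit ball with density $\pi^{-n/2}\,\frac{\Gamma((n+\nu)/2)}{\Gamma(\nu/2)}\,(1-|x|^2)^{(\nu-2)/2}$, $|x|<1$ (Beta model with parameter $\nu$); the uniform distribution on the unit sphere (spherical model). Fix one of these models (and, in the Beta model, the parameter $\nu>0$, not depending on $n$). Let $(r(n))_{n\ge 1}$ be an arbitrary sequence of integers with $1\le r(n)\le n$. For each $n\ge 1$ let $X_1,\dots,X_{r+1}$, $r=r(n)$, be independent random points in $\mathbb R^n$ distributed according to the chosen model, let $\mathcal V_{n,r}$ be the $r$-dimensional volume of the simplex with vertices $X_1,\dots,X_{r+1}$ (the convex hull of these points), and put $\mathcal L_{n,r}:=\log(r!\,\mathcal V_{n,r})$. Then, for every $n\ge 2$, $\mathcal V_{n,r}>0$ almost surely, and $\mathcal L_{n,r}$ is square integrable with $\operatorname{Var}\mathcal L_{n,r}>0$ (so that its standardization is well defined), and, as $n\to\infty$, $$ \frac{\mathcal L_{n,r}-\mathbb E[\mathcal L_{n,r}]}{\sqrt{\operatorname{Var}\mathcal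 L_{n,r}}}\ \overset{d}{\longrightarrow}\ Z, $$ where $Z\sim\mathcal N(0,1)$ is a standard Gaussian random variable. -/

import Mathlib

open MeasureTheory ProbabilityTheory Filter

noncomputable section

/-- The `r`-dimensional volume of the simplex with vertices `x 0, …, x r` in `ℝⁿ`: the
`r`-dimensional Hausdorff measure of the convex hull of the vertices, normalised so that it agrees
with Lebesgue measure on `r`-dimensional Euclidean space. -/
def simplexVolume {n r : ℕ} (x : Fin (r + 1) → EuclideanSpace ℝ (Fin n)) : ℝ :=
  (Measure.euclideanHausdorffMeasure r : Measure (EuclideanSpace ℝ (Fin n))).real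
    (convexHull ℝ (Set.range x))

/-- The log-volume `log (r! · V)` of the simplex with vertices `x 0, …, x r`. -/
def logVolume {n r : ℕ} (x : Fin (r + 1) → EuclideanSpace ℝ (Fin n)) : ℝ :=
  Real.log ((r.factorial : ℝ) * simplexVolume x)

/-- The Beta distribution with parameter `ν` on the open unit ball of `ℝⁿ`. -/
def betaBall (n : ℕ) (ν : ℝ) : Measure (EuclideanSpace ℝ (Fin n)) :=
  (volume.restrict (Metric.ball 0 1)).withDensity fun x =>
    ENNReal.ofReal
      (1 / Real.pi ^ ((n : ℝ) / 2) * (Real.Gamma (((n : ℝ) + ν) / 2) / Real.Gamma (ν / 2)) *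
        (1 - ‖x‖ ^ 2) ^ ((ν - 2) / 2))

/-- The uniform distribution (normalised surface measure) on the unit sphere of `ℝⁿ`. -/
def uniformSphere (n : ℕ) : Measure (EuclideanSpace ℝ (Fin n)) :=
  (((volume : Measure (EuclideanSpace ℝ (Fin n))).toSphere Set.univ)⁻¹ •
    (volume : Measure (EuclideanSpace ℝ (Fin n))).toSphere).map Subtype.val

/-- The three models for the random points: Gaussian, Beta with parameter `ν > 0`, spherical. -/
inductive PointModel : Type
  | gaussian : PointModel
  | beta (ν : ℝ) (hν : 0 < ν) : PointModel
  | spherical : PointModel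

/-- The distribution on `ℝⁿ` of a single random point in each of the models. -/
def PointModel.law (M : PointModel) (n : ℕ) : Measure (EuclideanSpace ℝ (Fin n)) :=
  match M with
  | .gaussian => stdGaussian (EuclideanSpace ℝ (Fin n))
  | .beta ν _ => betaBall n ν
  | .spherical => uniformSphere n

end

open scoped ENNReal Matrix Topology

/-! Put W = r!·V, the square root of the Gram determinant of the edge vectors
(`factorial_mul_simplexVolume`), and d = n - r. The law of log W can be read off from p ↦ E W^p by
analytic continuation to the imaginary axis, so the theorem rests on explicit moments followed by an
asymptotic analysis of Gamma functions.

Moments. The affine Blaschke–Petkantschin formula (`exists_lintegral_gramArray_eq`) disintegrates r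
+ 1 points of ℝⁿ into the position of the r-flat they span and the points inside that flat, with a
power of the simplex volume as Jacobian. Gaussian and Beta weights restricted to a flat are rescaled
copies of themselves (`SliceProfile`), so the integral factorises. Three relations then determine
everything: slicing of simplices (`exists_simplexMoment_eq`), slicing of parallelotopes by a
hyperplane (`exists_detMoment_eq`), and the rotation argument `exists_fullMoment_gauss`. Gaussian
determinants follow by recursion. Beta determinants follow from Gaussian ones because a determinant
is homogeneous in each row, so that the radial weight can be exchanged
(`radialMoment_pow_mul_lintegral_comm`). Constants independent of p are never computed: W > 0 almost
surely forces E W^p → 1 as p → 0, and this fixes the normalisation (`lintegral_volFactor_eq_div`).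
The spherical model is the weak limit ν → 0 of the Beta model.

Characteristic function. The Euler product gives log Γ(a + it) = log Γ(a) + ict - ζ(2,a)t²/2 +
O(ζ(3,a)|t|³), with ζ the Hurwitz zeta function and a bound valid for every real t
(`exists_Gamma_eq_exp`, `norm_gammaRem_le`). Hence the characteristic function of log W is that of a
normal law times exp R(t) with |R(t)| ≤ κ|t|³ (`CubicExp`). Such a form yields square integrability,
mean and variance v (`CubicExp.moments`), and asymptotic normality follows from κ/v^{3/2} → 0
(`tendstoInDistribution_of_cubicExp`). In the Beta model the variance contains differences ζ(2,b) -
ζ(2,a), so the remainders of numerator and denominator Gammas are paired in the same way; adding up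
individual bounds would lose this cancellation.

Uniformity in r. Up to constant factors, κ ≤ v/(d + 1) plus a term of order n⁻² in the Beta and
spherical cases. Also v ≥ c/n and v ≥ 2 log((n + 1)/(d + 1)) - 4. The first lower bound is used when
d + 1 ≥ n^{3/4} and the second otherwise; together they give (d + 1)²v → ∞ for an arbitrary sequence
r(n) (`min_le_sq_mul_of_le`, `tendsto_remainder_ratio`). -/

/-! ### Gram matrices of point configurations -/

/-- The Gram matrix of the points `x i`, with points given by coordinates. -/
noncomputable def gramArray {ι κ : Type*} [Fintype κ] (x : ι → κ → ℝ) : ι → ι → ℝ :=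
  fun i j => ∑ k, x i k * x j k

/-- The Gram determinant of the edge vectors `x (j + 1) - x 0`, in terms of the Gram matrix of the
vertices. -/
noncomputable def simplexGram {r : ℕ} (G : Fin (r + 1) → Fin (r + 1) → ℝ) : ℝ :=
  Matrix.det (Matrix.of fun i j : Fin r => G i.succ j.succ - G i.succ 0 - G 0 j.succ + G 0 0)

/-- The matrix of coordinates of `r + 1` points in `ℝʳ`, bordered by a column of ones. -/
noncomputable def onesLeft {r : ℕ} (y : Fin (r + 1) → Fin r → ℝ) :
    Matrix (Fin (r + 1)) (Fin (r + 1)) ℝ :=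
  Matrix.of fun i => Fin.cons 1 (y i)

/-- The matrix of the edge vectors `y (j + 1) - y 0`. -/
noncomputable def edgeMatrix {r : ℕ} {κ : Type*} (y : Fin (r + 1) → κ → ℝ) : Matrix (Fin r) κ ℝ :=
  Matrix.of fun i k => y i.succ k - y 0 k

theorem simplexGram_gramArray {r : ℕ} {κ : Type*} [Fintype κ] (y : Fin (r + 1) → κ → ℝ) :
    simplexGram (gramArray y) = (edgeMatrix y * (edgeMatrix y)ᵀ).det := by
  unfold simplexGram
  congr 1
  ext i j
  simp only [gramArray, edgeMatrix, Matrix.of_apply, Matrix.mul_apply, Matrix.transpose_apply,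
    ← Finset.sum_sub_distrib, ← Finset.sum_add_distrib]
  exact Finset.sum_congr rfl fun k _ => by ring

/-- A component common to all points and orthogonal to their flat adds its squared length to every
Gram entry and cancels in the edge vectors: the volume does not see the distance of the flat from
the origin. -/
theorem simplexGram_add_const {r : ℕ} (G : Fin (r + 1) → Fin (r + 1) → ℝ) (t : ℝ) :
    simplexGram (fun i j => t + G i j) = simplexGram G := by
  unfold simplexGram
  congr 1
  ext i j
  simp only [Matrix.of_apply]
  ring

theorem det_onesLeft {r : ℕ} (y : Fin (r + 1) → Fin r → ℝ) :
    (onesLeft y).det = (edgeMatrix y).det := by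
  -- Subtract row 0 from all other rows; the column of ones becomes the first unit vector and the
  -- determinant expands along it.
  have h := Matrix.det_eq_of_forall_row_eq_smul_add_const (A := onesLeft y)
    (B := Matrix.of (Fin.cons (Fin.cons 1 (y 0) : Fin (r + 1) → ℝ)
      fun i => (Fin.cons 0 (edgeMatrix y i) : Fin (r + 1) → ℝ)))
    (Fin.cons 0 fun _ => 1) 0 rfl (by
      intro i j
      refine Fin.cases ?_ (fun i => ?_) i <;> refine Fin.cases ?_ (fun j => ?_) j <;>
        simp [onesLeft, edgeMatrix])
  rw [h, Matrix.det_succ_column_zero, Fin.sum_univ_succ]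
  simp only [Fin.val_zero, pow_zero, one_mul, Matrix.of_apply, Fin.cons_zero, Fin.cons_succ,
    mul_zero, zero_mul, Finset.sum_const_zero, add_zero]
  congr 1

theorem simplexGram_eq_det_onesLeft_sq {r : ℕ} (y : Fin (r + 1) → Fin r → ℝ) :
    simplexGram (gramArray y) = (onesLeft y).det ^ 2 := by
  rw [simplexGram_gramArray, Matrix.det_mul, Matrix.det_transpose, det_onesLeft, sq]

/-- The matrix is the Gram matrix of the points lifted to height t in one extra dimension, and the
parallelotope they span has volume |t| times the simplex factor. This links determinants in ℝ^{r+1}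
with simplices in a hyperplane. -/
theorem det_add_const_gramArray {r : ℕ} (y : Fin (r + 1) → Fin r → ℝ) (t : ℝ) :
    (Matrix.of fun i j => t ^ 2 + gramArray y i j).det = t ^ 2 * (onesLeft y).det ^ 2 := by
  have h : (Matrix.of fun i j => t ^ 2 + gramArray y i j) =
      (Matrix.of fun i => Fin.cons t (y i) : Matrix (Fin (r + 1)) (Fin (r + 1)) ℝ) *
      (Matrix.of fun i => Fin.cons t (y i) : Matrix (Fin (r + 1)) (Fin (r + 1)) ℝ)ᵀ := by
    ext i j
    simp [gramArray, Matrix.mul_apply, Fin.sum_univ_succ, sq]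
  have h2 : (Matrix.of fun i => Fin.cons t (y i) : Matrix (Fin (r + 1)) (Fin (r + 1)) ℝ) =
      onesLeft y * Matrix.diagonal (Fin.cons t fun _ => 1) := by
    ext i j
    rw [Matrix.mul_diagonal]
    refine Fin.cases ?_ (fun j => ?_) j <;> simp [onesLeft]
  rw [h, Matrix.det_mul, Matrix.det_transpose, h2, Matrix.det_mul, Matrix.det_diagonal,
    Fin.prod_univ_succ]
  simp
  ring

/-! ### Linear changes of variables on arrays -/

theorem measurable_gramArray {ι κ : Type*} [Fintype κ] :
    Measurable (gramArray : (ι → κ → ℝ) → ι → ι → ℝ) := by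
  unfold gramArray
  refine measurable_pi_iff.2 fun i => measurable_pi_iff.2 fun j => ?_
  refine Finset.measurable_sum _ fun k _ => ?_
  fun_prop

theorem lintegral_comp_linearMap {E : Type*} [NormedAddCommGroup E] [NormedSpace ℝ E]
    [MeasurableSpace E] [BorelSpace E] [FiniteDimensional ℝ E] (μ : Measure E)
    [μ.IsAddHaarMeasure] (f : E →ₗ[ℝ] E) (hf : LinearMap.det f ≠ 0) {G : E → ℝ≥0∞}
    (hG : Measurable G) :
    ∫⁻ x, G (f x) ∂μ = ENNReal.ofReal |(LinearMap.det f)⁻¹| * ∫⁻ x, G x ∂μ := by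
  rw [← lintegral_map hG f.continuous_of_finiteDimensional.measurable,
    Measure.map_linearMap_addHaar_eq_smul_addHaar μ hf, lintegral_smul_measure, smul_eq_mul]

theorem det_pi_mulRight {ι κ : Type*} [Fintype ι] [Fintype κ] [DecidableEq κ]
    (T : Matrix κ κ ℝ) :
    LinearMap.det (LinearMap.pi fun i : ι => (Matrix.toLin' T).comp
      (LinearMap.proj i : (ι → κ → ℝ) →ₗ[ℝ] κ → ℝ)) = T.det ^ Fintype.card ι := by
  rw [LinearMap.det_pi]
  simp [LinearMap.det_toLin']

theorem lintegral_comp_rows {ι κ : Type*} [Fintype ι] [Fintype κ] [DecidableEq κ]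
    (T : Matrix κ κ ℝ) (hT : T.det ≠ 0) {G : (ι → κ → ℝ) → ℝ≥0∞} (hG : Measurable G) :
    ∫⁻ x : ι → κ → ℝ, G (fun i => T *ᵥ x i) =
      ENNReal.ofReal |T.det|⁻¹ ^ Fintype.card ι * ∫⁻ x, G x := by
  have h := lintegral_comp_linearMap (volume : Measure (ι → κ → ℝ))
    (LinearMap.pi fun i : ι => (Matrix.toLin' T).comp
      (LinearMap.proj i : (ι → κ → ℝ) →ₗ[ℝ] κ → ℝ))
    (by rw [det_pi_mulRight]; exact pow_ne_zero _ hT) hG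
  rw [det_pi_mulRight, ← inv_pow, abs_pow, ENNReal.ofReal_pow (abs_nonneg _), abs_inv] at h
  exact h

/-- The matrix mixes the points, not their coordinates. Transposing the array turns this into the
same matrix acting on each coordinate column, hence one Jacobian factor per coordinate. -/
theorem lintegral_comp_columns {ι κ : Type*} [Fintype ι] [Fintype κ] [DecidableEq ι]
    (B : Matrix ι ι ℝ) (hB : B.det ≠ 0) {G : (ι → κ → ℝ) → ℝ≥0∞} (hG : Measurable G) :
    ∫⁻ x : ι → κ → ℝ, G (fun i k => ∑ j, B i j * x j k) =
      ENNReal.ofReal |B.det|⁻¹ ^ Fintype.card κ * ∫⁻ x, G x := by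
  set e : (κ → ι → ℝ) ≃ₗ[ℝ] (ι → κ → ℝ) := Matrix.transposeLinearEquiv κ ι ℝ ℝ with he
  set f : (κ → ι → ℝ) →ₗ[ℝ] (κ → ι → ℝ) := LinearMap.pi fun i : κ => (Matrix.toLin' B).comp
      (LinearMap.proj i : (κ → ι → ℝ) →ₗ[ℝ] ι → ℝ) with hf
  have hdet : LinearMap.det ((e : (κ → ι → ℝ) →ₗ[ℝ] (ι → κ → ℝ)) ∘ₗ f ∘ₗ
      (e.symm : (ι → κ → ℝ) →ₗ[ℝ] (κ → ι → ℝ))) = B.det ^ Fintype.card κ := by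
    rw [LinearMap.det_conj, hf, det_pi_mulRight]
  have h := lintegral_comp_linearMap (volume : Measure (ι → κ → ℝ))
    ((e : (κ → ι → ℝ) →ₗ[ℝ] (ι → κ → ℝ)) ∘ₗ f ∘ₗ
      (e.symm : (ι → κ → ℝ) →ₗ[ℝ] (κ → ι → ℝ)))
    (by rw [hdet]; exact pow_ne_zero _ hB) hG
  rw [hdet, ← inv_pow, abs_pow, ENNReal.ofReal_pow (abs_nonneg _), abs_inv] at h
  exact h

/-! ### Degenerate configurations form a null set. -/

theorem ae_det_add_smul_one_ne_zero {r : ℕ} (M : Matrix (Fin r) (Fin r) ℝ) :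
    ∀ᵐ t : ℝ, (M + t • 1).det ≠ 0 := by
  have hfin : {t : ℝ | (M + t • 1).det = 0} ⊆ ((-M).charpoly.roots.toFinset : Set ℝ) := by
    intro t ht
    have : (-M).charpoly.eval t = 0 := by
      rw [Matrix.eval_charpoly, ← ht.out]
      congr 1
      simp [Matrix.scalar_apply, add_comm, Matrix.smul_one_eq_diagonal]
    simpa [(Matrix.charpoly_monic (-M)).ne_zero] using this
  have : volume {t : ℝ | (M + t • 1).det = 0} = 0 :=
    measure_mono_null hfin (Finset.measure_zero _ _)
  simpa [ae_iff] using this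

theorem continuous_det_edgeMatrix {r : ℕ} :
    Continuous fun y : Fin (r + 1) → Fin r → ℝ => (edgeMatrix y).det := by
  refine Continuous.matrix_det ?_
  unfold edgeMatrix
  fun_prop

/-- Translating by t times a configuration whose edge matrix is the identity adds t·1 to the edge
matrix. Each such line meets the degenerate set only at eigenvalues, so a Fubini argument along the
lines applies. -/
theorem ae_det_onesLeft_ne_zero (r : ℕ) :
    ∀ᵐ y : Fin (r + 1) → Fin r → ℝ, (onesLeft y).det ≠ 0 := by
  simp_rw [det_onesLeft]
  let v : Fin (r + 1) → Fin r → ℝ := Fin.cons 0 fun i k => (1 : Matrix (Fin r) (Fin r) ℝ) i k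
  have hs : MeasurableSet {y : Fin (r + 1) → Fin r → ℝ | (edgeMatrix y).det ≠ 0} :=
    (isOpen_ne_fun continuous_det_edgeMatrix continuous_const).measurableSet
  refine ae_mem_of_ae_add_linearMap_mem
    (LinearMap.toSpanSingleton ℝ (Fin (r + 1) → Fin r → ℝ) v) volume volume hs fun y => ?_
  filter_upwards [ae_det_add_smul_one_ne_zero (edgeMatrix y)] with t ht
  convert! ht using 3
  ext i k
  simp only [edgeMatrix, v, Matrix.of_apply, LinearMap.toSpanSingleton_apply, Pi.add_apply,
    Pi.smul_apply, Fin.cons_succ, Fin.cons_zero, Pi.zero_apply, smul_eq_mul, mul_zero, add_zero,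
    Matrix.add_apply, Matrix.smul_apply]
  ring

/-! ### The affine Blaschke–Petkantschin formula -/

theorem Matrix.PosDef.exists_transpose_mul_self {κ : Type*} [Fintype κ] [DecidableEq κ]
    {M : Matrix κ κ ℝ} (hM : M.PosDef) :
    ∃ Q : Matrix κ κ ℝ, Qᵀ * Q = M ∧ Q.det ≠ 0 ∧ |Q.det| = √M.det := by
  open scoped MatrixOrder in
  obtain ⟨Q, hQ⟩ := CStarAlgebra.nonneg_iff_eq_star_mul_self.mp hM.posSemidef.nonneg
  have hQ' : Qᵀ * Q = M := by
    rw [hQ, Matrix.star_eq_conjTranspose, Matrix.conjTranspose_eq_transpose_of_trivial]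
  have hd : Q.det * Q.det = M.det := by rw [← hQ', Matrix.det_mul, Matrix.det_transpose]
  refine ⟨Q, hQ', fun h => ?_, ?_⟩
  · have := hM.det_pos
    rw [← hd, h] at this
    simp at this
  · rw [← hd, Real.sqrt_mul_self_eq_abs]

theorem posDef_one_add_mul_transpose {κ η : Type*} [Fintype κ] [DecidableEq κ] [Fintype η]
    (A : Matrix κ η ℝ) : (1 + A * Aᵀ).PosDef := by
  refine Matrix.PosDef.one.add_posSemidef ?_
  rw [← Matrix.conjTranspose_eq_transpose_of_trivial]
  exact Matrix.posSemidef_self_mul_conjTranspose A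

open Matrix in
theorem mulVec_dotProduct_mulVec {κ : Type*} [Fintype κ] (N : Matrix κ κ ℝ) (u v : κ → ℝ) :
    (N *ᵥ u) ⬝ᵥ (N *ᵥ v) = u ⬝ᵥ ((Nᵀ * N) *ᵥ v) := by
  rw [← mulVec_mulVec, dotProduct_mulVec u, vecMul_transpose]

open Matrix in
-- This is Pythagoras for the flat {(x, b + xA)}. Its point closest to the origin is x = -z, at
-- squared distance bᵀ(1 + AᵀA)⁻¹b = |Qb|², and T maps x + z to orthonormal coordinates on the flat.
theorem dotProduct_add_dotProduct_graph {κ η : Type*} [Fintype κ] [DecidableEq κ] [Fintype η]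
    [DecidableEq η] (A : Matrix κ η ℝ) {T : Matrix κ κ ℝ} (hT : Tᵀ * T = 1 + A * Aᵀ)
    {Q : Matrix η η ℝ} (hQ : Qᵀ * Q = (1 + Aᵀ * A)⁻¹) (b : η → ℝ) {z : κ → ℝ}
    (hz : (1 + A * Aᵀ) *ᵥ z = A *ᵥ b) (p q : κ → ℝ) :
    p ⬝ᵥ q + (b + p ᵥ* A) ⬝ᵥ (b + q ᵥ* A) =
      (Q *ᵥ b) ⬝ᵥ (Q *ᵥ b) + (T *ᵥ (p + z)) ⬝ᵥ (T *ᵥ (q + z)) := by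
  have hdet : IsUnit (1 + Aᵀ * A).det := by
    have := (posDef_one_add_mul_transpose Aᵀ).det_pos
    rw [transpose_transpose] at this
    exact this.ne'.isUnit
  have hR : (1 + Aᵀ * A)⁻¹ *ᵥ b = b - Aᵀ *ᵥ z := by
    have h1 : (1 + Aᵀ * A) *ᵥ (b - Aᵀ *ᵥ z) = b := by
      -- Push-through identity (1 + AᵀA)Aᵀ = Aᵀ(1 + AAᵀ).
      have h2 : (1 + Aᵀ * A) *ᵥ (Aᵀ *ᵥ z) = Aᵀ *ᵥ ((1 + A * Aᵀ) *ᵥ z) := by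
        simp only [mulVec_mulVec, Matrix.add_mul, Matrix.mul_add, Matrix.one_mul, Matrix.mul_one,
          Matrix.mul_assoc]
      rw [mulVec_sub, h2, hz, add_mulVec, one_mulVec, mulVec_mulVec]
      abel
    conv_lhs => rw [← h1]
    rw [mulVec_mulVec, nonsing_inv_mul _ hdet, one_mulVec]
  rw [mulVec_dotProduct_mulVec, mulVec_dotProduct_mulVec, hQ, hT, hR, mulVec_add, hz]
  simp only [add_dotProduct, dotProduct_add, dotProduct_sub, add_mulVec, one_mulVec]
  have e1 : b ⬝ᵥ Aᵀ *ᵥ z = z ⬝ᵥ A *ᵥ b := by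
    rw [dotProduct_mulVec, vecMul_transpose, dotProduct_comm]
  have e2 : b ⬝ᵥ q ᵥ* A = z ⬝ᵥ q + z ⬝ᵥ (A * Aᵀ) *ᵥ q := by
    have : b ⬝ᵥ q ᵥ* A = (A *ᵥ b) ⬝ᵥ q := by
      rw [dotProduct_comm, ← dotProduct_mulVec, dotProduct_comm]
    rw [this, ← hz, add_mulVec, one_mulVec, add_dotProduct]
    congr 1
    rw [dotProduct_comm, dotProduct_mulVec, dotProduct_comm, ← mulVec_transpose, transpose_mul,
      transpose_transpose]
  have e3 : p ᵥ* A ⬝ᵥ b = p ⬝ᵥ A *ᵥ b := by rw [← dotProduct_mulVec]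
  have e4 : p ᵥ* A ⬝ᵥ q ᵥ* A = p ⬝ᵥ (A * Aᵀ) *ᵥ q := by
    rw [← mulVec_mulVec, dotProduct_mulVec p, mulVec_transpose]
  rw [e1, e2, e3, e4]
  ring

theorem onesLeft_apply_sum {r : ℕ} {κ : Type*} (x : Fin (r + 1) → Fin r → ℝ)
    (b : κ → ℝ) (A : Fin r → κ → ℝ) (i : Fin (r + 1)) :
    (fun k => ∑ j, onesLeft x i j * (Fin.cons b A : Fin (r + 1) → κ → ℝ) j k) =
      b + x i ᵥ* (Matrix.of A) := by
  ext k
  simp [Fin.sum_univ_succ, onesLeft, Matrix.vecMul, dotProduct]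

theorem det_onesLeft_mulVec_add {r : ℕ} (T : Matrix (Fin r) (Fin r) ℝ) (z : Fin r → ℝ)
    (x : Fin (r + 1) → Fin r → ℝ) :
    (onesLeft fun i => T *ᵥ (x i + z)).det = T.det * (onesLeft x).det := by
  have h : edgeMatrix (fun i => T *ᵥ (x i + z)) = edgeMatrix x * Tᵀ := by
    ext i k
    simp only [edgeMatrix, Matrix.of_apply, Matrix.mul_apply, Matrix.transpose_apply,
      Matrix.mulVec, dotProduct, ← Finset.sum_sub_distrib, Pi.add_apply]
    exact Finset.sum_congr rfl fun _ _ => by ring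
  rw [det_onesLeft, det_onesLeft, h, Matrix.det_mul, Matrix.det_transpose, mul_comm]

theorem measurable_det_onesLeft {r : ℕ} :
    Measurable fun y : Fin (r + 1) → Fin r → ℝ => (onesLeft y).det := by
  simp_rw [det_onesLeft]
  exact continuous_det_edgeMatrix.measurable

/-- Substitute y = T(x + z). Each of the r + 1 points contributes a factor |det T|⁻¹, and the d-th
power of the determinant contributes |det T|⁻ᵈ, where |det T| = √det(1 + AAᵀ). -/
theorem lintegral_graph_flat {r d : ℕ} (A : Matrix (Fin r) (Fin d) ℝ)
    {Q : Matrix (Fin d) (Fin d) ℝ} (hQ : Qᵀ * Q = (1 + Aᵀ * A)⁻¹) (b : Fin d → ℝ)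
    {Ψ : (Fin (r + 1) → Fin (r + 1) → ℝ) → ℝ≥0∞} (hΨ : Measurable Ψ) :
    ∫⁻ x : Fin (r + 1) → Fin r → ℝ, ENNReal.ofReal |(onesLeft x).det| ^ d *
        Ψ (gramArray x + gramArray fun i => b + x i ᵥ* A) =
      ENNReal.ofReal (√(1 + A * Aᵀ).det)⁻¹ ^ (d + (r + 1)) *
        ∫⁻ y : Fin (r + 1) → Fin r → ℝ, ENNReal.ofReal |(onesLeft y).det| ^ d *
          Ψ (fun i j => (Q *ᵥ b) ⬝ᵥ (Q *ᵥ b) + gramArray y i j) := by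
  have hS := posDef_one_add_mul_transpose A
  obtain ⟨T, hT, hT0, hTdet⟩ := hS.exists_transpose_mul_self
  set z : Fin r → ℝ := (1 + A * Aᵀ)⁻¹ *ᵥ (A *ᵥ b) with hzdef
  have hz : (1 + A * Aᵀ) *ᵥ z = A *ᵥ b := by
    rw [hzdef, Matrix.mulVec_mulVec, Matrix.mul_nonsing_inv _ hS.det_pos.ne'.isUnit,
      Matrix.one_mulVec]
  set F : (Fin (r + 1) → Fin r → ℝ) → ℝ≥0∞ := fun y => ENNReal.ofReal |(onesLeft y).det| ^ d *
          Ψ (fun i j => (Q *ᵥ b) ⬝ᵥ (Q *ᵥ b) + gramArray y i j) with hF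
  have hFm : Measurable F := by
    refine (measurable_det_onesLeft.abs.ennreal_ofReal.pow_const d).mul (hΨ.comp ?_)
    have := measurable_gramArray (ι := Fin (r + 1)) (κ := Fin r)
    fun_prop
  have h1 : ∀ x : Fin (r + 1) → Fin r → ℝ, ENNReal.ofReal |(onesLeft x).det| ^ d *
        Ψ (gramArray x + gramArray fun i => b + x i ᵥ* A) =
      ENNReal.ofReal |T.det|⁻¹ ^ d * F (fun i => T *ᵥ ((x + fun _ => z : Fin (r + 1) → Fin r → ℝ) i)) := by
    intro x
    have hg : (gramArray x + gramArray fun i => b + x i ᵥ* A) = fun i j =>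
        (Q *ᵥ b) ⬝ᵥ (Q *ᵥ b) + gramArray (fun i => T *ᵥ (x i + z)) i j := by
      ext i j
      exact dotProduct_add_dotProduct_graph A hT hQ b hz (x i) (x j)
    simp only [hF, Pi.add_apply, det_onesLeft_mulVec_add, hg]
    rw [← mul_assoc, ← mul_pow, ← ENNReal.ofReal_mul (by positivity), abs_mul, ← mul_assoc,
      inv_mul_cancel₀ (abs_ne_zero.2 hT0), one_mul]
  simp_rw [h1]
  rw [lintegral_const_mul' _ _ (by finiteness),
    lintegral_add_right_eq_self (fun x : Fin (r + 1) → Fin r → ℝ => F fun i => T *ᵥ x i)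
      (fun _ => z), lintegral_comp_rows T hT0 hFm, ← mul_assoc, hTdet, pow_add,
      Fintype.card_fin]

/-- The affine Blaschke–Petkantschin formula for `r + 1` points in `ℝʳ × ℝᵈ`, for functions of the
Gram matrix. -/
theorem exists_lintegral_gramArray_eq (r d : ℕ) : ∃ K : ℝ≥0∞,
    ∀ Ψ : (Fin (r + 1) → Fin (r + 1) → ℝ) → ℝ≥0∞, Measurable Ψ →
      ∫⁻ x : Fin (r + 1) → Fin r → ℝ, ∫⁻ c : Fin (r + 1) → Fin d → ℝ,
          Ψ (gramArray x + gramArray c) =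
        K * ∫⁻ b : Fin d → ℝ, ∫⁻ y : Fin (r + 1) → Fin r → ℝ,
          ENNReal.ofReal |(onesLeft y).det| ^ d * Ψ (fun i j => b ⬝ᵥ b + gramArray y i j) := by
  -- The constant collects all that depends only on the slope A: the Jacobian of flattening the
  -- graph and that of replacing b by Qb. Its finiteness plays no role here and is obtained later
  -- from a Gaussian test function.
  refine ⟨∫⁻ A : Fin r → Fin d → ℝ,
    ENNReal.ofReal (√(1 + Matrix.of A * (Matrix.of A)ᵀ).det)⁻¹ ^ (d + (r + 1)) *
    ENNReal.ofReal (√(1 + (Matrix.of A)ᵀ * Matrix.of A).det), fun Ψ hΨ => ?_⟩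
  have hgr := measurable_gramArray (ι := Fin (r + 1)) (κ := Fin r)
  have hgd := measurable_gramArray (ι := Fin (r + 1)) (κ := Fin d)
  have hol := measurable_det_onesLeft (r := r)
  set H : (Fin (r + 1) → Fin r → ℝ) → (Fin (r + 1) → Fin d → ℝ) → ℝ≥0∞ := fun x u =>
    ENNReal.ofReal |(onesLeft x).det| ^ d *
      Ψ (gramArray x + gramArray fun i k => ∑ j, onesLeft x i j * u j k) with hH
  have holc : Continuous fun y : Fin (r + 1) → Fin r → ℝ => onesLeft y := by
    refine continuous_matrix fun i j => ?_
    refine Fin.cases ?_ (fun j => ?_) j <;> simp [onesLeft] <;> fun_prop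
  have hHm : Measurable (Function.uncurry H) := by
    refine ((hol.comp measurable_fst).abs.ennreal_ofReal.pow_const d).mul (hΨ.comp ?_)
    refine (hgr.comp measurable_fst).add (hgd.comp ?_)
    refine Continuous.measurable ?_
    have : ∀ i j, Continuous fun p : (Fin (r + 1) → Fin r → ℝ) × (Fin (r + 1) → Fin d → ℝ) =>
        onesLeft p.1 i j := fun i j => (holc.comp continuous_fst).matrix_elem i j
    fun_prop
  -- For affinely independent x the remaining coordinates c are interpolated by a unique affine map
  -- x ↦ b + xA. The coefficients u = (b, A) replace c, with Jacobian |det (onesLeft x)|^d.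
  have hA : ∫⁻ x : Fin (r + 1) → Fin r → ℝ, ∫⁻ c : Fin (r + 1) → Fin d → ℝ,
      Ψ (gramArray x + gramArray c) = ∫⁻ x, ∫⁻ u, H x u := by
    refine lintegral_congr_ae ?_
    filter_upwards [ae_det_onesLeft_ne_zero r] with x hx
    simp only [hH]
    rw [lintegral_const_mul' _ _ (by finiteness),
      lintegral_comp_columns (onesLeft x) hx (G := fun c => Ψ (gramArray x + gramArray c))
        (hΨ.comp (hgd.const_add _)), ← mul_assoc, Fintype.card_fin, ← mul_pow,
        ← ENNReal.ofReal_mul (abs_nonneg _), mul_inv_cancel₀ (abs_ne_zero.2 hx)]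
    simp
  set I : ℝ → ℝ≥0∞ := fun s => ∫⁻ y : Fin (r + 1) → Fin r → ℝ,
    ENNReal.ofReal |(onesLeft y).det| ^ d * Ψ (fun i j => s + gramArray y i j) with hI
  have hIm : Measurable I := by
    refine Measurable.lintegral_prod_right' (f := fun p : ℝ × (Fin (r + 1) → Fin r → ℝ) =>
      ENNReal.ofReal |(onesLeft p.2).det| ^ d * Ψ (fun i j => p.1 + gramArray p.2 i j)) ?_
    refine ((hol.comp measurable_snd).abs.ennreal_ofReal.pow_const d).mul (hΨ.comp ?_)
    fun_prop
  have hsplit : ∫⁻ u : Fin (r + 1) → Fin d → ℝ, ∫⁻ x, H x u =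
      ∫⁻ A : Fin r → Fin d → ℝ, ∫⁻ b : Fin d → ℝ, ∫⁻ x, H x (Fin.cons b A) := by
    have hm : Measurable fun u : Fin (r + 1) → Fin d → ℝ => ∫⁻ x, H x u :=
      hHm.lintegral_prod_left'
    have hp := (volume_preserving_piFinSuccAbove (fun _ : Fin (r + 1) => Fin d → ℝ) 0).symm
    rw [← hp.lintegral_comp hm, Measure.volume_eq_prod, lintegral_prod_symm']
    · simp [MeasurableEquiv.piFinSuccAbove, Fin.insertNthEquiv]
    · exact hm.comp (MeasurableEquiv.measurable _)
  rw [hA, lintegral_lintegral_swap hHm.aemeasurable, hsplit]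
  rw [← lintegral_mul_const]
  · refine lintegral_congr fun A => ?_
    have hR := posDef_one_add_mul_transpose (Matrix.of A)ᵀ
    rw [Matrix.transpose_transpose] at hR
    obtain ⟨Q, hQ, hQ0, hQdet⟩ := hR.inv.exists_transpose_mul_self
    have h1 : ∀ b : Fin d → ℝ, ∫⁻ x, H x (Fin.cons b A) =
        ENNReal.ofReal (√(1 + Matrix.of A * (Matrix.of A)ᵀ).det)⁻¹ ^ (d + (r + 1)) *
          I ((Q *ᵥ b) ⬝ᵥ (Q *ᵥ b)) := by
      intro b
      rw [hI, ← lintegral_graph_flat (Matrix.of A) hQ b hΨ]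
      simp only [hH]
      refine lintegral_congr fun x => ?_
      rw [← funext fun i => onesLeft_apply_sum x b A i]
    simp_rw [h1]
    rw [lintegral_const_mul' _ _ (by finiteness), mul_assoc]
    congr 1
    have h2 := lintegral_comp_linearMap (volume : Measure (Fin d → ℝ)) (Matrix.toLin' Q)
      (by rwa [LinearMap.det_toLin']) (G := fun b => I (b ⬝ᵥ b))
      (hIm.comp (by unfold dotProduct; fun_prop))
    simp only [Matrix.toLin'_apply, LinearMap.det_toLin'] at h2
    rw [h2, abs_inv, hQdet, Matrix.det_nonsing_inv, Ring.inverse_eq_inv', Real.sqrt_inv, inv_inv]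
  · have hc : Continuous fun A : Fin r → Fin d → ℝ => Matrix.of A := continuous_id
    have c1 : Continuous fun A : Fin r → Fin d → ℝ => (1 + Matrix.of A * (Matrix.of A)ᵀ).det :=
      (continuous_const.add (hc.matrix_mul hc.matrix_transpose)).matrix_det
    have c2 : Continuous fun A : Fin r → Fin d → ℝ => (1 + (Matrix.of A)ᵀ * Matrix.of A).det :=
      (continuous_const.add (hc.matrix_transpose.matrix_mul hc)).matrix_det
    exact (c1.measurable.sqrt.inv.ennreal_ofReal.pow_const _).mul c2.measurable.sqrt.ennreal_ofReal

/-! ### Radial integration -/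

theorem lintegral_eq_lintegral_sphere {E : Type*} [NormedAddCommGroup E] [NormedSpace ℝ E]
    [MeasurableSpace E] [BorelSpace E] [FiniteDimensional ℝ E] [Nontrivial E] (μ : Measure E)
    [μ.IsAddHaarMeasure] {F : E → ℝ≥0∞} (hF : Measurable F) :
    ∫⁻ x, F x ∂μ = ∫⁻ u : Metric.sphere (0 : E) 1, (∫⁻ t in Set.Ioi (0 : ℝ),
      ENNReal.ofReal (t ^ (Module.finrank ℝ E - 1)) * F (t • (u : E))) ∂μ.toSphere := by
  have hmp := μ.measurePreserving_homeomorphUnitSphereProd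
  set G : Metric.sphere (0 : E) 1 × Set.Ioi (0 : ℝ) → ℝ≥0∞ := fun q => F ((q.2 : ℝ) • (q.1 : E))
  have hG : Measurable G := by
    refine hF.comp ?_
    fun_prop
  have h1 := hmp.lintegral_comp hG
  have h2 : ∀ x : ({0}ᶜ : Set E), G (homeomorphUnitSphereProd E x) = F x := by
    intro x
    have : ‖(x : E)‖ ≠ 0 := norm_ne_zero_iff.2 x.2
    simp [G, smul_smul, this]
  simp_rw [h2] at h1
  rw [lintegral_subtype_comap (measurableSet_singleton _).compl,
    restrict_compl_singleton, lintegral_prod _ hG.aemeasurable] at h1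
  rw [h1]
  refine lintegral_congr fun u => ?_
  have hGu : Measurable fun t : Set.Ioi (0 : ℝ) => G (u, t) := hG.comp (by fun_prop)
  rw [Measure.volumeIoiPow, lintegral_withDensity_eq_lintegral_mul _ (by fun_prop) hGu]
  exact lintegral_subtype_comap measurableSet_Ioi
    (fun t : ℝ => ENNReal.ofReal (t ^ (Module.finrank ℝ E - 1)) * F (t • (u : E)))

theorem lintegral_Ioi_eq_lintegral_sq (g : ℝ → ℝ≥0∞) :
    ∫⁻ s in Set.Ioi (0 : ℝ), g s = ∫⁻ t in Set.Ioi (0 : ℝ), ENNReal.ofReal (2 * t) * g (t ^ 2) := by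
  have himg : (fun t : ℝ => t ^ 2) '' Set.Ioi 0 = Set.Ioi 0 := by
    ext s
    constructor
    · rintro ⟨t, ht, rfl⟩
      exact pow_pos (Set.mem_Ioi.1 ht) 2
    · intro hs
      exact ⟨√s, Real.sqrt_pos.2 hs, Real.sq_sqrt (le_of_lt hs)⟩
  have h := lintegral_image_eq_lintegral_abs_deriv_mul (s := Set.Ioi (0 : ℝ)) measurableSet_Ioi
    (f := fun t => t ^ 2) (f' := fun t => 2 * t)
    (fun x _ => by simpa using (hasDerivAt_pow 2 x).hasDerivWithinAt)
    (fun a ha b hb hab => (sq_eq_sq₀ (le_of_lt ha) (le_of_lt hb)).1 hab) g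
  rw [himg] at h
  rw [h]
  refine setLIntegral_congr_fun measurableSet_Ioi fun t ht => ?_
  rw [abs_of_pos (mul_pos two_pos ht)]

/-- The radial integral `∫₀^∞ s ^ ((n + p) / 2 - 1) f s ds`. -/
noncomputable def radialMoment (n : ℕ) (p : ℝ) (f : ℝ → ℝ≥0∞) : ℝ≥0∞ :=
  ∫⁻ s in Set.Ioi (0 : ℝ), ENNReal.ofReal (s ^ (((n : ℝ) + p) / 2 - 1)) * f s

/-- In polar coordinates the integrand separates, and s = t² turns the radial part into
`radialMoment`; c is half the integral of H over the sphere. It does not depend on f, which is what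
permits exchanging weights. For H = 1 it is a genuine positive constant. -/
theorem lintegral_radial_mul_homogeneous {n : ℕ} (hn : 1 ≤ n) {p : ℝ} {H : (Fin n → ℝ) → ℝ≥0∞}
    (hH : Measurable H) (hom : ∀ t : ℝ, 0 < t → ∀ x, H (t • x) = ENNReal.ofReal t ^ p * H x) :
    ∃ c : ℝ≥0∞, ((∀ x, H x = 1) → c ≠ 0 ∧ c ≠ ∞) ∧ ∀ f : ℝ → ℝ≥0∞, Measurable f →
      ∫⁻ x : Fin n → ℝ, f (x ⬝ᵥ x) * H x = c * radialMoment n p f := by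
  have : Nonempty (Fin n) := ⟨⟨0, hn⟩⟩
  let S := (volume : Measure (EuclideanSpace ℝ (Fin n))).toSphere
  have hmo : Measurable fun x : EuclideanSpace ℝ (Fin n) => x.ofLp :=
    (PiLp.continuous_ofLp 2 _).measurable
  have hHS : Measurable fun u : Metric.sphere (0 : EuclideanSpace ℝ (Fin n)) 1 =>
      H (u : EuclideanSpace ℝ (Fin n)).ofLp := hH.comp (hmo.comp measurable_subtype_coe)
  refine ⟨2⁻¹ * ∫⁻ u, H (u : EuclideanSpace ℝ (Fin n)).ofLp ∂S, fun h1 => ?_, fun f hf => ?_⟩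
  · have hS : S ≠ 0 := Measure.toSphere_ne_zero _
    simp only [h1, lintegral_one]
    refine ⟨mul_ne_zero (by simp) ?_, ?_⟩
    · simpa using hS
    · exact ENNReal.mul_ne_top (by simp) (measure_ne_top S _)
  · have hvp := EuclideanSpace.volume_preserving_symm_measurableEquiv_toLp (Fin n)
    have hFm : Measurable fun x : Fin n → ℝ => f (x ⬝ᵥ x) * H x := by
      refine (hf.comp ?_).mul hH
      unfold dotProduct
      fun_prop
    refine (hvp.lintegral_comp hFm).symm.trans
      ((lintegral_eq_lintegral_sphere volume (hFm.comp hvp.measurable)).trans ?_)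
    rw [mul_assoc, mul_comm (∫⁻ _, _ ∂S), ← mul_assoc, mul_comm _ (∫⁻ _, _ ∂S),
      ← lintegral_mul_const _ hHS]
    refine lintegral_congr fun u => ?_
    have hu : (u : EuclideanSpace ℝ (Fin n)).ofLp ⬝ᵥ (u : EuclideanSpace ℝ (Fin n)).ofLp = 1 := by
      have h1 : ‖(u : EuclideanSpace ℝ (Fin n))‖ = 1 := by simp
      have h2 := EuclideanSpace.real_norm_sq_eq (u : EuclideanSpace ℝ (Fin n))
      rw [h1] at h2
      simpa [dotProduct, sq] using h2.symm
    have hrad : radialMoment n p f = _ := lintegral_Ioi_eq_lintegral_sq _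
    rw [hrad, ← lintegral_const_mul' _ _ (by simp),
      ← lintegral_const_mul]
    · refine setLIntegral_congr_fun measurableSet_Ioi fun t ht => ?_
      have ht : 0 < t := ht
      change ENNReal.ofReal (t ^ (Module.finrank ℝ (EuclideanSpace ℝ (Fin n)) - 1)) *
        (f ((t • (u : EuclideanSpace ℝ (Fin n)).ofLp) ⬝ᵥ
          (t • (u : EuclideanSpace ℝ (Fin n)).ofLp)) *
          H (t • (u : EuclideanSpace ℝ (Fin n)).ofLp)) = _
      rw [hom t ht, smul_dotProduct, dotProduct_smul, hu, finrank_euclideanSpace, Fintype.card_fin]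
      have e1 : t • t • (1 : ℝ) = t ^ 2 := by simp [sq]
      rw [e1]
      have e2 : ENNReal.ofReal (t ^ (n - 1)) * ENNReal.ofReal t ^ p =
          2⁻¹ * (ENNReal.ofReal (2 * t) * ENNReal.ofReal ((t ^ 2) ^ (((n : ℝ) + p) / 2 - 1))) := by
        have h2 : (2⁻¹ : ℝ≥0∞) = ENNReal.ofReal 2⁻¹ := by
          rw [ENNReal.ofReal_inv_of_pos two_pos]; simp
        rw [ENNReal.ofReal_rpow_of_pos ht, ← ENNReal.ofReal_mul (by positivity),
          ← ENNReal.ofReal_mul (by positivity), h2, ← ENNReal.ofReal_mul (by positivity)]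
        congr 1
        rw [← Real.rpow_natCast t 2, ← Real.rpow_mul ht.le, ← Real.rpow_natCast t (n - 1),
          ← Real.rpow_add ht, ← mul_assoc, ← mul_assoc]
        rw [inv_mul_cancel₀ two_ne_zero, one_mul]
        have h3 : ∀ w : ℝ, t * t ^ w = t ^ (1 + w) := fun w => by
          rw [Real.rpow_add ht, Real.rpow_one]
        rw [h3]
        congr 1
        rw [Nat.cast_sub hn]
        push_cast
        ring
      calc _ = (ENNReal.ofReal (t ^ (n - 1)) * ENNReal.ofReal t ^ p) *
            (H (u : EuclideanSpace ℝ (Fin n)).ofLp * f (t ^ 2)) := by ring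
        _ = _ := by rw [e2]; ring
    · refine Measurable.const_mul (Measurable.mul (by fun_prop) ?_) _
      exact (by fun_prop : Measurable fun t : ℝ =>
        ENNReal.ofReal ((t ^ 2) ^ (((n : ℝ) + p) / 2 - 1))).mul (hf.comp (measurable_id.pow_const 2))

theorem measurable_fin_cons {α : Type*} [MeasurableSpace α] {m : ℕ} :
    Measurable fun q : α × (Fin m → α) => (Fin.cons q.1 q.2 : Fin (m + 1) → α) := by
  refine measurable_pi_iff.2 fun i => ?_
  refine Fin.cases ?_ (fun i => ?_) i
  · simpa using measurable_fst
  · simp only [Fin.cons_succ]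
    exact (measurable_pi_apply i).comp measurable_snd

theorem lintegral_fin_cons {α : Type*} [MeasureSpace α] [SigmaFinite (volume : Measure α)] {m : ℕ}
    {F : (Fin (m + 1) → α) → ℝ≥0∞} (hF : Measurable F) :
    ∫⁻ x : Fin (m + 1) → α, F x = ∫⁻ v : α, ∫⁻ x : Fin m → α, F (Fin.cons v x) := by
  have hp := (volume_preserving_piFinSuccAbove (fun _ : Fin (m + 1) => α) 0).symm
  refine (hp.lintegral_comp hF).symm.trans ?_
  rw [Measure.volume_eq_prod]
  refine (lintegral_prod _ (hF.comp hp.measurable).aemeasurable).trans ?_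
  simp [MeasurableEquiv.piFinSuccAbove, Fin.insertNthEquiv]

/-- Replacing the radial weight `f` by `g` in the integral of a function which is homogeneous of
degree `p` in each of its `m` vector arguments. -/
theorem radialMoment_pow_mul_lintegral_comm {n : ℕ} (hn : 1 ≤ n) {p : ℝ} {f g : ℝ → ℝ≥0∞}
    (hf : Measurable f) (hg : Measurable g) (m : ℕ) {H : (Fin m → Fin n → ℝ) → ℝ≥0∞}
    (hH : Measurable H)
    (hom : ∀ i, ∀ t : ℝ, 0 < t → ∀ x,
      H (Function.update x i (t • x i)) = ENNReal.ofReal t ^ p * H x)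
    (hfr : radialMoment n p f ≠ ∞) (hgr : radialMoment n p g ≠ ∞) :
    radialMoment n p g ^ m * ∫⁻ x : Fin m → Fin n → ℝ, (∏ i, f (x i ⬝ᵥ x i)) * H x =
      radialMoment n p f ^ m * ∫⁻ x : Fin m → Fin n → ℝ, (∏ i, g (x i ⬝ᵥ x i)) * H x := by
  induction m with
  | zero => simp
  | succ m ih =>
    have hdot : Measurable fun v : Fin n → ℝ => v ⬝ᵥ v := by unfold dotProduct; fun_prop
    have hcons := measurable_fin_cons (α := Fin n → ℝ) (m := m)
    have hprod : ∀ w : ℝ → ℝ≥0∞, Measurable w →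
        Measurable fun x : Fin m → Fin n → ℝ => ∏ i, w (x i ⬝ᵥ x i) := fun w hw =>
      Finset.measurable_prod _ fun i _ => hw.comp (hdot.comp (measurable_pi_apply i))
    have hsplit : ∀ w : ℝ → ℝ≥0∞, Measurable w →
        ∫⁻ x : Fin (m + 1) → Fin n → ℝ, (∏ i, w (x i ⬝ᵥ x i)) * H x =
        ∫⁻ v : Fin n → ℝ, w (v ⬝ᵥ v) * ∫⁻ x : Fin m → Fin n → ℝ,
          (∏ i, w (x i ⬝ᵥ x i)) * H (Fin.cons v x) := by
      intro w hw
      have hmeas : Measurable fun x : Fin (m + 1) → Fin n → ℝ =>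
          (∏ i, w (x i ⬝ᵥ x i)) * H x :=
        (Finset.measurable_prod _ fun i _ => hw.comp (hdot.comp (measurable_pi_apply i))).mul hH
      rw [lintegral_fin_cons hmeas]
      refine lintegral_congr fun v => ?_
      have hm2 : Measurable fun x : Fin m → Fin n → ℝ =>
          (∏ i, w (x i ⬝ᵥ x i)) * H (Fin.cons v x) :=
        (hprod w hw).mul (hH.comp (hcons.comp measurable_prodMk_left))
      rw [← lintegral_const_mul _ hm2]
      refine lintegral_congr fun x => ?_
      simp [Fin.prod_univ_succ, mul_assoc]
    have hupd : ∀ (v : Fin n → ℝ) (x : Fin m → Fin n → ℝ) (i : Fin m) (t : ℝ), 0 < t →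
        H (Fin.cons v (Function.update x i (t • x i))) =
          ENNReal.ofReal t ^ p * H (Fin.cons v x) := by
      intro v x i t ht
      rw [← hom i.succ t ht, Fin.cons_update]
      simp
    have hupd0 : ∀ (v : Fin n → ℝ) (x : Fin m → Fin n → ℝ) (t : ℝ), 0 < t →
        H (Fin.cons (t • v) x) = ENNReal.ofReal t ^ p * H (Fin.cons v x) := by
      intro v x t ht
      rw [← hom 0 t ht, Fin.cons_zero, Fin.update_cons_zero]
    set Hg : (Fin n → ℝ) → ℝ≥0∞ := fun v => ∫⁻ x : Fin m → Fin n → ℝ,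
      (∏ i, g (x i ⬝ᵥ x i)) * H (Fin.cons v x) with hHg
    have hHgm : Measurable Hg := by
      refine Measurable.lintegral_prod_right' (f := fun q : (Fin n → ℝ) × (Fin m → Fin n → ℝ) =>
        (∏ i, g (q.2 i ⬝ᵥ q.2 i)) * H (Fin.cons q.1 q.2)) ?_
      exact ((hprod g hg).comp measurable_snd).mul (hH.comp hcons)
    -- After the other m vectors have been integrated against g, the remaining function is still
    -- homogeneous of degree p in the first one. The same constant c serves f and g, so only their
    -- radial moments differ.
    obtain ⟨c, -, hc⟩ := lintegral_radial_mul_homogeneous hn hHgm (p := p) (fun t ht v => by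
      simp only [hHg]
      rw [← lintegral_const_mul' _ _ (by
        rw [ENNReal.ofReal_rpow_of_pos ht]; exact ENNReal.ofReal_ne_top)]
      refine lintegral_congr fun x => ?_
      rw [hupd0 v x t ht]
      ring)
    have ih' : ∀ v : Fin n → ℝ, radialMoment n p g ^ m * ∫⁻ x : Fin m → Fin n → ℝ,
        (∏ i, f (x i ⬝ᵥ x i)) * H (Fin.cons v x) = radialMoment n p f ^ m * Hg v := fun v =>
      ih (hH.comp (hcons.comp measurable_prodMk_left)) fun i t ht x => hupd v x i t ht
    have hgm : radialMoment n p g ^ m ≠ ∞ := ENNReal.pow_ne_top hgr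
    have hfm : radialMoment n p f ^ m ≠ ∞ := ENNReal.pow_ne_top hfr
    calc radialMoment n p g ^ (m + 1) *
          ∫⁻ x : Fin (m + 1) → Fin n → ℝ, (∏ i, f (x i ⬝ᵥ x i)) * H x
        = radialMoment n p g * ∫⁻ v : Fin n → ℝ, f (v ⬝ᵥ v) * (radialMoment n p g ^ m *
            ∫⁻ x : Fin m → Fin n → ℝ, (∏ i, f (x i ⬝ᵥ x i)) * H (Fin.cons v x)) := by
          rw [hsplit f hf, pow_succ, mul_comm (_ ^ m), mul_assoc, ← lintegral_const_mul' _ _ hgm]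
          congr 1
          refine lintegral_congr fun v => ?_
          ring
      _ = radialMoment n p g * (radialMoment n p f ^ m * ∫⁻ v : Fin n → ℝ,
            f (v ⬝ᵥ v) * Hg v) := by
          simp_rw [ih']
          rw [← lintegral_const_mul' _ _ hfm]
          congr 1
          refine lintegral_congr fun v => ?_
          ring
      _ = radialMoment n p f ^ (m + 1) * ∫⁻ v : Fin n → ℝ, g (v ⬝ᵥ v) * Hg v := by
          rw [hc f hf, hc g hg]
          ring
      _ = _ := by rw [hsplit g hg]

/-! ### Moments of simplex volumes under radial weights -/

theorem lintegral_gauss_array_ne {ι κ : Type*} [Fintype ι] [Fintype κ] :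
    (∫⁻ x : ι → κ → ℝ, ∏ i, ENNReal.ofReal (Real.exp (-(gramArray x i i) / 2))) ≠ 0 ∧
    (∫⁻ x : ι → κ → ℝ, ∏ i, ENNReal.ofReal (Real.exp (-(gramArray x i i) / 2))) ≠ ∞ := by
  have hint : Integrable fun x : ι → κ → ℝ => ∏ i, ∏ k, Real.exp (-(x i k ^ 2) / 2) := by
    refine Integrable.fintype_prod (f := fun _ (v : κ → ℝ) => ∏ k, Real.exp (-(v k ^ 2) / 2))
      fun i => ?_
    refine Integrable.fintype_prod (f := fun _ (t : ℝ) => Real.exp (-(t ^ 2) / 2)) fun k => ?_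
    have := integrable_exp_neg_mul_sq (b := 1 / 2) (by norm_num)
    refine this.congr (ae_of_all _ fun t => ?_)
    ring_nf
  have heq : ∀ x : ι → κ → ℝ, ∏ i, ENNReal.ofReal (Real.exp (-(gramArray x i i) / 2)) =
      ENNReal.ofReal (∏ i, ∏ k, Real.exp (-(x i k ^ 2) / 2)) := by
    intro x
    rw [ENNReal.ofReal_prod_of_nonneg fun i _ => by positivity]
    refine Finset.prod_congr rfl fun i _ => ?_
    rw [← Real.exp_sum, gramArray, ← Finset.sum_div, ← Finset.sum_neg_distrib]
    simp_rw [sq]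
  simp_rw [heq]
  constructor
  · refine (lintegral_pos_iff_support ?_).2 ?_ |>.ne'
    · fun_prop
    · have : (Function.support fun x : ι → κ → ℝ =>
          ENNReal.ofReal (∏ i, ∏ k, Real.exp (-(x i k ^ 2) / 2))) = Set.univ := by
        ext x
        simp only [Function.mem_support, Set.mem_univ, iff_true, ne_eq, ENNReal.ofReal_eq_zero,
          not_le]
        positivity
      rw [this]
      exact NeZero.pos _
  · exact hint.lintegral_lt_top.ne

theorem lintegral_append_gramArray {ι : Type*} [Fintype ι] (r d : ℕ)
    {Ψ : (ι → ι → ℝ) → ℝ≥0∞} (hΨ : Measurable Ψ) :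
    ∫⁻ x : ι → Fin (r + d) → ℝ, Ψ (gramArray x) =
      ∫⁻ x : ι → Fin r → ℝ, ∫⁻ c : ι → Fin d → ℝ, Ψ (gramArray x + gramArray c) := by
  have m1 := (volume_measurePreserving_arrowProdEquivProdArrow (Fin r → ℝ) (Fin d → ℝ) ι).symm
  have m2 := (volume_measurePreserving_piCongrLeft (fun _ : Fin (r + d) => ℝ)
    finSumFinEquiv).comp (volume_measurePreserving_sumPiEquivProdPi_symm
      (fun _ : Fin r ⊕ Fin d => ℝ))
  have m3 := (volume_preserving_pi (fun _ : ι => m2)).comp m1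
  have hg := measurable_gramArray (ι := ι) (κ := Fin (r + d))
  refine (m3.lintegral_comp (hΨ.comp hg)).symm.trans ?_
  rw [Measure.volume_eq_prod]
  refine (lintegral_prod _ ((hΨ.comp hg).comp m3.measurable).aemeasurable).trans ?_
  refine lintegral_congr fun x => lintegral_congr fun c => ?_
  simp only [Function.comp_apply]
  congr 1
  ext i j
  simp only [gramArray, Pi.add_apply]
  rw [← finSumFinEquiv.sum_comp, Fintype.sum_sum_type]
  congr 1 <;> refine Finset.sum_congr rfl fun k _ => ?_ <;>
  · simp only [MeasurableEquiv.coe_piCongrLeft, Equiv.piCongrLeft_apply_apply]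
    rfl

/-- A radial weight `x ↦ f (|x|²)` whose restriction to every affine subspace is, up to a constant
factor, a rescaled copy of itself. -/
structure SliceProfile (f : ℝ → ℝ≥0∞) (c : ℝ → ℝ) : Prop where
  measurable : Measurable f
  measurable_scale : Measurable c
  scale_pos : ∀ s, 0 < c s
  slice : ∀ s u, 0 ≤ s → 0 ≤ u → f (s + u) = f s * f (u / c s)

/-- The weighted integral of the `q`-th power of `r!` times the volume of full dimensional
simplices. -/
noncomputable def fullMoment (f : ℝ → ℝ≥0∞) (r : ℕ) (q : ℝ) : ℝ≥0∞ :=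
  ∫⁻ y : Fin (r + 1) → Fin r → ℝ,
    (∏ i, f (gramArray y i i)) * ENNReal.ofReal |(onesLeft y).det| ^ q

/-- The weighted integral of the `p`-th power of `r!` times the volume of `r`-dimensional
simplices in `ℝⁿ`. -/
noncomputable def simplexMoment (f : ℝ → ℝ≥0∞) (n r : ℕ) (p : ℝ) : ℝ≥0∞ :=
  ∫⁻ x : Fin (r + 1) → Fin n → ℝ,
    (∏ i, f (gramArray x i i)) * ENNReal.ofReal (√(simplexGram (gramArray x))) ^ p

/-- The weighted integral of the `p`-th power of the volume of parallelotopes. -/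
noncomputable def detMoment (f : ℝ → ℝ≥0∞) (N : ℕ) (p : ℝ) : ℝ≥0∞ :=
  ∫⁻ x : Fin N → Fin N → ℝ,
    (∏ i, f (gramArray x i i)) * ENNReal.ofReal |(Matrix.of x).det| ^ p

/-- Evaluated on a Gaussian weight, the left side is positive and finite; this excludes K = 0, and
also K = ∞ because the other factor is then nonzero. -/
theorem exists_lintegral_gramArray_eq_of_ne (r d : ℕ) : ∃ K : ℝ≥0∞, K ≠ 0 ∧ K ≠ ∞ ∧
    ∀ Ψ : (Fin (r + 1) → Fin (r + 1) → ℝ) → ℝ≥0∞, Measurable Ψ →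
      ∫⁻ x : Fin (r + 1) → Fin (r + d) → ℝ, Ψ (gramArray x) =
        K * ∫⁻ b : Fin d → ℝ, ∫⁻ y : Fin (r + 1) → Fin r → ℝ,
          ENNReal.ofReal |(onesLeft y).det| ^ d * Ψ (fun i j => b ⬝ᵥ b + gramArray y i j) := by
  obtain ⟨K, hK⟩ := exists_lintegral_gramArray_eq r d
  have hK' : ∀ Ψ : (Fin (r + 1) → Fin (r + 1) → ℝ) → ℝ≥0∞, Measurable Ψ →
      ∫⁻ x : Fin (r + 1) → Fin (r + d) → ℝ, Ψ (gramArray x) =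
        K * ∫⁻ b : Fin d → ℝ, ∫⁻ y : Fin (r + 1) → Fin r → ℝ,
          ENNReal.ofReal |(onesLeft y).det| ^ d * Ψ (fun i j => b ⬝ᵥ b + gramArray y i j) :=
    fun Ψ hΨ => (lintegral_append_gramArray r d hΨ).trans (hK Ψ hΨ)
  set Ψ : (Fin (r + 1) → Fin (r + 1) → ℝ) → ℝ≥0∞ := fun G =>
    ∏ i, ENNReal.ofReal (Real.exp (-(G i i) / 2)) with hΨ
  have hΨm : Measurable Ψ := by fun_prop
  obtain ⟨h0, h1⟩ := lintegral_gauss_array_ne (ι := Fin (r + 1)) (κ := Fin (r + d))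
  have hg := hK' Ψ hΨm
  simp only [hΨ] at hg
  rw [hg] at h0 h1
  refine ⟨K, fun h => h0 (by rw [h, zero_mul]), fun h => h1 ?_, hK'⟩
  rw [h]
  exact ENNReal.top_mul (right_ne_zero_of_mul h0)

/-- Rescale y by √(c s), the size of the slice at squared distance s. Volume elements of r + 1
points in ℝʳ contribute c^{r(r+1)/2} and the q-th power of the determinant contributes c^{rq/2}. -/
theorem fullMoment_slice {f : ℝ → ℝ≥0∞} {c : ℝ → ℝ} (hf : SliceProfile f c) (r : ℕ) (q : ℝ)
    {s : ℝ} (hs : 0 ≤ s) :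
    ∫⁻ y : Fin (r + 1) → Fin r → ℝ,
      (∏ i, f (s + gramArray y i i)) * ENNReal.ofReal |(onesLeft y).det| ^ q =
    f s ^ (r + 1) * ENNReal.ofReal (c s ^ ((r : ℝ) * (r + 1 + q) / 2)) * fullMoment f r q := by
  have hc := hf.scale_pos s
  have hc' : 0 < √(c s) := Real.sqrt_pos.2 hc
  set T : Matrix (Fin r) (Fin r) ℝ := √(c s) • 1 with hT
  have hTdet : T.det = √(c s) ^ r := by simp [hT]
  set G : (Fin (r + 1) → Fin r → ℝ) → ℝ≥0∞ := fun y =>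
    (∏ i, f (s + gramArray y i i)) * ENNReal.ofReal |(onesLeft y).det| ^ q with hG
  have hgr := measurable_gramArray (ι := Fin (r + 1)) (κ := Fin r)
  have hGm : Measurable G := by
    refine Measurable.mul (Finset.measurable_prod _ fun i _ => hf.measurable.comp ?_) ?_
    · exact ((measurable_pi_apply i).comp ((measurable_pi_apply i).comp hgr)).const_add s
    · exact (measurable_det_onesLeft.abs.ennreal_ofReal).pow_const q
  have h1 := lintegral_comp_rows (ι := Fin (r + 1)) T (by rw [hTdet]; positivity) hGm
  have h2 : ∀ y : Fin (r + 1) → Fin r → ℝ, G (fun i => T *ᵥ y i) =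
      (f s ^ (r + 1) * ENNReal.ofReal (√(c s) ^ r) ^ q) *
        ((∏ i, f (gramArray y i i)) * ENNReal.ofReal |(onesLeft y).det| ^ q) := by
    intro y
    have hT0 := det_onesLeft_mulVec_add T 0 y
    simp only [add_zero] at hT0
    have hgram : ∀ i, gramArray (fun i => T *ᵥ y i) i i = c s * gramArray y i i := by
      intro i
      have hs2 := Real.mul_self_sqrt hc.le
      simp only [gramArray, hT, Matrix.smul_mulVec, Matrix.one_mulVec, Pi.smul_apply, smul_eq_mul,
        Finset.mul_sum]
      refine Finset.sum_congr rfl fun k _ => ?_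
      linear_combination (y i k * y i k) * hs2
    have hnn : ∀ i, 0 ≤ gramArray y i i := fun i =>
      Finset.sum_nonneg fun k _ => mul_self_nonneg _
    simp only [hG, hT0, hgram]
    have : ∀ i, f (s + c s * gramArray y i i) = f s * f (gramArray y i i) := by
      intro i
      rw [hf.slice s _ hs (mul_nonneg hc.le (hnn i)), mul_div_cancel_left₀ _ hc.ne']
    simp_rw [this]
    rw [Finset.prod_mul_distrib, Finset.prod_const, Finset.card_univ, Fintype.card_fin, abs_mul,
      ENNReal.ofReal_mul (abs_nonneg _), ENNReal.mul_rpow_of_ne_top (by finiteness)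
        (by finiteness), hTdet, abs_of_pos (pow_pos hc' r)]
    ring
  simp_rw [h2] at h1
  have hfm : Measurable fun y : Fin (r + 1) → Fin r → ℝ =>
      (∏ i, f (gramArray y i i)) * ENNReal.ofReal |(onesLeft y).det| ^ q := by
    refine Measurable.mul (Finset.measurable_prod _ fun i _ => hf.measurable.comp ?_) ?_
    · exact ((measurable_pi_apply i).comp ((measurable_pi_apply i).comp hgr))
    · exact (measurable_det_onesLeft.abs.ennreal_ofReal).pow_const q
  rw [lintegral_const_mul _ hfm, hTdet, abs_of_pos (pow_pos hc' r), Fintype.card_fin] at h1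
  have h3 : ENNReal.ofReal (√(c s) ^ r) ^ (r + 1) *
      (ENNReal.ofReal (√(c s) ^ r)⁻¹ ^ (r + 1) * ∫⁻ y, G y) = ∫⁻ y, G y := by
    rw [← mul_assoc, ← mul_pow, ← ENNReal.ofReal_mul (by positivity),
      mul_inv_cancel₀ (by positivity)]
    simp
  rw [← h3, ← h1, fullMoment]
  have h4 : ENNReal.ofReal (√(c s) ^ r) ^ (r + 1) * ENNReal.ofReal (√(c s) ^ r) ^ q =
      ENNReal.ofReal (c s ^ ((r : ℝ) * (r + 1 + q) / 2)) := by
    rw [ENNReal.ofReal_rpow_of_pos (by positivity), ← ENNReal.ofReal_pow (by positivity),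
      ← ENNReal.ofReal_mul (by positivity)]
    congr 1
    rw [Real.sqrt_eq_rpow, ← Real.rpow_natCast (c s ^ (1 / 2 : ℝ)), ← Real.rpow_mul hc.le,
      ← Real.rpow_natCast _ (r + 1), ← Real.rpow_mul hc.le, ← Real.rpow_mul hc.le,
      ← Real.rpow_add hc]
    congr 1
    push_cast
    ring
  rw [← h4]
  ring

theorem measurable_simplexGram {r : ℕ} :
    Measurable (simplexGram : (Fin (r + 1) → Fin (r + 1) → ℝ) → ℝ) := by
  refine Continuous.measurable ?_
  unfold simplexGram
  refine Continuous.matrix_det ?_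
  fun_prop

/-- The slicing property decouples the position b of the flat from the simplex inside it. The
Blaschke–Petkantschin Jacobian of power d raises the order of the inner moment from p to d + p. -/
theorem exists_simplexMoment_eq (r d : ℕ) : ∃ K : ℝ≥0∞, K ≠ 0 ∧ K ≠ ∞ ∧
    ∀ (f : ℝ → ℝ≥0∞) (c : ℝ → ℝ), SliceProfile f c → ∀ p : ℝ, 0 ≤ p →
      simplexMoment f (r + d) r p =
        K * (∫⁻ b : Fin d → ℝ, f (b ⬝ᵥ b) ^ (r + 1) *
          ENNReal.ofReal (c (b ⬝ᵥ b) ^ ((r : ℝ) * (r + 1 + (d + p)) / 2))) *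
        fullMoment f r (d + p) := by
  obtain ⟨K, hK0, hK1, hK⟩ := exists_lintegral_gramArray_eq_of_ne r d
  refine ⟨K, hK0, hK1, fun f c hf p hp => ?_⟩
  have hdot : Measurable fun b : Fin d → ℝ => b ⬝ᵥ b := by unfold dotProduct; fun_prop
  have hfc := hf.measurable
  have hcc := hf.measurable_scale
  rw [simplexMoment, hK (fun G => (∏ i, f (G i i)) * ENNReal.ofReal (√(simplexGram G)) ^ p) (by
    refine Measurable.mul (by fun_prop) ?_
    exact (measurable_simplexGram.sqrt.ennreal_ofReal).pow_const p), mul_assoc K,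
    ← lintegral_mul_const]
  · congr 1
    refine lintegral_congr fun b => ?_
    have hb : 0 ≤ b ⬝ᵥ b := Finset.sum_nonneg fun k _ => mul_self_nonneg _
    rw [← fullMoment_slice hf r (d + p) hb]
    refine lintegral_congr fun y => ?_
    rw [simplexGram_add_const, simplexGram_eq_det_onesLeft_sq, Real.sqrt_sq_eq_abs,
      ENNReal.rpow_add_of_nonneg _ _ (Nat.cast_nonneg _) hp, ENNReal.rpow_natCast]
    ring
  · exact ((hfc.comp hdot).pow_const _).mul ((hcc.comp hdot).pow_const _).ennreal_ofReal

/-- The hyperplane through r + 1 vectors of ℝ^{r+1} has codimension one, and the determinant is the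
distance of that hyperplane from the origin times the simplex factor within it. -/
theorem exists_detMoment_eq (r : ℕ) : ∃ K : ℝ≥0∞, K ≠ 0 ∧ K ≠ ∞ ∧
    ∀ (f : ℝ → ℝ≥0∞) (c : ℝ → ℝ), SliceProfile f c → ∀ p : ℝ,
      detMoment f (r + 1) p =
        K * (∫⁻ b : Fin 1 → ℝ, ENNReal.ofReal (√(b ⬝ᵥ b)) ^ p * (f (b ⬝ᵥ b) ^ (r + 1) *
          ENNReal.ofReal (c (b ⬝ᵥ b) ^ ((r : ℝ) * (r + 1 + (1 + p)) / 2)))) *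
        fullMoment f r (1 + p) := by
  obtain ⟨K, hK0, hK1, hK⟩ := exists_lintegral_gramArray_eq_of_ne r 1
  refine ⟨K, hK0, hK1, fun f c hf p => ?_⟩
  have hdot : Measurable fun b : Fin 1 → ℝ => b ⬝ᵥ b := by unfold dotProduct; fun_prop
  have hfc := hf.measurable
  have hcc := hf.measurable_scale
  have hdm : ∀ x : Fin (r + 1) → Fin (r + 1) → ℝ,
      |(Matrix.of x).det| = √(Matrix.of (gramArray x)).det := by
    intro x
    have : Matrix.of (gramArray x) = Matrix.of x * (Matrix.of x)ᵀ := by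
      ext i j
      simp [gramArray, Matrix.mul_apply]
    rw [this, Matrix.det_mul, Matrix.det_transpose, Real.sqrt_mul_self_eq_abs]
  simp_rw [detMoment, hdm]
  rw [hK (fun G => (∏ i, f (G i i)) * ENNReal.ofReal (√(Matrix.of G).det) ^ p) (by
    refine Measurable.mul (by fun_prop) ?_
    have hcd : Continuous fun G : Fin (r + 1) → Fin (r + 1) → ℝ => (Matrix.of G).det :=
      Continuous.matrix_det continuous_id
    exact (hcd.measurable.sqrt.ennreal_ofReal).pow_const p), mul_assoc K,
    ← lintegral_mul_const]
  · congr 1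
    refine lintegral_congr fun b => ?_
    have hb : 0 ≤ b ⬝ᵥ b := Finset.sum_nonneg fun k _ => mul_self_nonneg _
    rw [mul_assoc, ← fullMoment_slice hf r (1 + p) hb, ← lintegral_const_mul]
    -- Negative p is allowed, so combining the powers 1 and p of the determinant requires it to be
    -- nonzero, which holds almost everywhere.
    · refine lintegral_congr_ae ?_
      filter_upwards [ae_det_onesLeft_ne_zero r] with y hy
      have hdet := det_add_const_gramArray y (√(b ⬝ᵥ b))
      rw [Real.sq_sqrt hb] at hdet
      have hbs : √(b ⬝ᵥ b * (onesLeft y).det ^ 2) = √(b ⬝ᵥ b) * |(onesLeft y).det| := by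
        rw [Real.sqrt_mul hb, Real.sqrt_sq_eq_abs]
      have hy' : ENNReal.ofReal |(onesLeft y).det| ≠ 0 := by simpa using hy
      rw [hdet, hbs, ENNReal.ofReal_mul (Real.sqrt_nonneg _),
        ENNReal.mul_rpow_of_ne_top (by finiteness) (by finiteness),
        ENNReal.rpow_add _ _ hy' (by finiteness), ENNReal.rpow_one, pow_one]
      ring
    · refine Measurable.mul (Finset.measurable_prod _ fun i _ => hfc.comp ?_)
        ((measurable_det_onesLeft.abs.ennreal_ofReal).pow_const _)
      exact ((measurable_pi_apply i).comp ((measurable_pi_apply i).comp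
        measurable_gramArray)).const_add _
  · exact ((hdot.sqrt.ennreal_ofReal).pow_const p).mul
      (((hfc.comp hdot).pow_const _).mul ((hcc.comp hdot).pow_const _).ennreal_ofReal)

/-! ### Gaussian and Beta weights -/

/-- The Gaussian weight `exp (-s / 2)` as a function of the squared norm `s`. -/
noncomputable def gaussProfile (s : ℝ) : ℝ≥0∞ := ENNReal.ofReal (Real.exp (-s / 2))

/-- The Beta weight `(1 - s) ^ β` as a function of the squared norm `s`. -/
noncomputable def betaProfile (β s : ℝ) : ℝ≥0∞ :=
  if s < 1 then ENNReal.ofReal ((1 - s) ^ β) else 0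

/-- The factor by which the unit ball shrinks in slices at squared distance `s` of the origin. -/
noncomputable def betaScale (s : ℝ) : ℝ := if s < 1 then 1 - s else 1

theorem sliceProfile_gauss : SliceProfile gaussProfile fun _ => 1 where
  measurable := by unfold gaussProfile; fun_prop
  measurable_scale := measurable_const
  scale_pos _ := one_pos
  slice s u _ _ := by
    rw [gaussProfile, gaussProfile, gaussProfile, ← ENNReal.ofReal_mul (Real.exp_pos _).le,
      ← Real.exp_add]
    ring_nf

/-- The point is 1 - s - u = (1 - s)(1 - u/(1 - s)). Outside the unit ball the weight vanishes, so
the scale there is arbitrary and the value 1 merely keeps it positive. -/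
theorem sliceProfile_beta (β : ℝ) : SliceProfile (betaProfile β) betaScale where
  measurable := Measurable.ite measurableSet_Iio (by fun_prop) measurable_const
  measurable_scale := Measurable.ite measurableSet_Iio (by fun_prop) measurable_const
  scale_pos s := by
    unfold betaScale
    split_ifs with h
    · linarith
    · exact one_pos
  slice s u hs hu := by
    unfold betaProfile betaScale
    by_cases h : s < 1
    · have h1 : 0 < 1 - s := by linarith
      have h2 : s + u < 1 ↔ u / (1 - s) < 1 := by
        rw [div_lt_one h1]
        constructor <;> intro <;> linarith
      simp only [h, if_true, h2]
      split_ifs with h3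
      · have h4 : 0 ≤ 1 - u / (1 - s) := by linarith
        rw [← ENNReal.ofReal_mul (Real.rpow_nonneg h1.le _), ← Real.mul_rpow h1.le h4]
        congr 2
        field_simp
        ring
      · simp
    · have h2 : ¬ s + u < 1 := by linarith
      simp [h, h2]

theorem radialMoment_gauss {n : ℕ} {p : ℝ} (hp : 0 < n + p) {m : ℕ} (hm : 1 ≤ m) :
    radialMoment n p (fun s => gaussProfile s ^ m) =
      ENNReal.ofReal (Real.Gamma ((n + p) / 2) * (2 / m) ^ ((n + p) / 2)) := by
  have hm' : (0 : ℝ) < m := by exact_mod_cast hm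
  have hx : 0 < ((n : ℝ) + p) / 2 := by positivity
  have h1 := Real.integral_rpow_mul_exp_neg_mul_Ioi hx (r := (m : ℝ) / 2) (by positivity)
  have hint : IntegrableOn (fun s : ℝ => s ^ (((n : ℝ) + p) / 2 - 1) * Real.exp (-((m : ℝ) / 2 * s)))
      (Set.Ioi 0) := by
    have := integrableOn_rpow_mul_exp_neg_mul_rpow (s := ((n : ℝ) + p) / 2 - 1) (p := 1)
      (b := (m : ℝ) / 2) (by linarith) one_pos (by positivity)
    simpa using this
  have hnn : 0 ≤ᵐ[volume.restrict (Set.Ioi (0 : ℝ))] fun s : ℝ =>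
      s ^ (((n : ℝ) + p) / 2 - 1) * Real.exp (-((m : ℝ) / 2 * s)) := by
    filter_upwards [ae_restrict_mem measurableSet_Ioi] with s hs
    have : 0 < s := hs
    positivity
  have h2 := ofReal_integral_eq_lintegral_ofReal hint hnn
  rw [h1] at h2
  rw [mul_comm (Real.Gamma _)]
  have h3 : (1 / ((m : ℝ) / 2)) = 2 / m := by field_simp
  rw [h3] at h2
  rw [h2, radialMoment]
  refine setLIntegral_congr_fun measurableSet_Ioi fun s hs => ?_
  have : 0 < s := hs
  simp only [gaussProfile]
  rw [← ENNReal.ofReal_pow (Real.exp_pos _).le, ← Real.exp_nat_mul,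
    ← ENNReal.ofReal_mul (by positivity)]
  congr 3
  ring

theorem radialMoment_beta {n : ℕ} {p : ℝ} (hp : 0 < n + p) {m : ℕ} (hm : 1 ≤ m) {β e : ℝ}
    (hy : 0 < m * β + e + 1) :
    radialMoment n p (fun s => betaProfile β s ^ m * ENNReal.ofReal (betaScale s ^ e)) =
      ENNReal.ofReal (beta ((n + p) / 2) (m * β + e + 1)) := by
  have hx : 0 < ((n : ℝ) + p) / 2 := by positivity
  have hB := beta_pos hx hy
  have h1 := lintegral_betaPDF_eq_one hx hy
  rw [lintegral_betaPDF] at h1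
  have h2 : radialMoment n p (fun s => betaProfile β s ^ m * ENNReal.ofReal (betaScale s ^ e)) =
      ENNReal.ofReal (beta ((n + p) / 2) (m * β + e + 1)) *
      ∫⁻ s in Set.Ioo (0 : ℝ) 1, ENNReal.ofReal (1 / beta ((n + p) / 2) (m * β + e + 1) *
        s ^ (((n : ℝ) + p) / 2 - 1) * (1 - s) ^ (m * β + e + 1 - 1)) := by
    rw [← lintegral_const_mul' _ _ ENNReal.ofReal_ne_top, radialMoment,
      ← Set.Ioi_inter_Iio, Set.inter_comm, ← setLIntegral_indicator measurableSet_Iio]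
    refine setLIntegral_congr_fun measurableSet_Ioi fun s hs => ?_
    have hs : 0 < s := hs
    simp only [Set.indicator, Set.mem_Iio, betaProfile, betaScale]
    split_ifs with h
    · have h3 : 0 < 1 - s := by linarith
      rw [← ENNReal.ofReal_pow (by positivity), ← ENNReal.ofReal_mul (by positivity),
        ← ENNReal.ofReal_mul (by positivity), ← ENNReal.ofReal_mul hB.le]
      congr 1
      rw [← Real.rpow_natCast, ← Real.rpow_mul h3.le, ← Real.rpow_add h3, mul_assoc (1 / _),
        one_div, mul_inv_cancel_left₀ hB.ne', add_sub_cancel_right, mul_comm β]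
    · simp [show m ≠ 0 by lia]
  rw [h2, h1, mul_one]

theorem radialMoment_sqrt_rpow_mul (n : ℕ) (p : ℝ) (g : ℝ → ℝ≥0∞) :
    radialMoment n 0 (fun s => ENNReal.ofReal (√s) ^ p * g s) = radialMoment n p g := by
  refine setLIntegral_congr_fun measurableSet_Ioi fun s hs => ?_
  have hs : 0 < s := hs
  rw [← mul_assoc, ENNReal.ofReal_rpow_of_pos (Real.sqrt_pos.2 hs),
    ← ENNReal.ofReal_mul (by positivity), Real.sqrt_eq_rpow, ← Real.rpow_mul hs.le,
    ← Real.rpow_add hs]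
  congr 3
  ring

theorem exists_lintegral_dotProduct_eq_radialMoment {d : ℕ} (hd : 1 ≤ d) :
    ∃ c : ℝ, 0 < c ∧ ∀ f : ℝ → ℝ≥0∞, Measurable f →
      ∫⁻ b : Fin d → ℝ, f (b ⬝ᵥ b) = ENNReal.ofReal c * radialMoment d 0 f := by
  obtain ⟨c, hc, h⟩ := lintegral_radial_mul_homogeneous hd (p := 0)
    (H := fun _ => 1) measurable_const (by simp)
  obtain ⟨h0, h1⟩ := hc fun _ => rfl
  refine ⟨c.toReal, ENNReal.toReal_pos h0 h1, fun f hf => ?_⟩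
  rw [ENNReal.ofReal_toReal h1, ← h f hf]
  simp

/-! ### Gaussian moments -/

theorem exists_orthogonal_const_column (r : ℕ) : ∃ P : Matrix (Fin (r + 1)) (Fin (r + 1)) ℝ,
    Pᵀ * P = 1 ∧ ∀ i, P i 0 = (√(r + 1))⁻¹ := by
  let v : Fin (r + 1) → EuclideanSpace ℝ (Fin (r + 1)) := fun _ =>
    WithLp.toLp 2 fun _ => (√(r + 1))⁻¹
  have hr : (0 : ℝ) < r + 1 := by positivity
  have hv : Orthonormal ℝ (({0} : Set (Fin (r + 1))).domRestrict v) := by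
    rw [orthonormal_iff_ite]
    rintro ⟨i, rfl⟩ ⟨j, rfl⟩
    simp only [if_true, Set.domRestrict_apply, PiLp.inner_apply, v]
    simp [Real.sq_sqrt hr.le]
    field_simp
  obtain ⟨b, hb⟩ := hv.exists_orthonormalBasis_extension_of_card_eq (by simp)
  refine ⟨Matrix.of fun i j => b j i, ?_, fun i => ?_⟩
  · ext j k
    have := orthonormal_iff_ite.1 b.orthonormal j k
    rw [Matrix.one_apply, ← this]
    simp [Matrix.mul_apply, PiLp.inner_apply, mul_comm]
  · rw [Matrix.of_apply, hb 0 rfl]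

/-- The Gaussian weight is invariant under mixing the points by an orthogonal matrix. If its first
column is constant, the border of ones becomes √(r + 1) times the first unit vector: one Gaussian
vector integrates out and an r × r Gaussian determinant is left. -/
theorem exists_fullMoment_gauss (r : ℕ) : ∃ K : ℝ, 0 < K ∧ ∀ q : ℝ,
    fullMoment gaussProfile r q =
      ENNReal.ofReal (K * ((r : ℝ) + 1) ^ (q / 2)) * detMoment gaussProfile r q := by
  have hr : (0 : ℝ) < r + 1 := by positivity
  obtain ⟨P, hP, hP0⟩ := exists_orthogonal_const_column r
  have hPdet : |P.det| = 1 := by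
    have : P.det * P.det = 1 := by
      rw [← Matrix.det_one (n := Fin (r + 1)) (R := ℝ), ← hP, Matrix.det_mul, Matrix.det_transpose]
    rw [← Real.sqrt_mul_self_eq_abs, this, Real.sqrt_one]
  have hP1 : P.det ≠ 0 := fun h => by simp [h] at hPdet
  obtain ⟨h0, h1⟩ := lintegral_gauss_array_ne (ι := Unit) (κ := Fin r)
  set K := ∫⁻ x : Unit → Fin r → ℝ, ∏ i, ENNReal.ofReal (Real.exp (-(gramArray x i i) / 2))
    with hK
  have hdot : Measurable fun v : Fin r → ℝ => v ⬝ᵥ v := by unfold dotProduct; fun_prop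
  have hgv : Measurable fun v : Fin r → ℝ => gaussProfile (v ⬝ᵥ v) :=
    sliceProfile_gauss.measurable.comp hdot
  have hKv : ∫⁻ v : Fin r → ℝ, gaussProfile (v ⬝ᵥ v) = K := by
    rw [hK, ← (volume_preserving_funUnique Unit (Fin r → ℝ)).lintegral_comp hgv]
    simp [gaussProfile, gramArray, dotProduct]
  have hgm : ∀ m : ℕ, Measurable fun y : Fin m → Fin r → ℝ => ∏ i, gaussProfile (gramArray y i i) :=
    fun m => Finset.measurable_prod _ fun i _ => sliceProfile_gauss.measurable.comp
      ((measurable_pi_apply i).comp ((measurable_pi_apply i).comp measurable_gramArray))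
  refine ⟨K.toReal, ENNReal.toReal_pos h0 h1, fun q => ?_⟩
  set G : (Fin (r + 1) → Fin r → ℝ) → ℝ≥0∞ := fun y =>
    (∏ i, gaussProfile (gramArray y i i)) * ENNReal.ofReal |(onesLeft y).det| ^ q with hG
  have hGm : Measurable G := (hgm _).mul ((measurable_det_onesLeft.abs.ennreal_ofReal).pow_const q)
  have h2 := lintegral_comp_columns (κ := Fin r) P hP1 hGm
  rw [hPdet, inv_one, ENNReal.ofReal_one, one_pow, one_mul] at h2
  have hgauss : ∀ y : Fin (r + 1) → Fin r → ℝ, ∏ i, gaussProfile (gramArray y i i) =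
      ENNReal.ofReal (Real.exp (-(∑ i, gramArray y i i) / 2)) := by
    intro y
    simp only [gaussProfile]
    rw [← ENNReal.ofReal_prod_of_nonneg fun i _ => (Real.exp_pos _).le, ← Real.exp_sum,
      ← Finset.sum_div, Finset.sum_neg_distrib]
  have htr : ∀ z : Fin (r + 1) → Fin r → ℝ,
      ∑ i, gramArray (fun i k => ∑ j, P i j * z j k) i i = ∑ i, gramArray z i i := by
    intro z
    have e1 : ∀ y : Fin (r + 1) → Fin r → ℝ, ∑ i, gramArray y i i =
        (Matrix.of y * (Matrix.of y)ᵀ).trace := by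
      intro y
      simp [Matrix.trace, gramArray, Matrix.mul_apply]
    have e2 : Matrix.of (fun i k => ∑ j, P i j * z j k) = P * Matrix.of z := by
      ext i k
      simp [Matrix.mul_apply]
    rw [e1, e1, e2, Matrix.transpose_mul, Matrix.mul_assoc, Matrix.trace_mul_comm,
      Matrix.mul_assoc, Matrix.mul_assoc, hP, Matrix.mul_one]
  have hdet : ∀ z : Fin (r + 1) → Fin r → ℝ, |(onesLeft fun i k => ∑ j, P i j * z j k).det| =
      √(r + 1) * |(Matrix.of (Fin.tail z)).det| := by
    intro z
    have e1 : onesLeft (fun i k => ∑ j, P i j * z j k) = P * Matrix.of fun j : Fin (r + 1) =>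
        (Fin.cons ((Fin.cons √(r + 1) fun _ => 0 : Fin (r + 1) → ℝ) j) (z j) :
          Fin (r + 1) → ℝ) := by
      ext i k
      refine Fin.cases ?_ (fun k => ?_) k
      · simp [onesLeft, Matrix.mul_apply, Fin.sum_univ_succ, hP0,
          (Real.sqrt_pos.2 hr).ne']
      · simp [onesLeft, Matrix.mul_apply]
    rw [e1, Matrix.det_mul, abs_mul, hPdet, one_mul, Matrix.det_succ_column_zero,
      Fin.sum_univ_succ]
    simp only [Fin.val_zero, pow_zero, one_mul, Matrix.of_apply, Fin.cons_zero, Fin.cons_succ,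
      mul_zero, zero_mul, Finset.sum_const_zero, add_zero, abs_mul, abs_of_pos (Real.sqrt_pos.2 hr)]
    congr 1
  calc fullMoment gaussProfile r q = ∫⁻ y, G y := rfl
    _ = ∫⁻ z : Fin (r + 1) → Fin r → ℝ, (∏ i, gaussProfile (gramArray z i i)) *
          (ENNReal.ofReal √(r + 1) ^ q * ENNReal.ofReal |(Matrix.of (Fin.tail z)).det| ^ q) := by
        rw [← h2]
        refine lintegral_congr fun z => ?_
        simp only [hG]
        rw [hgauss, htr, ← hgauss, hdet, ENNReal.ofReal_mul (Real.sqrt_nonneg _),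
          ENNReal.mul_rpow_of_ne_top (by finiteness) (by finiteness)]
    _ = ∫⁻ v : Fin r → ℝ, gaussProfile (v ⬝ᵥ v) * (ENNReal.ofReal √(r + 1) ^ q *
          detMoment gaussProfile r q) := by
        have hdm : Measurable fun z : Fin (r + 1) → Fin r → ℝ => (Matrix.of (Fin.tail z)).det := by
          refine (Continuous.matrix_det ?_).measurable
          unfold Fin.tail
          exact continuous_matrix fun i j => by simp only [Matrix.of_apply]; fun_prop
        have hm : Measurable fun z : Fin (r + 1) → Fin r → ℝ =>
            (∏ i, gaussProfile (gramArray z i i)) *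
            (ENNReal.ofReal √(r + 1) ^ q * ENNReal.ofReal |(Matrix.of (Fin.tail z)).det| ^ q) :=
          (hgm _).mul (((hdm.abs.ennreal_ofReal).pow_const q).const_mul _)
        rw [lintegral_fin_cons hm]
        refine lintegral_congr fun v => ?_
        have hrt : ENNReal.ofReal √(r + 1) ^ q ≠ ∞ := by
          rw [ENNReal.ofReal_rpow_of_pos (Real.sqrt_pos.2 hr)]; exact ENNReal.ofReal_ne_top
        rw [detMoment, ← lintegral_const_mul' _ _ hrt,
          ← lintegral_const_mul' (gaussProfile (v ⬝ᵥ v)) _ ENNReal.ofReal_ne_top]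
        refine lintegral_congr fun x => ?_
        have h00 : gramArray (Fin.cons v x : Fin (r + 1) → Fin r → ℝ) 0 0 = v ⬝ᵥ v := by
          simp [gramArray, dotProduct]
        have hss : ∀ i : Fin r, gramArray (Fin.cons v x : Fin (r + 1) → Fin r → ℝ) i.succ i.succ =
          gramArray x i i := fun i => by simp [gramArray]
        simp only [Fin.prod_univ_succ, Fin.tail_cons, h00, hss]
        ring
    _ = _ := by
        rw [lintegral_mul_const _ hgv, hKv, ← mul_assoc]
        congr 1
        rw [ENNReal.ofReal_mul ENNReal.toReal_nonneg, ENNReal.ofReal_toReal h1,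
          ENNReal.ofReal_rpow_of_pos (Real.sqrt_pos.2 hr), Real.sqrt_eq_rpow,
          ← Real.rpow_mul hr.le]
        congr 3
        ring

/-! ### Explicit moment formulas -/

theorem volume_pi_fin_zero_univ (α : Type*) [MeasureSpace α] [SigmaFinite (volume : Measure α)] :
    (volume : Measure (Fin 0 → α)) Set.univ = 1 := by
  rw [volume_pi, Measure.pi_univ]
  simp

theorem detMoment_gauss_zero (p : ℝ) : detMoment gaussProfile 0 p = 1 := by
  simp [detMoment, lintegral_unique, volume_pi_fin_zero_univ]

/-- Slicing by a hyperplane followed by the rotation argument expresses the (r + 1)-dimensional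
moment of order p through the r-dimensional one of order 1 + p, at the price of a one-dimensional
radial integral that supplies the factor Γ((p + 1)/2). -/
theorem exists_detMoment_gauss (N : ℕ) : ∃ K : ℝ, 0 < K ∧ ∀ p : ℝ, -1 < p →
    detMoment gaussProfile N p = ENNReal.ofReal (K * ∏ j ∈ Finset.range N,
      (Real.Gamma ((p + j + 1) / 2) * 2 ^ ((p + j + 1) / 2))) := by
  induction N with
  | zero => exact ⟨1, one_pos, fun p _ => by simp [detMoment_gauss_zero]⟩
  | succ r ih =>
    obtain ⟨K₁, hK₁, h₁⟩ := ih
    obtain ⟨K₂, hK₂0, hK₂1, h₂⟩ := exists_detMoment_eq r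
    obtain ⟨K₃, hK₃, h₃⟩ := exists_fullMoment_gauss r
    obtain ⟨K₄, hK₄, h₄⟩ := exists_lintegral_dotProduct_eq_radialMoment (le_refl 1)
    have hr : (0 : ℝ) < r + 1 := by positivity
    refine ⟨K₂.toReal * K₄ * K₃ * K₁,
      by have := ENNReal.toReal_pos hK₂0 hK₂1; positivity, fun p hp => ?_⟩
    have hx : (0 : ℝ) < (p + 1) / 2 := by linarith
    have hm : Measurable fun s : ℝ => ENNReal.ofReal (√s) ^ p * (gaussProfile s ^ (r + 1)) :=
      (Real.continuous_sqrt.measurable.ennreal_ofReal.pow_const p).mul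
        (sliceProfile_gauss.measurable.pow_const _)
    rw [h₂ _ _ sliceProfile_gauss p]
    simp only [Real.one_rpow, ENNReal.ofReal_one, mul_one]
    rw [h₄ _ hm, radialMoment_sqrt_rpow_mul, radialMoment_gauss (by push_cast; linarith)
      (Nat.le_add_left 1 r), h₃, h₁ (1 + p) (by linarith), ← ENNReal.ofReal_toReal hK₂1]
    have hG : 0 < Real.Gamma ((p + 1) / 2) := Real.Gamma_pos_of_pos hx
    rw [← ENNReal.ofReal_mul hK₄.le, ← ENNReal.ofReal_mul (by positivity),
      ← ENNReal.ofReal_mul (by positivity), ← ENNReal.ofReal_mul (by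
        have : 0 < Real.Gamma ((((1 : ℕ) : ℝ) + p) / 2) :=
          Real.Gamma_pos_of_pos (by push_cast; linarith)
        positivity)]
    congr 1
    rw [Finset.prod_range_succ', ENNReal.toReal_ofReal ENNReal.toReal_nonneg]
    have e1 : ∀ j : ℕ, (1 + p + (j : ℝ) + 1) / 2 = (p + ((j + 1 : ℕ) : ℝ) + 1) / 2 := fun j => by
      push_cast; ring
    simp only [e1]
    -- The powers of r + 1 coming from the radial integral of exp(-(r + 1)s/2) and from the rotation
    -- cancel.
    have e2 : (2 / ((r + 1 : ℕ) : ℝ)) ^ ((((1 : ℕ) : ℝ) + p) / 2) * ((r : ℝ) + 1) ^ ((1 + p) / 2) =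
        2 ^ ((p + 1) / 2) := by
      push_cast
      rw [Real.div_rpow two_pos.le hr.le, add_comm p 1]
      field_simp
    push_cast at e2 ⊢
    rw [show (p + 0 + 1) / 2 = (1 + p) / 2 by ring]
    rw [add_comm p 1] at e2
    rw [← e2]
    ring

theorem exists_fullMoment_gauss_eq (r : ℕ) : ∃ K : ℝ, 0 < K ∧ ∀ q : ℝ, -1 < q →
    fullMoment gaussProfile r q = ENNReal.ofReal (K * ((((r : ℝ) + 1) * 2 ^ r) ^ (q / 2) *
      ∏ j ∈ Finset.range r, Real.Gamma ((q + j + 1) / 2))) := by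
  obtain ⟨K₁, hK₁, h₁⟩ := exists_fullMoment_gauss r
  obtain ⟨K₂, hK₂, h₂⟩ := exists_detMoment_gauss r
  refine ⟨K₁ * K₂ * ∏ j ∈ Finset.range r, (2 : ℝ) ^ (((j : ℝ) + 1) / 2), by positivity,
    fun q hq => ?_⟩
  rw [h₁, h₂ q hq, ← ENNReal.ofReal_mul (by positivity)]
  congr 1
  have e1 : ∀ j : ℕ, (2 : ℝ) ^ ((q + j + 1) / 2) = 2 ^ (q / 2) * 2 ^ (((j : ℝ) + 1) / 2) := fun j => by
    rw [← Real.rpow_add two_pos]; ring_nf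
  simp only [e1, Finset.prod_mul_distrib, Finset.prod_const, Finset.card_range]
  rw [Real.mul_rpow (by positivity) (by positivity), ← Real.rpow_natCast, ← Real.rpow_mul two_pos.le,
    ← Real.rpow_natCast, ← Real.rpow_mul two_pos.le]
  rw [mul_comm (r : ℝ) (q / 2)]
  ring

theorem exists_flatFactor_gauss (r d : ℕ) : ∃ K : ℝ, 0 < K ∧
    ∫⁻ b : Fin d → ℝ, gaussProfile (b ⬝ᵥ b) ^ (r + 1) = ENNReal.ofReal K := by
  rcases Nat.eq_zero_or_pos d with rfl | hd
  · exact ⟨1, one_pos, by simp [lintegral_unique, gaussProfile, volume_pi_fin_zero_univ]⟩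
  · obtain ⟨K, hK, h⟩ := exists_lintegral_dotProduct_eq_radialMoment hd
    have hd' : (0 : ℝ) < d := by exact_mod_cast hd
    have hG : 0 < Real.Gamma ((d + 0) / 2) := Real.Gamma_pos_of_pos (by linarith)
    refine ⟨K * (Real.Gamma ((d + 0) / 2) * (2 / (r + 1 : ℕ)) ^ (((d : ℝ) + 0) / 2)),
      by positivity, ?_⟩
    rw [h _ (sliceProfile_gauss.measurable.pow_const _),
      radialMoment_gauss (by linarith) (Nat.le_add_left 1 r), ENNReal.ofReal_mul hK.le]

/-- Moments of the volume of Gaussian simplices, up to normalisation. -/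
theorem exists_simplexMoment_gauss (r d : ℕ) : ∃ K : ℝ, 0 < K ∧ ∀ p : ℝ, 0 < p →
    simplexMoment gaussProfile (r + d) r p =
      ENNReal.ofReal (K * ((((r : ℝ) + 1) * 2 ^ r) ^ (p / 2) *
        ∏ j ∈ Finset.range r, Real.Gamma ((d + p + j + 1) / 2))) := by
  obtain ⟨K₁, hK₁0, hK₁1, h₁⟩ := exists_simplexMoment_eq r d
  obtain ⟨K₂, hK₂, h₂⟩ := exists_fullMoment_gauss_eq r
  obtain ⟨K₃, hK₃, h₃⟩ := exists_flatFactor_gauss r d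
  have hK₁ := ENNReal.toReal_pos hK₁0 hK₁1
  refine ⟨K₁.toReal * K₃ * K₂ * (((r : ℝ) + 1) * 2 ^ r) ^ ((d : ℝ) / 2), by positivity,
    fun p hp => ?_⟩
  rw [h₁ _ _ sliceProfile_gauss p hp.le]
  simp only [Real.one_rpow, ENNReal.ofReal_one, mul_one]
  have hd : (0 : ℝ) ≤ d := Nat.cast_nonneg d
  rw [h₃, h₂ _ (by linarith), ← ENNReal.ofReal_toReal hK₁1, ← ENNReal.ofReal_mul hK₁.le,
    ← ENNReal.ofReal_mul (by positivity), ENNReal.toReal_ofReal hK₁.le]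
  congr 1
  rw [add_div (d : ℝ) p, Real.rpow_add (by positivity)]
  ring

/-- |det|^p is homogeneous of degree p in each row, so passing from the Gaussian to the Beta weight
costs one quotient of radial moments per row. -/
theorem exists_detMoment_beta {β : ℝ} (hβ : -1 < β) (N : ℕ) (hN : 1 ≤ N) : ∃ K : ℝ, 0 < K ∧
    ∀ p : ℝ, -1 < p → detMoment (betaProfile β) N p = ENNReal.ofReal (K *
      ((∏ j ∈ Finset.range N, Real.Gamma ((p + j + 1) / 2)) /
        Real.Gamma ((N + p) / 2 + (β + 1)) ^ N)) := by
  obtain ⟨K₁, hK₁, h₁⟩ := exists_detMoment_gauss N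
  have hN' : (1 : ℝ) ≤ N := by exact_mod_cast hN
  have hGβ : 0 < Real.Gamma (β + 1) := Real.Gamma_pos_of_pos (by linarith)
  refine ⟨K₁ * Real.Gamma (β + 1) ^ N * (2 ^ (-((N : ℝ) / 2))) ^ N *
    ∏ j ∈ Finset.range N, (2 : ℝ) ^ (((j : ℝ) + 1) / 2), by positivity, fun p hp => ?_⟩
  have hx : (0 : ℝ) < N + p := by linarith
  have hg := radialMoment_gauss hx (le_refl 1)
  simp only [pow_one] at hg
  have hb := radialMoment_beta hx (le_refl 1) (β := β) (e := 0) (by push_cast; linarith)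
  simp only [pow_one, Real.rpow_zero, ENNReal.ofReal_one, mul_one, Nat.cast_one, one_mul,
    add_zero] at hb
  have hdm : Measurable fun x : Fin N → Fin N → ℝ => ENNReal.ofReal |(Matrix.of x).det| ^ p := by
    have hc : Continuous fun x : Fin N → Fin N → ℝ => (Matrix.of x).det :=
      Continuous.matrix_det continuous_id
    exact (hc.measurable.abs.ennreal_ofReal).pow_const p
  have key := radialMoment_pow_mul_lintegral_comm hN (p := p) (sliceProfile_beta β).measurable
    sliceProfile_gauss.measurable N hdm (fun i t ht x => by
      have : Matrix.of (Function.update x i (t • x i)) =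
          (Matrix.of x).updateRow i (t • (Matrix.of x) i) := rfl
      rw [this, Matrix.det_updateRow_smul, Matrix.updateRow_eq_self, abs_mul, abs_of_pos ht,
        ENNReal.ofReal_mul ht.le, ENNReal.mul_rpow_of_ne_top (by finiteness) (by finiteness)])
    (by rw [hb]; finiteness) (by rw [hg]; finiteness)
  change _ * detMoment (betaProfile β) N p = _ * detMoment gaussProfile N p at key
  have hGx : 0 < Real.Gamma ((N + p) / 2) := Real.Gamma_pos_of_pos (by positivity)
  have hGxb : 0 < Real.Gamma ((N + p) / 2 + (β + 1)) := Real.Gamma_pos_of_pos (by linarith)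
  rw [hg, hb, h₁ p hp, ← ENNReal.ofReal_pow (by positivity),
    ← ENNReal.ofReal_pow (beta_pos (by linarith) (by linarith)).le,
    ← ENNReal.ofReal_mul (pow_nonneg (beta_pos (by linarith) (by linarith)).le _)] at key
  set c := (Real.Gamma ((N + p) / 2) * (2 / (1 : ℕ)) ^ (((N : ℝ) + p) / 2)) ^ N with hc
  have hc0 : 0 < c := by positivity
  have key2 : detMoment (betaProfile β) N p = ENNReal.ofReal c⁻¹ *
      (ENNReal.ofReal c * detMoment (betaProfile β) N p) := by
    rw [← mul_assoc, ← ENNReal.ofReal_mul (by positivity), inv_mul_cancel₀ hc0.ne']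
    simp
  rw [key2, key, ← ENNReal.ofReal_mul (by positivity)]
  congr 1
  have e1 : ∀ j : ℕ, (2 : ℝ) ^ ((p + j + 1) / 2) = 2 ^ (p / 2) * 2 ^ (((j : ℝ) + 1) / 2) := fun j => by
    rw [← Real.rpow_add two_pos]; ring_nf
  have e2 : (2 / ((1 : ℕ) : ℝ)) ^ (((N : ℝ) + p) / 2) = 2 ^ (p / 2) * (2 ^ (-((N : ℝ) / 2)))⁻¹ := by
    rw [← Real.rpow_neg two_pos.le, neg_neg, ← Real.rpow_add two_pos]
    norm_num
    ring_nf
  simp only [e1, Finset.prod_mul_distrib, Finset.prod_const, Finset.card_range, hc, e2, beta]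
  have h2 : (0 : ℝ) < 2 ^ (p / 2) := by positivity
  have h3 : (0 : ℝ) < 2 ^ (-((N : ℝ) / 2)) := by positivity
  generalize (2 : ℝ) ^ (p / 2) = A at *
  generalize (2 : ℝ) ^ (-((N : ℝ) / 2)) = B at *
  simp only [mul_pow, div_pow, inv_pow]
  field_simp


/-- Here the hyperplane slicing relation is read backwards: with p = q - 1 the parallelotope moment
is already known, and dividing by the radial factor isolates the simplex moment. -/
theorem exists_fullMoment_beta {ν : ℝ} (hν : 0 < ν) (r : ℕ) : ∃ K : ℝ, 0 < K ∧ ∀ q : ℝ, 0 < q →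
    fullMoment (betaProfile (ν / 2 - 1)) r q = ENNReal.ofReal (K *
      ((∏ j ∈ Finset.range r, Real.Gamma ((q + j + 1) / 2)) / Real.Gamma ((r + ν + q) / 2) ^ (r + 1) *
        (Real.Gamma (((r + 1) * ν + r * (r - 1) + (r + 1) * q) / 2) /
          Real.Gamma (((r + 1) * ν + r * (r - 1) + r * q) / 2)))) := by
  obtain ⟨K₁, hK₁, h₁⟩ := exists_detMoment_beta (β := ν / 2 - 1) (by linarith) (r + 1)
    (Nat.le_add_left 1 r)
  obtain ⟨K₂, hK₂0, hK₂1, h₂⟩ := exists_detMoment_eq r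
  obtain ⟨K₄, hK₄, h₄⟩ := exists_lintegral_dotProduct_eq_radialMoment (le_refl 1)
  have hK₂ := ENNReal.toReal_pos hK₂0 hK₂1
  have hr : (0 : ℝ) ≤ r := Nat.cast_nonneg r
  have hrr : (0 : ℝ) ≤ r * (r - 1) := by
    rcases Nat.eq_zero_or_pos r with rfl | h
    · simp
    · have : (1 : ℝ) ≤ r := by exact_mod_cast h
      exact mul_nonneg hr (by linarith)
  refine ⟨K₁ * (K₂.toReal * K₄)⁻¹, by positivity, fun q hq => ?_⟩
  have hB : 0 < ((r + 1) * ν + r * (r - 1) + r * q) / 2 := by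
    have : 0 < (r + 1) * ν := by positivity
    have : 0 ≤ r * q := by positivity
    linarith
  have hG := Real.Gamma_pos_of_pos hB
  have hq2 : 0 < Real.Gamma (q / 2) := Real.Gamma_pos_of_pos (by linarith)
  have hGA : 0 < Real.Gamma (((r + 1) * ν + r * (r - 1) + (r + 1) * q) / 2) :=
    Real.Gamma_pos_of_pos (by linarith)
  have hm : Measurable fun s : ℝ => ENNReal.ofReal (√s) ^ (q - 1) *
      (betaProfile (ν / 2 - 1) s ^ (r + 1) *
        ENNReal.ofReal (betaScale s ^ ((r : ℝ) * (r + 1 + (1 + (q - 1))) / 2))) :=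
    (Real.continuous_sqrt.measurable.ennreal_ofReal.pow_const _).mul
      (((sliceProfile_beta _).measurable.pow_const _).mul
        ((sliceProfile_beta 0).measurable_scale.pow_const _).ennreal_ofReal)
  have key := h₂ _ _ (sliceProfile_beta (ν / 2 - 1)) (q - 1)
  have e0 : ((r + 1 : ℕ) : ℝ) * (ν / 2 - 1) + (r : ℝ) * (r + 1 + (1 + (q - 1))) / 2 + 1 =
      ((r + 1) * ν + r * (r - 1) + r * q) / 2 := by push_cast; ring
  rw [h₁ _ (by linarith), h₄ _ hm, radialMoment_sqrt_rpow_mul,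
    radialMoment_beta (by push_cast; linarith) (Nat.le_add_left 1 r) (by rw [e0]; exact hB), e0,
    beta] at key
  rw [show (((1 : ℕ) : ℝ) + (q - 1)) / 2 = q / 2 by push_cast; ring,
    show q / 2 + ((r + 1) * ν + r * (r - 1) + r * q) / 2 =
      ((r + 1) * ν + r * (r - 1) + (r + 1) * q) / 2 by ring, Finset.prod_range_succ',
    show (((r + 1 : ℕ) : ℝ) + (q - 1)) / 2 + (ν / 2 - 1 + 1) = (r + ν + q) / 2 by push_cast; ring,
    show 1 + (q - 1) = q by ring, show (q - 1 + ((0 : ℕ) : ℝ) + 1) / 2 = q / 2 by push_cast; ring,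
    ← ENNReal.ofReal_toReal hK₂1, ← ENNReal.ofReal_mul hK₄.le, ← ENNReal.ofReal_mul hK₂.le] at key
  have e1 : ∀ j : ℕ, (q - 1 + ((j + 1 : ℕ) : ℝ) + 1) / 2 = (q + j + 1) / 2 := fun j => by
    push_cast; ring
  simp only [e1] at key
  set c := K₂.toReal * (K₄ * (Real.Gamma (q / 2) *
    Real.Gamma (((r + 1) * ν + r * (r - 1) + r * q) / 2) /
    Real.Gamma (((r + 1) * ν + r * (r - 1) + (r + 1) * q) / 2))) with hc
  have hc0 : 0 < c := by positivity
  have key2 : fullMoment (betaProfile (ν / 2 - 1)) r q = ENNReal.ofReal c⁻¹ *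
      (ENNReal.ofReal c * fullMoment (betaProfile (ν / 2 - 1)) r q) := by
    rw [← mul_assoc, ← ENNReal.ofReal_mul (by positivity), inv_mul_cancel₀ hc0.ne']
    simp
  rw [key2, ← key, ← ENNReal.ofReal_mul (by positivity)]
  congr 1
  rw [hc]
  field_simp

theorem exists_flatFactor_beta {ν : ℝ} (hν : 0 < ν) (r d : ℕ) : ∃ K : ℝ, 0 < K ∧ ∀ p : ℝ, 0 < p →
    ∫⁻ b : Fin d → ℝ, betaProfile (ν / 2 - 1) (b ⬝ᵥ b) ^ (r + 1) *
        ENNReal.ofReal (betaScale (b ⬝ᵥ b) ^ ((r : ℝ) * (r + 1 + (d + p)) / 2)) =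
      ENNReal.ofReal (K * (Real.Gamma (((r + 1) * ν + r * (r - 1) + r * (d + p)) / 2) /
        Real.Gamma ((d + (r + 1) * ν + r * (r - 1) + r * (d + p)) / 2))) := by
  have hr : (0 : ℝ) ≤ r := Nat.cast_nonneg r
  have hrr : (0 : ℝ) ≤ r * (r - 1) := by
    rcases Nat.eq_zero_or_pos r with rfl | h
    · simp
    · have : (1 : ℝ) ≤ r := by exact_mod_cast h
      exact mul_nonneg hr (by linarith)
  have hB : ∀ p : ℝ, 0 < p → 0 < ((r + 1) * ν + r * (r - 1) + r * (d + p)) / 2 := fun p hp => by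
    have : 0 < (r + 1) * ν := by positivity
    have : 0 ≤ r * (d + p) := by positivity
    linarith
  rcases Nat.eq_zero_or_pos d with rfl | hd
  · refine ⟨1, one_pos, fun p hp => ?_⟩
    have := Real.Gamma_pos_of_pos (hB p hp)
    push_cast
    rw [zero_add ((r + 1) * ν), div_self (by simpa using this.ne')]
    simp [lintegral_unique, betaProfile, betaScale, volume_pi_fin_zero_univ]
  · obtain ⟨K, hK, h⟩ := exists_lintegral_dotProduct_eq_radialMoment hd
    have hd' : (0 : ℝ) < d := by exact_mod_cast hd
    have hG : 0 < Real.Gamma (d / 2) := Real.Gamma_pos_of_pos (by linarith)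
    refine ⟨K * Real.Gamma (d / 2), by positivity, fun p hp => ?_⟩
    have hm : Measurable fun s : ℝ => betaProfile (ν / 2 - 1) s ^ (r + 1) *
        ENNReal.ofReal (betaScale s ^ ((r : ℝ) * (r + 1 + (d + p)) / 2)) :=
      ((sliceProfile_beta _).measurable.pow_const _).mul
        ((sliceProfile_beta 0).measurable_scale.pow_const _).ennreal_ofReal
    have e0 : ((r + 1 : ℕ) : ℝ) * (ν / 2 - 1) + (r : ℝ) * (r + 1 + (d + p)) / 2 + 1 =
        ((r + 1) * ν + r * (r - 1) + r * (d + p)) / 2 := by push_cast; ring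
    rw [h _ hm, radialMoment_beta (by linarith) (Nat.le_add_left 1 r)
      (by rw [e0]; exact hB p hp), e0, ← ENNReal.ofReal_mul hK.le, beta, add_zero]
    congr 1
    rw [show (d : ℝ) / 2 + ((r + 1) * ν + r * (r - 1) + r * (d + p)) / 2 =
      (d + (r + 1) * ν + r * (r - 1) + r * (d + p)) / 2 by ring]
    ring

/-- Moments of the volume of Beta simplices, up to normalisation. -/
theorem exists_simplexMoment_beta {ν : ℝ} (hν : 0 < ν) (r d : ℕ) :
    ∃ K : ℝ, 0 < K ∧ ∀ p : ℝ, 0 < p →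
    simplexMoment (betaProfile (ν / 2 - 1)) (r + d) r p = ENNReal.ofReal (K *
      ((∏ j ∈ Finset.range r, Real.Gamma ((d + p + j + 1) / 2)) /
        Real.Gamma ((r + d + ν) / 2 + p / 2) ^ (r + 1) *
        (Real.Gamma ((r + 1) * ((r + d + ν) / 2) - r + (r + 1) * (p / 2)) /
          Real.Gamma ((r + 1) * ((r + d + ν) / 2) - r + r * (p / 2))))) := by
  obtain ⟨K₁, hK₁0, hK₁1, h₁⟩ := exists_simplexMoment_eq r d
  obtain ⟨K₂, hK₂, h₂⟩ := exists_fullMoment_beta hν r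
  obtain ⟨K₃, hK₃, h₃⟩ := exists_flatFactor_beta hν r d
  have hK₁ := ENNReal.toReal_pos hK₁0 hK₁1
  refine ⟨K₁.toReal * K₃ * K₂, by positivity, fun p hp => ?_⟩
  have hd : (0 : ℝ) ≤ d := Nat.cast_nonneg d
  have hr : (0 : ℝ) ≤ r := Nat.cast_nonneg r
  have hrr : (0 : ℝ) ≤ r * (r - 1) := by
    rcases Nat.eq_zero_or_pos r with rfl | h
    · simp
    · have : (1 : ℝ) ≤ r := by exact_mod_cast h
      exact mul_nonneg hr (by linarith)
  have hB : 0 < ((r + 1) * ν + r * (r - 1) + r * (d + p)) / 2 := by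
    have : 0 < (r + 1) * ν := by positivity
    have : 0 ≤ r * (d + p) := by positivity
    linarith
  have hG := Real.Gamma_pos_of_pos hB
  have hG2 : 0 < Real.Gamma ((d + (r + 1) * ν + r * (r - 1) + r * (d + p)) / 2) :=
    Real.Gamma_pos_of_pos (by linarith)
  rw [h₁ _ _ (sliceProfile_beta _) p hp.le, h₃ p hp, h₂ _ (by linarith),
    ← ENNReal.ofReal_toReal hK₁1, ← ENNReal.ofReal_mul hK₁.le,
    ← ENNReal.ofReal_mul (by positivity), ENNReal.toReal_ofReal hK₁.le]
  congr 1
  -- The numerator Gamma of the flat factor equals the denominator Gamma of the inner moment at q =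
  -- d + p and cancels. The rest is written with a = (r + d + ν)/2 and A = (r + 1)a - r.
  rw [show (r + ν + (d + p)) / 2 = (r + d + ν) / 2 + p / 2 by ring,
    show ((r + 1) * ν + r * (r - 1) + (r + 1) * (d + p)) / 2 =
      (r + 1) * ((r + d + ν) / 2) - r + (r + 1) * (p / 2) by ring,
    show (r + 1) * ((r + d + ν) / 2) - r + r * (p / 2) =
      (d + (r + 1) * ν + r * (r - 1) + r * (d + p)) / 2 by ring]
  field_simp

/-! ### Laws with a radial density -/

theorem lintegral_pi_fin_cons {α : Type*} [MeasurableSpace α] (μ : Measure α) [SigmaFinite μ]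
    {m : ℕ} {F : (Fin (m + 1) → α) → ℝ≥0∞} (hF : Measurable F) :
    ∫⁻ x, F x ∂(Measure.pi fun _ : Fin (m + 1) => μ) =
      ∫⁻ v, ∫⁻ x, F (Fin.cons v x) ∂(Measure.pi fun _ : Fin m => μ) ∂μ := by
  have hp := (measurePreserving_piFinSuccAbove (fun _ : Fin (m + 1) => μ) 0).symm
  refine (hp.lintegral_comp hF).symm.trans ?_
  refine (lintegral_prod _ (hF.comp hp.measurable).aemeasurable).trans ?_
  refine lintegral_congr fun v => lintegral_congr fun x => ?_
  simp [MeasurableEquiv.piFinSuccAbove, Fin.insertNthEquiv]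

theorem lintegral_pi_withDensity {α : Type*} [MeasurableSpace α] (μ : Measure α) [SigmaFinite μ]
    {g : α → ℝ≥0∞} (hg : Measurable g) [SigmaFinite (μ.withDensity g)] {m : ℕ}
    {H : (Fin m → α) → ℝ≥0∞} (hH : Measurable H) :
    ∫⁻ x, H x ∂(Measure.pi fun _ : Fin m => μ.withDensity g) =
      ∫⁻ x, (∏ i, g (x i)) * H x ∂(Measure.pi fun _ : Fin m => μ) := by
  induction m with
  | zero =>
    simp only [Finset.univ_eq_empty, Finset.prod_empty, one_mul]
    rw [Measure.pi_of_empty, Measure.pi_of_empty]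
  | succ m ih =>
    have hpm : ∀ k : ℕ, Measurable fun x : Fin k → α => ∏ i, g (x i) := fun k =>
      Finset.measurable_prod _ fun i _ => hg.comp (measurable_pi_apply i)
    have hpH : Measurable fun x : Fin (m + 1) → α => (∏ i, g (x i)) * H x := (hpm _).mul hH
    rw [lintegral_pi_fin_cons _ hH, lintegral_pi_fin_cons _ hpH]
    have hHc : Measurable fun q : α × (Fin m → α) => H (Fin.cons q.1 q.2) :=
      hH.comp measurable_fin_cons
    have h1 : ∀ v, ∫⁻ x, H (Fin.cons v x) ∂(Measure.pi fun _ : Fin m => μ.withDensity g) =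
        ∫⁻ x, (∏ i, g (x i)) * H (Fin.cons v x) ∂(Measure.pi fun _ : Fin m => μ) := fun v =>
      ih (hHc.comp measurable_prodMk_left)
    simp only [h1]
    have hm : Measurable fun v => ∫⁻ x, (∏ i, g (x i)) * H (Fin.cons v x)
        ∂(Measure.pi fun _ : Fin m => μ) :=
      Measurable.lintegral_prod_right' (f := fun q : α × (Fin m → α) =>
        (∏ i, g (q.2 i)) * H (Fin.cons q.1 q.2)) (((hpm m).comp measurable_snd).mul hHc)
    rw [lintegral_withDensity_eq_lintegral_mul _ hg hm]
    refine lintegral_congr fun v => ?_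
    simp only [Pi.mul_apply]
    have hpv : Measurable fun x : Fin m → α => (∏ i, g (x i)) * H (Fin.cons v x) :=
      (hpm m).mul (hHc.comp measurable_prodMk_left)
    rw [← lintegral_const_mul _ hpv]
    refine lintegral_congr fun x => ?_
    simp only [Fin.prod_univ_succ, Fin.cons_zero, Fin.cons_succ, mul_assoc]

/-- The square root of the Gram determinant of the edge vectors of a simplex. -/
noncomputable def volFactor {n r : ℕ} (x : Fin (r + 1) → EuclideanSpace ℝ (Fin n)) : ℝ :=
  √(simplexGram (gramArray fun i => (x i).ofLp))

/-- The measure on `ℝⁿ` with density proportional to `f (|x|²)`. -/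
noncomputable def profileLaw (f : ℝ → ℝ≥0∞) (C : ℝ≥0∞) (n : ℕ) :
    Measure (EuclideanSpace ℝ (Fin n)) :=
  (volume.withDensity fun v : Fin n → ℝ => C * f (v ⬝ᵥ v)).map (WithLp.toLp 2)

theorem continuous_simplexGram {r : ℕ} :
    Continuous (simplexGram : (Fin (r + 1) → Fin (r + 1) → ℝ) → ℝ) := by
  unfold simplexGram
  refine Continuous.matrix_det ?_
  fun_prop

theorem continuous_volFactor {n r : ℕ} :
    Continuous (volFactor : (Fin (r + 1) → EuclideanSpace ℝ (Fin n)) → ℝ) := by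
  unfold volFactor
  refine Real.continuous_sqrt.comp (continuous_simplexGram.comp ?_)
  unfold gramArray
  fun_prop

theorem volFactor_nonneg {n r : ℕ} (x : Fin (r + 1) → EuclideanSpace ℝ (Fin n)) :
    0 ≤ volFactor x := Real.sqrt_nonneg _

theorem measurable_dotProduct_self {n : ℕ} : Measurable fun v : Fin n → ℝ => v ⬝ᵥ v := by
  unfold dotProduct
  fun_prop

theorem lintegral_pi_profileLaw {f : ℝ → ℝ≥0∞} (hf : Measurable f) {C : ℝ≥0∞} {n m : ℕ}
    [hprob : IsProbabilityMeasure (profileLaw f C n)]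
    {H : (Fin m → EuclideanSpace ℝ (Fin n)) → ℝ≥0∞} (hH : Measurable H) :
    ∫⁻ x, H x ∂(Measure.pi fun _ => profileLaw f C n) =
      ∫⁻ x : Fin m → Fin n → ℝ, (∏ i, C * f (gramArray x i i)) * H fun i => WithLp.toLp 2 (x i) := by
  have hg : Measurable fun v : Fin n → ℝ => C * f (v ⬝ᵥ v) :=
    (hf.comp measurable_dotProduct_self).const_mul _
  have hl : Measurable (WithLp.toLp 2 : (Fin n → ℝ) → EuclideanSpace ℝ (Fin n)) := by fun_prop
  have hfin : IsFiniteMeasure (volume.withDensity fun v : Fin n → ℝ => C * f (v ⬝ᵥ v)) := by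
    constructor
    have h := hprob.measure_univ
    rw [profileLaw, Measure.map_apply hl MeasurableSet.univ, Set.preimage_univ] at h
    rw [h]
    exact ENNReal.one_lt_top
  have hmap := Measure.pi_map_pi (μ := fun _ : Fin m =>
    volume.withDensity fun v : Fin n → ℝ => C * f (v ⬝ᵥ v))
    (f := fun _ => (WithLp.toLp 2 : (Fin n → ℝ) → EuclideanSpace ℝ (Fin n)))
    fun _ => hl.aemeasurable
  unfold profileLaw
  rw [← hmap]
  have hlm : Measurable fun (x : Fin m → Fin n → ℝ) i => WithLp.toLp 2 (x i) := by fun_prop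
  have hHl : Measurable fun x : Fin m → Fin n → ℝ => H fun i => WithLp.toLp 2 (x i) := hH.comp hlm
  rw [lintegral_map hH hlm, lintegral_pi_withDensity _ hg hHl]
  rfl

theorem lintegral_volFactor_profileLaw {f : ℝ → ℝ≥0∞} (hf : Measurable f) {C : ℝ≥0∞} (n r : ℕ)
    [IsProbabilityMeasure (profileLaw f C n)] (p : ℝ) :
    ∫⁻ x, ENNReal.ofReal (volFactor x) ^ p ∂(Measure.pi fun _ : Fin (r + 1) => profileLaw f C n) =
      C ^ (r + 1) * simplexMoment f n r p := by
  have hW : Measurable fun x : Fin (r + 1) → EuclideanSpace ℝ (Fin n) =>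
      ENNReal.ofReal (volFactor x) ^ p :=
    continuous_volFactor.measurable.ennreal_ofReal.pow_const p
  have hga : Measurable fun x : Fin (r + 1) → Fin n → ℝ => gramArray x := measurable_gramArray
  have hgd : ∀ i, Measurable fun x : Fin (r + 1) → Fin n → ℝ => gramArray x i i := fun i =>
    (measurable_pi_apply i).comp ((measurable_pi_apply i).comp hga)
  have hm : Measurable fun x : Fin (r + 1) → Fin n → ℝ =>
      (∏ i, f (gramArray x i i)) * ENNReal.ofReal (√(simplexGram (gramArray x))) ^ p :=
    (Finset.measurable_prod _ fun i _ => hf.comp (hgd i)).mul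
      (((measurable_simplexGram.comp hga).sqrt.ennreal_ofReal).pow_const p)
  rw [lintegral_pi_profileLaw hf hW, simplexMoment, ← lintegral_const_mul _ hm]
  refine lintegral_congr fun x => ?_
  rw [Finset.prod_mul_distrib, Finset.prod_const, Finset.card_univ, Fintype.card_fin, mul_assoc]
  rfl

/-- Apply the Blaschke–Petkantschin formula to the indicator of degenerate Gram matrices: inside a
flat the simplex factor is the square of a determinant that vanishes only on a null set. -/
theorem ae_simplexGram_pos (r d : ℕ) :
    ∀ᵐ x : Fin (r + 1) → Fin (r + d) → ℝ, 0 < simplexGram (gramArray x) := by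
  obtain ⟨K, hK0, hK1, hK⟩ := exists_lintegral_gramArray_eq_of_ne r d
  have hs : MeasurableSet {G : Fin (r + 1) → Fin (r + 1) → ℝ | simplexGram G ≤ 0} :=
    measurable_simplexGram measurableSet_Iic
  have hS : MeasurableSet {x : Fin (r + 1) → Fin (r + d) → ℝ | simplexGram (gramArray x) ≤ 0} :=
    measurable_gramArray hs
  have h := hK _ ((measurable_const (a := (1 : ℝ≥0∞))).indicator hs)
  have h0 : ∀ b : Fin d → ℝ, ∫⁻ y : Fin (r + 1) → Fin r → ℝ, ENNReal.ofReal |(onesLeft y).det| ^ d *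
      {G : Fin (r + 1) → Fin (r + 1) → ℝ | simplexGram G ≤ 0}.indicator (fun _ => 1)
        (fun i j => b ⬝ᵥ b + gramArray y i j) = 0 := fun b => by
    rw [lintegral_eq_zero_iff' (AEMeasurable.congr (f := fun _ => 0) aemeasurable_const ?_)]
    all_goals
      filter_upwards [ae_det_onesLeft_ne_zero r] with y hy
      have : ¬ simplexGram (fun i j => b ⬝ᵥ b + gramArray y i j) ≤ 0 := by
        rw [simplexGram_add_const, simplexGram_eq_det_onesLeft_sq]
        have := sq_pos_of_ne_zero hy
        linarith
      simp [this]
  simp only [h0, lintegral_zero, mul_zero] at h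
  have h' : ∫⁻ x, {x : Fin (r + 1) → Fin (r + d) → ℝ | simplexGram (gramArray x) ≤ 0}.indicator
      (fun _ => 1) x = 0 := h
  rw [lintegral_indicator_const hS, one_mul] at h'
  rw [ae_iff]
  simpa using h'

theorem ae_volFactor_pos_profileLaw {f : ℝ → ℝ≥0∞} (hf : Measurable f) {C : ℝ≥0∞} (r d : ℕ)
    [IsProbabilityMeasure (profileLaw f C (r + d))] :
    ∀ᵐ x ∂(Measure.pi fun _ : Fin (r + 1) => profileLaw f C (r + d)), 0 < volFactor x := by
  have hS : MeasurableSet {x : Fin (r + 1) → EuclideanSpace ℝ (Fin (r + d)) | ¬ 0 < volFactor x} :=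
    (isOpen_lt continuous_const continuous_volFactor).measurableSet.compl
  rw [ae_iff, ← lintegral_indicator_one hS, lintegral_pi_profileLaw hf
    (measurable_one.indicator hS)]
  refine (lintegral_congr_ae ?_).trans lintegral_zero
  filter_upwards [ae_simplexGram_pos r d] with x hx
  have : 0 < volFactor fun i => (WithLp.toLp 2 (x i) : EuclideanSpace ℝ (Fin (r + d))) :=
    Real.sqrt_pos.2 hx
  simp [this]

/-! ### The Gaussian and Beta laws as radial densities. -/

theorem exists_stdGaussian_eq_profileLaw (n : ℕ) :
    ∃ C : ℝ≥0∞, stdGaussian (EuclideanSpace ℝ (Fin n)) = profileLaw gaussProfile C n := by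
  refine ⟨ENNReal.ofReal ((√(2 * Real.pi))⁻¹) ^ n, ?_⟩
  rw [← map_pi_eq_stdGaussian, profileLaw]
  congr 1
  have hg : gaussianReal 0 1 = volume.withDensity (gaussianPDF 0 1) :=
    gaussianReal_of_var_ne_zero _ one_ne_zero
  have : SigmaFinite (volume.withDensity (gaussianPDF 0 1)) := by rw [← hg]; infer_instance
  ext s hs
  rw [hg, ← lintegral_indicator_one hs, lintegral_pi_withDensity _ (measurable_gaussianPDF 0 1)
    (measurable_one.indicator hs), withDensity_apply _ hs, ← lintegral_indicator hs]
  refine lintegral_congr fun x => ?_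
  by_cases hx : x ∈ s
  · simp only [hx, Set.indicator_of_mem, Pi.one_apply, mul_one]
    simp only [gaussianPDF, gaussianPDFReal, gaussProfile]
    rw [← ENNReal.ofReal_prod_of_nonneg fun i _ => by positivity, Finset.prod_mul_distrib,
      ← Real.exp_sum, ENNReal.ofReal_mul (by positivity)]
    simp only [Finset.prod_const, Finset.card_univ, Fintype.card_fin, NNReal.coe_one, mul_one,
      sub_zero]
    rw [ENNReal.ofReal_pow (by positivity)]
    congr 3
    simp only [dotProduct, ← sq, ← Finset.sum_neg_distrib, Finset.sum_div]
  · simp [hx]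

theorem exists_betaBall_eq_profileLaw (n : ℕ) (ν : ℝ) :
    ∃ C : ℝ≥0∞, betaBall n ν = profileLaw (betaProfile (ν / 2 - 1)) C n := by
  set c : ℝ := 1 / Real.pi ^ ((n : ℝ) / 2) * (Real.Gamma (((n : ℝ) + ν) / 2) / Real.Gamma (ν / 2))
    with hc
  refine ⟨ENNReal.ofReal c, ?_⟩
  have h1 : betaBall n ν = volume.withDensity fun x : EuclideanSpace ℝ (Fin n) =>
      ENNReal.ofReal c * betaProfile (ν / 2 - 1) (‖x‖ ^ 2) := by
    rw [betaBall, ← withDensity_indicator measurableSet_ball]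
    congr 1
    ext x
    by_cases hx : x ∈ Metric.ball (0 : EuclideanSpace ℝ (Fin n)) 1
    · have hx1 : ‖x‖ < 1 := by simpa using hx
      have hx2 : ‖x‖ ^ 2 < 1 := by nlinarith [norm_nonneg x]
      rw [Set.indicator_of_mem hx, betaProfile, if_pos hx2, ← hc,
        ENNReal.ofReal_mul' (Real.rpow_nonneg (by linarith) _)]
      congr 3
      ring
    · have hx1 : 1 ≤ ‖x‖ := by simpa using hx
      have hx2 : ¬ ‖x‖ ^ 2 < 1 := by nlinarith [norm_nonneg x]
      rw [Set.indicator_of_notMem hx, betaProfile, if_neg hx2, mul_zero]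
  have hl : Measurable (WithLp.toLp 2 : (Fin n → ℝ) → EuclideanSpace ℝ (Fin n)) := by fun_prop
  have hG : Measurable fun x : EuclideanSpace ℝ (Fin n) =>
      ENNReal.ofReal c * betaProfile (ν / 2 - 1) (‖x‖ ^ 2) :=
    ((sliceProfile_beta _).measurable.comp (measurable_norm.pow_const 2)).const_mul _
  rw [h1, profileLaw]
  ext s hs
  rw [withDensity_apply _ hs, Measure.map_apply hl hs, withDensity_apply _ (hl hs),
    ← (PiLp.volume_preserving_toLp (Fin n)).setLIntegral_comp_preimage hs hG]
  refine lintegral_congr fun v => ?_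
  congr 2
  rw [EuclideanSpace.norm_sq_eq]
  simp [dotProduct, sq]

/-! ### Normalised moments in the Gaussian and Beta models -/

/-- W^p tends to 1 where W > 0 and is 0 elsewhere for p > 0, while 1 + W dominates for p < 1. The
limit thus detects an atom of W at 0. -/
theorem tendsto_lintegral_rpow_zero {α : Type*} [MeasurableSpace α] {μ : Measure α}
    [IsProbabilityMeasure μ] {W : α → ℝ} (hW : Measurable W)
    (h1 : ∫⁻ x, ENNReal.ofReal (W x) ^ (1 : ℝ) ∂μ ≠ ∞) :
    Tendsto (fun p : ℝ => ∫⁻ x, ENNReal.ofReal (W x) ^ p ∂μ) (𝓝[>] 0) (𝓝 (μ {x | 0 < W x})) := by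
  have hS : MeasurableSet {x | 0 < W x} := measurableSet_lt measurable_const hW
  rw [← lintegral_indicator_one hS]
  refine tendsto_lintegral_filter_of_dominated_convergence
    (fun x => 1 + ENNReal.ofReal (W x) ^ (1 : ℝ))
    (.of_forall fun p => hW.ennreal_ofReal.pow_const p) ?_ ?_ ?_
  · filter_upwards [Ioo_mem_nhdsGT (zero_lt_one (α := ℝ))] with p hp
    refine .of_forall fun x => ?_
    rcases le_total (ENNReal.ofReal (W x)) 1 with h | h
    · exact (ENNReal.rpow_le_one h hp.1.le).trans le_self_add
    · exact (ENNReal.rpow_le_rpow_of_exponent_le h hp.2.le).trans le_add_self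
  · rw [lintegral_add_left measurable_const]
    simp only [lintegral_const, measure_univ, one_mul]
    exact ENNReal.add_ne_top.2 ⟨ENNReal.one_ne_top, h1⟩
  · refine .of_forall fun x => ?_
    by_cases hx : 0 < W x
    · rw [Set.indicator_of_mem (by exact hx)]
      have h0 : 0 < W x := hx
      simp only [ENNReal.ofReal_rpow_of_pos h0, Pi.one_apply]
      have h2 := (ENNReal.continuous_ofReal.comp (Real.continuous_const_rpow h0.ne')).tendsto 0
      simp only [Function.comp, Real.rpow_zero, ENNReal.ofReal_one] at h2
      exact h2.mono_left nhdsWithin_le_nhds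
    · rw [Set.indicator_of_notMem (by exact hx)]
      refine tendsto_const_nhds.congr' ?_
      filter_upwards [self_mem_nhdsWithin] with p hp
      rw [ENNReal.ofReal_of_nonpos (not_lt.1 hx), ENNReal.zero_rpow_of_pos hp]

theorem measure_pos_eq_of_moment {α : Type*} [MeasurableSpace α] {μ : Measure α}
    [IsProbabilityMeasure μ] {W : α → ℝ} (hW : Measurable W) {F : ℝ → ℝ}
    (hF : ContinuousWithinAt F (Set.Ioi 0) 0)
    (h : ∀ p : ℝ, 0 < p → ∫⁻ x, ENNReal.ofReal (W x) ^ p ∂μ = ENNReal.ofReal (F p)) :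
    μ {x | 0 < W x} = ENNReal.ofReal (F 0) := by
  refine tendsto_nhds_unique (tendsto_lintegral_rpow_zero hW (by rw [h 1 one_pos]; finiteness)) ?_
  refine ((ENNReal.continuous_ofReal.tendsto _).comp hF).congr' ?_
  filter_upwards [self_mem_nhdsWithin] with p hp
  exact (h p hp).symm

/-- The unnormalised `p`-th moment of the volume of Gaussian simplices. -/
noncomputable def gaussMoment (r d : ℕ) (p : ℝ) : ℝ :=
  (((r : ℝ) + 1) * 2 ^ r) ^ (p / 2) * ∏ j ∈ Finset.range r, Real.Gamma ((d + p + j + 1) / 2)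

/-- The unnormalised `p`-th moment of the volume of Beta simplices. -/
noncomputable def betaMoment (r d : ℕ) (ν p : ℝ) : ℝ :=
  (∏ j ∈ Finset.range r, Real.Gamma ((d + p + j + 1) / 2)) /
    Real.Gamma ((r + d + ν) / 2 + p / 2) ^ (r + 1) *
    (Real.Gamma ((r + 1) * ((r + d + ν) / 2) - r + (r + 1) * (p / 2)) /
      Real.Gamma ((r + 1) * ((r + d + ν) / 2) - r + r * (p / 2)))

theorem Real.continuousAt_Gamma_comp {X : Type*} [TopologicalSpace X] {f : X → ℝ} {x : X}
    (hf : ContinuousAt f x) (h : 0 < f x) : ContinuousAt (fun y => Real.Gamma (f y)) x :=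
  ContinuousAt.comp (g := Real.Gamma)
    (Real.differentiableAt_Gamma fun m => by
      have : (0 : ℝ) ≤ m := Nat.cast_nonneg m
      linarith).continuousAt hf

theorem continuousAt_prod_Gamma (r d : ℕ) {p : ℝ} (hp : 0 ≤ p) :
    ContinuousAt (fun p : ℝ => ∏ j ∈ Finset.range r, Real.Gamma ((d + p + j + 1) / 2)) p :=
  tendsto_finsetProd _ fun j _ => Real.continuousAt_Gamma_comp (by fun_prop) (by positivity)

theorem continuousAt_gaussMoment (r d : ℕ) {p : ℝ} (hp : 0 ≤ p) :
    ContinuousAt (gaussMoment r d) p := by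
  have h : (0 : ℝ) < ((r : ℝ) + 1) * 2 ^ r := by positivity
  unfold gaussMoment
  exact ((Real.continuous_const_rpow h.ne').comp (by fun_prop)).continuousAt.mul
    (continuousAt_prod_Gamma r d hp)

theorem continuousAt_betaMoment (r d : ℕ) {ν p : ℝ} (hp : 0 ≤ p) (ha : 0 < r + d + ν)
    (hA : 0 < (r + 1) * ((r + d + ν) / 2) - r) :
    ContinuousAt (fun q : ℝ × ℝ => betaMoment r d q.1 q.2) (ν, p) := by
  have hr : (0 : ℝ) ≤ r := Nat.cast_nonneg r
  have h1 : 0 < (r + d + ν) / 2 + p / 2 := by positivity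
  have h2 : 0 < (r + 1) * ((r + d + ν) / 2) - r + r * (p / 2) := by positivity
  unfold betaMoment
  refine ContinuousAt.mul (ContinuousAt.div ?_ (ContinuousAt.pow ?_ _) ?_) (ContinuousAt.div ?_ ?_ ?_)
  · exact ContinuousAt.comp (g := fun p : ℝ => ∏ j ∈ Finset.range r, Real.Gamma ((d + p + j + 1) / 2))
      (f := Prod.snd) (continuousAt_prod_Gamma r d hp) continuousAt_snd
  · exact Real.continuousAt_Gamma_comp (by fun_prop) h1
  · exact pow_ne_zero _ (Real.Gamma_pos_of_pos h1).ne'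
  · exact Real.continuousAt_Gamma_comp (by fun_prop) (by positivity)
  · exact Real.continuousAt_Gamma_comp (by fun_prop) h2
  · exact (Real.Gamma_pos_of_pos h2).ne'

theorem gaussMoment_pos (r d : ℕ) {p : ℝ} (hp : 0 ≤ p) : 0 < gaussMoment r d p :=
  mul_pos (Real.rpow_pos_of_pos (by positivity) _)
    (Finset.prod_pos fun j _ => Real.Gamma_pos_of_pos (by positivity))

theorem betaMoment_pos (r d : ℕ) {ν p : ℝ} (hp : 0 ≤ p) (ha : 0 < r + d + ν)
    (hA : 0 < (r + 1) * ((r + d + ν) / 2) - r) : 0 < betaMoment r d ν p := by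
  refine mul_pos (div_pos (Finset.prod_pos fun j _ => Real.Gamma_pos_of_pos (by positivity))
    (pow_pos (Real.Gamma_pos_of_pos (by positivity)) _))
    (div_pos (Real.Gamma_pos_of_pos (by positivity)) (Real.Gamma_pos_of_pos (by positivity)))

/-- The moments are known only up to a factor free of p. Letting p → 0 gives P(W > 0) = 1 on one
side and that factor times F 0 on the other. -/
theorem lintegral_volFactor_eq_div {f : ℝ → ℝ≥0∞} (hf : Measurable f) {C : ℝ≥0∞} (r d : ℕ)
    [IsProbabilityMeasure (profileLaw f C (r + d))] {F : ℝ → ℝ} (hFc : ContinuousAt F 0)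
    (hF : ∀ p, 0 ≤ p → 0 < F p)
    (h : ∃ K : ℝ, 0 < K ∧ ∀ p : ℝ, 0 < p → simplexMoment f (r + d) r p = ENNReal.ofReal (K * F p))
    {p : ℝ} (hp : 0 < p) :
    ∫⁻ x, ENNReal.ofReal (volFactor x) ^ p
      ∂(Measure.pi fun _ : Fin (r + 1) => profileLaw f C (r + d)) = ENNReal.ofReal (F p / F 0) := by
  obtain ⟨K, hK, h⟩ := h
  set μ := Measure.pi fun _ : Fin (r + 1) => profileLaw f C (r + d) with hμ
  have hpos := ae_volFactor_pos_profileLaw hf (C := C) r d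
  rw [← hμ] at hpos
  have hW : Measurable (volFactor : (Fin (r + 1) → EuclideanSpace ℝ (Fin (r + d))) → ℝ) :=
    continuous_volFactor.measurable
  have hm : ∀ p : ℝ, 0 < p → ∫⁻ x, ENNReal.ofReal (volFactor x) ^ p ∂μ =
      C ^ (r + 1) * ENNReal.ofReal (K * F p) := fun p hp => by
    rw [hμ, lintegral_volFactor_profileLaw hf, h p hp]
  -- An infinite density constant would give the law total mass 0 or ∞.
  have hC : C ^ (r + 1) ≠ ∞ := by
    intro hC
    have h1 := hm 1 one_pos
    rw [hC, ENNReal.top_mul (by simpa using mul_pos hK (hF 1 zero_le_one))] at h1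
    have h2 : C = ∞ := by
      by_contra h
      exact ENNReal.pow_ne_top h hC
    have hfin : profileLaw f C (r + d) Set.univ = 1 := measure_univ
    have hl : Measurable (WithLp.toLp 2 : (Fin (r + d) → ℝ) → EuclideanSpace ℝ (Fin (r + d))) := by
      fun_prop
    have hfm : Measurable fun v : Fin (r + d) → ℝ => f (v ⬝ᵥ v) := hf.comp measurable_dotProduct_self
    rw [profileLaw, Measure.map_apply hl MeasurableSet.univ, Set.preimage_univ,
      withDensity_apply _ MeasurableSet.univ, Measure.restrict_univ,
      lintegral_const_mul _ hfm, h2] at hfin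
    by_cases h0 : ∫⁻ v : Fin (r + d) → ℝ, f (v ⬝ᵥ v) = 0
    · simp [h0] at hfin
    · simp [ENNReal.top_mul h0] at hfin
  have hm' : ∀ p : ℝ, 0 < p → ∫⁻ x, ENNReal.ofReal (volFactor x) ^ p ∂μ =
      ENNReal.ofReal ((C ^ (r + 1)).toReal * K * F p) := fun p hp => by
    rw [hm p hp, mul_assoc, ENNReal.ofReal_mul ENNReal.toReal_nonneg, ENNReal.ofReal_toReal hC]
  have h1 := measure_pos_eq_of_moment hW
    (F := fun p => (C ^ (r + 1)).toReal * K * F p) (hFc.const_mul _).continuousWithinAt hm'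
  have h2 : μ {x | 0 < volFactor x} = 1 := by
    have : IsProbabilityMeasure μ := by rw [hμ]; infer_instance
    rw [← prob_compl_eq_zero_iff (measurableSet_lt measurable_const hW)]
    exact hpos
  rw [h2, eq_comm, ENNReal.ofReal_eq_one] at h1
  have hF0 := hF 0 le_rfl
  rw [hm' p hp, eq_div_of_mul_eq hF0.ne' h1]
  congr 1
  ring

theorem lintegral_volFactor_stdGaussian (r d : ℕ) {p : ℝ} (hp : 0 < p) :
    ∫⁻ x, ENNReal.ofReal (volFactor x) ^ p
      ∂(Measure.pi fun _ : Fin (r + 1) => stdGaussian (EuclideanSpace ℝ (Fin (r + d)))) =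
      ENNReal.ofReal (gaussMoment r d p / gaussMoment r d 0) := by
  obtain ⟨C, hC⟩ := exists_stdGaussian_eq_profileLaw (r + d)
  have : IsProbabilityMeasure (profileLaw gaussProfile C (r + d)) := by
    rw [← hC]; infer_instance
  rw [hC]
  exact lintegral_volFactor_eq_div sliceProfile_gauss.measurable r d
    (continuousAt_gaussMoment r d le_rfl) (fun p hp => gaussMoment_pos r d hp)
    (exists_simplexMoment_gauss r d) hp

theorem ae_volFactor_pos_stdGaussian (r d : ℕ) :
    ∀ᵐ x ∂(Measure.pi fun _ : Fin (r + 1) => stdGaussian (EuclideanSpace ℝ (Fin (r + d)))),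
      0 < volFactor x := by
  obtain ⟨C, hC⟩ := exists_stdGaussian_eq_profileLaw (r + d)
  have : IsProbabilityMeasure (profileLaw gaussProfile C (r + d)) := by
    rw [← hC]; infer_instance
  rw [hC]
  exact ae_volFactor_pos_profileLaw sliceProfile_gauss.measurable r d

/-- These are the Gamma arguments a and A, up to a factor 2 in the first. For ν = 0 the dimension
must be at least 2: with r = 1, d = 0 the second quantity is 0, reflecting that two points of S⁰
coincide with probability 1/2. -/
theorem vertexParam_pos {ν : ℝ} (r d : ℕ) (h : 0 < ν ∨ (0 ≤ ν ∧ 2 ≤ r + d)) :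
    0 < (r : ℝ) + d + ν ∧ 0 < ((r : ℝ) + 1) * ((r + d + ν) / 2) - r := by
  have hd : (0 : ℝ) ≤ d := Nat.cast_nonneg d
  have hr : (0 : ℝ) ≤ r := Nat.cast_nonneg r
  have hrr : (0 : ℝ) ≤ r * (r - 1) := by
    rcases Nat.eq_zero_or_pos r with rfl | h
    · simp
    · have : (1 : ℝ) ≤ r := by exact_mod_cast h
      exact mul_nonneg hr (by linarith)
  have hrd : 0 ≤ (r : ℝ) * d := by positivity
  rcases h with h | ⟨h, h2⟩
  · have : 0 ≤ (r : ℝ) * ν := by positivity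
    exact ⟨by positivity, by nlinarith⟩
  · have h2 : (2 : ℝ) ≤ r + d := by exact_mod_cast h2
    refine ⟨by linarith, ?_⟩
    nlinarith

theorem lintegral_volFactor_beta {ν : ℝ} (hν : 0 < ν) (r d : ℕ) {C : ℝ≥0∞}
    [IsProbabilityMeasure (profileLaw (betaProfile (ν / 2 - 1)) C (r + d))] {p : ℝ} (hp : 0 < p) :
    ∫⁻ x, ENNReal.ofReal (volFactor x) ^ p ∂(Measure.pi fun _ : Fin (r + 1) =>
      profileLaw (betaProfile (ν / 2 - 1)) C (r + d)) =
      ENNReal.ofReal (betaMoment r d ν p / betaMoment r d ν 0) := by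
  obtain ⟨ha, hA⟩ := vertexParam_pos r d (Or.inl hν)
  exact lintegral_volFactor_eq_div (sliceProfile_beta _).measurable r d
    (ContinuousAt.comp (g := fun q : ℝ × ℝ => betaMoment r d q.1 q.2) (f := fun p => (ν, p))
      (continuousAt_betaMoment r d le_rfl ha hA) (by fun_prop))
    (fun p hp => betaMoment_pos r d hp ha hA) (exists_simplexMoment_beta hν r d) hp

/-! ### The uniform distribution on the sphere as a limit of Beta distributions -/

theorem lintegral_profileLaw {f : ℝ → ℝ≥0∞} (hf : Measurable f) (C : ℝ≥0∞) (n : ℕ)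
    {H : EuclideanSpace ℝ (Fin n) → ℝ≥0∞} (hH : Measurable H) :
    ∫⁻ x, H x ∂(profileLaw f C n) =
      C * ∫⁻ x : EuclideanSpace ℝ (Fin n), f (‖x‖ ^ 2) * H x := by
  have hl : Measurable (WithLp.toLp 2 : (Fin n → ℝ) → EuclideanSpace ℝ (Fin n)) := by fun_prop
  have hg : Measurable fun v : Fin n → ℝ => C * f (v ⬝ᵥ v) :=
    (hf.comp measurable_dotProduct_self).const_mul _
  have hG : Measurable fun x : EuclideanSpace ℝ (Fin n) => f (‖x‖ ^ 2) * H x :=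
    (hf.comp (measurable_norm.pow_const 2)).mul hH
  have hHl : Measurable fun v : Fin n → ℝ => H (WithLp.toLp 2 v) := hH.comp hl
  rw [profileLaw, lintegral_map hH hl, lintegral_withDensity_eq_lintegral_mul _ hg hHl,
    ← (PiLp.volume_preserving_toLp (Fin n)).lintegral_comp hG]
  have hG' : Measurable fun v : Fin n → ℝ =>
      f (‖(WithLp.toLp 2 v : EuclideanSpace ℝ (Fin n))‖ ^ 2) *
      H (WithLp.toLp 2 v : EuclideanSpace ℝ (Fin n)) := hG.comp hl
  rw [← lintegral_const_mul _ hG']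
  refine lintegral_congr fun v => ?_
  have : ‖(WithLp.toLp 2 v : EuclideanSpace ℝ (Fin n))‖ ^ 2 = v ⬝ᵥ v := by
    rw [EuclideanSpace.norm_sq_eq]
    simp [dotProduct, sq]
  simp only [Pi.mul_apply, this, mul_assoc]

/-- In polar coordinates the direction of a radially distributed vector separates from its norm. The
law of the direction is a multiple of surface measure, and total mass one fixes the multiple. -/
theorem map_normalize_profileLaw {f : ℝ → ℝ≥0∞} (hf : Measurable f) {C : ℝ≥0∞} {n : ℕ}
    (hn : 1 ≤ n) [IsProbabilityMeasure (profileLaw f C n)] :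
    (profileLaw f C n).map (fun x => ‖x‖⁻¹ • x) = uniformSphere n := by
  have : Nonempty (Fin n) := ⟨⟨0, hn⟩⟩
  set S := (volume : Measure (EuclideanSpace ℝ (Fin n))).toSphere with hS
  have hnm : Measurable fun x : EuclideanSpace ℝ (Fin n) => ‖x‖⁻¹ • x := by fun_prop
  have key : ∃ c : ℝ≥0∞, ∀ H : EuclideanSpace ℝ (Fin n) → ℝ≥0∞, Measurable H →
      ∫⁻ x, H (‖x‖⁻¹ • x) ∂(profileLaw f C n) =
        c * ∫⁻ u : Metric.sphere (0 : EuclideanSpace ℝ (Fin n)) 1, H u ∂S := by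
    refine ⟨C * ∫⁻ t in Set.Ioi (0 : ℝ), ENNReal.ofReal (t ^ (n - 1)) * f (t ^ 2), fun H hH => ?_⟩
    have hHn : Measurable fun x : EuclideanSpace ℝ (Fin n) => H (‖x‖⁻¹ • x) := hH.comp hnm
    have hG : Measurable fun x : EuclideanSpace ℝ (Fin n) => f (‖x‖ ^ 2) * H (‖x‖⁻¹ • x) :=
      (hf.comp (measurable_norm.pow_const 2)).mul hHn
    rw [lintegral_profileLaw hf C n hHn, lintegral_eq_lintegral_sphere volume hG, mul_assoc]
    congr 1
    have hHs : Measurable fun u : Metric.sphere (0 : EuclideanSpace ℝ (Fin n)) 1 => H u :=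
      hH.comp measurable_subtype_coe
    rw [← lintegral_const_mul _ hHs]
    refine lintegral_congr fun u => ?_
    have hft : Measurable fun t : ℝ => ENNReal.ofReal (t ^ (n - 1)) * f (t ^ 2) :=
      (by fun_prop : Measurable fun t : ℝ => ENNReal.ofReal (t ^ (n - 1))).mul
        (hf.comp (measurable_id.pow_const 2))
    rw [← lintegral_mul_const _ hft]
    refine setLIntegral_congr_fun measurableSet_Ioi fun t ht => ?_
    have ht : 0 < t := ht
    have hu : ‖(u : EuclideanSpace ℝ (Fin n))‖ = 1 := by simp
    simp only [norm_smul, hu, mul_one, Real.norm_eq_abs, abs_of_pos ht, smul_smul,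
      inv_mul_cancel₀ ht.ne', one_smul, finrank_euclideanSpace, Fintype.card_fin, mul_assoc]
  obtain ⟨c, hc⟩ := key
  have h1 := hc (fun _ => 1) measurable_const
  simp only [lintegral_const, measure_univ, one_mul] at h1
  have hc' : c = (S Set.univ)⁻¹ := ENNReal.eq_inv_of_mul_eq_one_left h1.symm
  ext s hs
  have h2 := hc (s.indicator 1) (measurable_one.indicator hs)
  rw [← lintegral_indicator_one hs, lintegral_map (measurable_one.indicator hs) hnm, h2,
    uniformSphere, Measure.map_apply measurable_subtype_coe hs, Measure.smul_apply, smul_eq_mul,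
    ← lintegral_indicator_one (measurable_subtype_coe hs), hc']
  rfl

/-! ### Concentration of the Beta laws on the sphere as the parameter tends to 0. -/

theorem exists_betaProfile_mass {n : ℕ} (hn : 1 ≤ n) : ∃ c : ℝ, 0 < c ∧ ∀ ν : ℝ, 0 < ν →
    ∫⁻ x : EuclideanSpace ℝ (Fin n), betaProfile (ν / 2 - 1) (‖x‖ ^ 2) =
      ENNReal.ofReal (c * beta (n / 2) (ν / 2)) := by
  obtain ⟨c, hc, h⟩ := exists_lintegral_dotProduct_eq_radialMoment hn
  refine ⟨c, hc, fun ν hν => ?_⟩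
  have hG : Measurable fun x : EuclideanSpace ℝ (Fin n) => betaProfile (ν / 2 - 1) (‖x‖ ^ 2) :=
    (sliceProfile_beta _).measurable.comp (measurable_norm.pow_const 2)
  have hn' : (0 : ℝ) < n := by exact_mod_cast hn
  have hb := radialMoment_beta (n := n) (p := 0) (by linarith) (le_refl 1) (β := ν / 2 - 1) (e := 0)
    (by push_cast; linarith)
  simp only [pow_one, Real.rpow_zero, ENNReal.ofReal_one, mul_one, Nat.cast_one, one_mul,
    add_zero, sub_add_cancel] at hb
  rw [ENNReal.ofReal_mul hc.le, ← hb, ← h _ (sliceProfile_beta _).measurable,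
    ← (PiLp.volume_preserving_toLp (Fin n)).lintegral_comp hG]
  refine lintegral_congr fun v => ?_
  congr 1
  rw [EuclideanSpace.norm_sq_eq]
  simp [dotProduct, sq]

/-- Multiplying the Beta weight by 1 - |x|² raises ν to ν + 2, so the expectation is a quotient of
Beta functions, namely ν/(n + ν). The constant C is taken as the inverse mass, without comparison
with the explicit density constant. -/
theorem exists_isProbabilityMeasure_beta {n : ℕ} (hn : 1 ≤ n) {ν : ℝ} (hν : 0 < ν) :
    ∃ C : ℝ≥0∞, IsProbabilityMeasure (profileLaw (betaProfile (ν / 2 - 1)) C n) ∧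
      ∫⁻ x, ENNReal.ofReal (1 - ‖x‖ ^ 2) ∂(profileLaw (betaProfile (ν / 2 - 1)) C n) ≤
        ENNReal.ofReal ν := by
  obtain ⟨c, hc, h⟩ := exists_betaProfile_mass hn
  have hn' : (1 : ℝ) ≤ n := by exact_mod_cast hn
  have hb : 0 < c * beta (n / 2) (ν / 2) := mul_pos hc (beta_pos (by linarith) (by linarith))
  have hf := (sliceProfile_beta (ν / 2 - 1)).measurable
  refine ⟨(ENNReal.ofReal (c * beta (n / 2) (ν / 2)))⁻¹, ⟨?_⟩, ?_⟩
  · rw [← setLIntegral_one, Measure.restrict_univ, lintegral_profileLaw hf _ _ measurable_const]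
    simp only [mul_one]
    rw [h ν hν, ENNReal.inv_mul_cancel (by simpa using hb) (by finiteness)]
  · have hm : Measurable fun x : EuclideanSpace ℝ (Fin n) => ENNReal.ofReal (1 - ‖x‖ ^ 2) := by
      fun_prop
    rw [lintegral_profileLaw hf _ _ hm]
    have e1 : ∀ x : EuclideanSpace ℝ (Fin n), betaProfile (ν / 2 - 1) (‖x‖ ^ 2) *
        ENNReal.ofReal (1 - ‖x‖ ^ 2) = betaProfile ((ν + 2) / 2 - 1) (‖x‖ ^ 2) := fun x => by
      unfold betaProfile
      split_ifs with hx
      · rw [← ENNReal.ofReal_mul (Real.rpow_nonneg (by linarith) _), show (ν + 2) / 2 - 1 =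
          (ν / 2 - 1) + 1 by ring, Real.rpow_add (by linarith), Real.rpow_one]
      · simp
    simp only [e1]
    rw [h (ν + 2) (by linarith), ← ENNReal.ofReal_inv_of_pos hb,
      ← ENNReal.ofReal_mul (by positivity)]
    refine ENNReal.ofReal_le_ofReal ?_
    have hG1 : 0 < Real.Gamma (n / 2) := Real.Gamma_pos_of_pos (by linarith)
    have hG2 : 0 < Real.Gamma (ν / 2) := Real.Gamma_pos_of_pos (by linarith)
    have hG3 : 0 < Real.Gamma (n / 2 + ν / 2) := Real.Gamma_pos_of_pos (by linarith)
    rw [beta, beta, show (ν + 2) / 2 = ν / 2 + 1 by ring, Real.Gamma_add_one (by linarith),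
      ← add_assoc, Real.Gamma_add_one (by linarith)]
    rw [show (c * (Real.Gamma (n / 2) * Real.Gamma (ν / 2) / Real.Gamma (n / 2 + ν / 2)))⁻¹ *
      (c * (Real.Gamma (n / 2) * (ν / 2 * Real.Gamma (ν / 2)) /
        ((n / 2 + ν / 2) * Real.Gamma (n / 2 + ν / 2)))) = ν / (n + ν) by field_simp]
    exact div_le_self hν.le (by linarith)

theorem ae_norm_le_one_betaProfile (β : ℝ) (C : ℝ≥0∞) (n : ℕ) :
    ∀ᵐ x ∂(profileLaw (betaProfile β) C n), ‖x‖ ≤ 1 := by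
  have hS : MeasurableSet {x : EuclideanSpace ℝ (Fin n) | ¬ ‖x‖ ≤ 1} :=
    (measurableSet_le measurable_norm measurable_const).compl
  rw [ae_iff, ← lintegral_indicator_one hS,
    lintegral_profileLaw (sliceProfile_beta β).measurable _ _ (measurable_one.indicator hS)]
  rw [lintegral_congr (g := fun _ => 0) fun x => ?_, lintegral_zero, mul_zero]
  by_cases hx : ‖x‖ ≤ 1
  · simp [hx]
  · have : ¬ ‖x‖ ^ 2 < 1 := by nlinarith [norm_nonneg x]
    simp only [betaProfile, if_neg this, zero_mul]

theorem norm_cexp_mul_I_sub_le (a b : ℝ) :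
    ‖Complex.exp (a * Complex.I) - Complex.exp (b * Complex.I)‖ ≤ |a - b| := by
  have h : Complex.exp (a * Complex.I) - Complex.exp (b * Complex.I) =
      Complex.exp (b * Complex.I) * (Complex.exp (Complex.I * ((a - b : ℝ) : ℂ)) - 1) := by
    rw [mul_sub, ← Complex.exp_add, mul_one]
    congr 2
    push_cast
    ring
  rw [h, norm_mul, Complex.norm_exp_ofReal_mul_I, one_mul]
  exact Real.norm_exp_I_mul_ofReal_sub_one_le

theorem norm_sub_normalize_le {E : Type*} [NormedAddCommGroup E] [NormedSpace ℝ E] {x : E}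
    (hx : ‖x‖ ≤ 1) : ‖x - ‖x‖⁻¹ • x‖ ≤ 1 - ‖x‖ ^ 2 := by
  -- At the origin the normalised vector is 0 by the convention 0⁻¹ = 0, and the inequality reads 0
  -- ≤ 1.
  rcases eq_or_ne x 0 with rfl | h0
  · simp
  · have hp : 0 < ‖x‖ := norm_pos_iff.2 h0
    have : x - ‖x‖⁻¹ • x = (1 - ‖x‖⁻¹) • x := by rw [sub_smul, one_smul]
    rw [this, norm_smul, Real.norm_eq_abs, abs_of_nonpos (by
      rw [sub_nonpos]; exact (one_le_inv₀ hp).2 hx), neg_sub, sub_mul, inv_mul_cancel₀ hp.ne']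
    nlinarith

/-- Couple x with x/|x|, which is uniform on the sphere. The two exponentials differ by at most |t|
times 1 - |x| ≤ 1 - |x|², and the latter has expectation at most δ. -/
theorem norm_charFun_sub_uniformSphere_le {β : ℝ} {C : ℝ≥0∞} {n : ℕ} (hn : 1 ≤ n)
    [IsProbabilityMeasure (profileLaw (betaProfile β) C n)] {δ : ℝ} (hδ : 0 ≤ δ)
    (h : ∫⁻ x, ENNReal.ofReal (1 - ‖x‖ ^ 2) ∂(profileLaw (betaProfile β) C n) ≤ ENNReal.ofReal δ)
    (t : EuclideanSpace ℝ (Fin n)) :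
    ‖charFun (profileLaw (betaProfile β) C n) t - charFun (uniformSphere n) t‖ ≤ ‖t‖ * δ := by
  set μ := profileLaw (betaProfile β) C n with hμ
  have hnm : Measurable fun x : EuclideanSpace ℝ (Fin n) => ‖x‖⁻¹ • x := by fun_prop
  have hb : ∀ (g : EuclideanSpace ℝ (Fin n) → EuclideanSpace ℝ (Fin n)), Measurable g →
      Integrable (fun x => Complex.exp ((inner ℝ (g x) t : ℝ) * Complex.I)) μ := fun g hg =>
    Integrable.of_bound (C := 1)
      (Measurable.aestronglyMeasurable (by fun_prop))
      (.of_forall fun x => by rw [Complex.norm_exp_ofReal_mul_I])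
  rw [← map_normalize_profileLaw (sliceProfile_beta β).measurable (C := C) hn, charFun_apply,
    charFun_apply, integral_map hnm.aemeasurable
      (Measurable.aestronglyMeasurable (by fun_prop)), ← hμ,
    ← integral_sub (hb (fun x => x) measurable_id) (hb _ hnm)]
  have hae := ae_norm_le_one_betaProfile β C n
  rw [← hμ] at hae
  have hpt : ∀ x : EuclideanSpace ℝ (Fin n), ‖x‖ ≤ 1 →
      ‖Complex.exp ((inner ℝ x t : ℝ) * Complex.I) -
        Complex.exp ((inner ℝ (‖x‖⁻¹ • x) t : ℝ) * Complex.I)‖ ≤ ‖t‖ * (1 - ‖x‖ ^ 2) :=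
    fun x hx => by
    refine (norm_cexp_mul_I_sub_le _ _).trans ?_
    rw [← inner_sub_left]
    refine (abs_real_inner_le_norm _ _).trans ?_
    rw [mul_comm]
    exact mul_le_mul_of_nonneg_left (norm_sub_normalize_le hx) (norm_nonneg t)
  rw [← ENNReal.ofReal_le_ofReal_iff (by positivity), ofReal_norm]
  refine (enorm_integral_le_lintegral_enorm _).trans ?_
  rw [ENNReal.ofReal_mul (norm_nonneg t)]
  refine le_trans ?_ (mul_le_mul_right h _)
  rw [← lintegral_const_mul _ (by fun_prop)]
  refine lintegral_mono_ae ?_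
  filter_upwards [hae] with x hx
  rw [← ofReal_norm, ← ENNReal.ofReal_mul (norm_nonneg t)]
  exact ENNReal.ofReal_le_ofReal (hpt x hx)

theorem isProbabilityMeasure_uniformSphere {n : ℕ} (hn : 1 ≤ n) :
    IsProbabilityMeasure (uniformSphere n) := by
  obtain ⟨C, hC, -⟩ := exists_isProbabilityMeasure_beta hn one_pos
  rw [← map_normalize_profileLaw (sliceProfile_beta (1 / 2 - 1)).measurable (C := C) hn]
  exact Measure.isProbabilityMeasure_map (by fun_prop)

theorem ae_norm_le_one_uniformSphere (n : ℕ) : ∀ᵐ x ∂(uniformSphere n), ‖x‖ ≤ 1 := by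
  have hS : MeasurableSet {x : EuclideanSpace ℝ (Fin n) | ¬ ‖x‖ ≤ 1} :=
    (measurableSet_le measurable_norm measurable_const).compl
  rw [ae_iff, uniformSphere, Measure.map_apply measurable_subtype_coe hS]
  convert measure_empty using 2
  · ext u
    simp
  · infer_instance

theorem exists_volFactor_le (n r : ℕ) : ∃ M : ℝ, 0 ≤ M ∧
    ∀ x : Fin (r + 1) → EuclideanSpace ℝ (Fin n), (∀ i, ‖x i‖ ≤ 1) → volFactor x ≤ M := by
  have hK : IsCompact (Set.univ.pi fun _ : Fin (r + 1) =>
      Metric.closedBall (0 : EuclideanSpace ℝ (Fin n)) 1) :=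
    isCompact_univ_pi fun _ => isCompact_closedBall _ _
  obtain ⟨M, hM⟩ := (hK.image continuous_volFactor).bddAbove
  refine ⟨max M 0, le_max_right _ _, fun x hx => (hM ⟨x, fun i _ => ?_, rfl⟩).trans
    (le_max_left _ _)⟩
  simpa using hx i

/-- The simplex factor is continuous but unbounded. Truncating it at its bound M on the product of
closed unit balls changes nothing almost surely and makes it a test function for weak convergence.
-/
theorem tendsto_lintegral_volFactor {n r : ℕ} {μ : ℕ → ProbabilityMeasure (EuclideanSpace ℝ (Fin n))}
    {μ₀ : ProbabilityMeasure (EuclideanSpace ℝ (Fin n))} (h : Tendsto μ atTop (𝓝 μ₀))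
    (hμ : ∀ k, ∀ᵐ x ∂(μ k : Measure (EuclideanSpace ℝ (Fin n))), ‖x‖ ≤ 1)
    (hμ₀ : ∀ᵐ x ∂(μ₀ : Measure (EuclideanSpace ℝ (Fin n))), ‖x‖ ≤ 1) {p : ℝ} (hp : 0 < p) :
    Tendsto (fun k => ∫⁻ x, ENNReal.ofReal (volFactor x) ^ p
      ∂(Measure.pi fun _ : Fin (r + 1) => (μ k : Measure (EuclideanSpace ℝ (Fin n))))) atTop
      (𝓝 (∫⁻ x, ENNReal.ofReal (volFactor x) ^ p
        ∂(Measure.pi fun _ : Fin (r + 1) => (μ₀ : Measure (EuclideanSpace ℝ (Fin n)))))) := by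
  obtain ⟨M, hM0, hM⟩ := exists_volFactor_le n r
  have hpi : Tendsto (fun k => ProbabilityMeasure.pi fun _ : Fin (r + 1) => μ k) atTop
      (𝓝 (ProbabilityMeasure.pi fun _ : Fin (r + 1) => μ₀)) :=
    (ProbabilityMeasure.continuous_pi.tendsto _).comp (tendsto_pi_nhds.2 fun _ => h)
  let F : BoundedContinuousFunction (Fin (r + 1) → EuclideanSpace ℝ (Fin n)) NNReal :=
    BoundedContinuousFunction.mkOfBound
      ⟨fun x => Real.toNNReal (min (volFactor x) M) ^ p, by
        refine (NNReal.continuous_rpow_const hp.le).comp ?_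
        exact continuous_real_toNNReal.comp (continuous_volFactor.min continuous_const)⟩
      ((Real.toNNReal M ^ p : NNReal) : ℝ) fun x y => by
        have hle : ∀ z : Fin (r + 1) → EuclideanSpace ℝ (Fin n),
            Real.toNNReal (min (volFactor z) M) ^ p ≤ Real.toNNReal M ^ p := fun z =>
          NNReal.rpow_le_rpow (Real.toNNReal_le_toNNReal (min_le_right _ _)) hp.le
        rw [NNReal.dist_eq]
        exact abs_sub_le_of_nonneg_of_le (NNReal.coe_nonneg _) (NNReal.coe_le_coe.2 (hle x))
          (NNReal.coe_nonneg _) (NNReal.coe_le_coe.2 (hle y))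
  have hF := (ProbabilityMeasure.tendsto_iff_forall_lintegral_tendsto.1 hpi) F
  have key : ∀ ν : ProbabilityMeasure (EuclideanSpace ℝ (Fin n)),
      (∀ᵐ x ∂(ν : Measure (EuclideanSpace ℝ (Fin n))), ‖x‖ ≤ 1) →
      ∫⁻ x, F x ∂((ProbabilityMeasure.pi fun _ : Fin (r + 1) => ν :
        ProbabilityMeasure (Fin (r + 1) → EuclideanSpace ℝ (Fin n))) : Measure _) =
      ∫⁻ x, ENNReal.ofReal (volFactor x) ^ p
        ∂(Measure.pi fun _ : Fin (r + 1) => (ν : Measure (EuclideanSpace ℝ (Fin n)))) :=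
    fun ν hν => by
    rw [ProbabilityMeasure.toMeasure_pi]
    refine lintegral_congr_ae ?_
    have hall : ∀ᵐ x ∂(Measure.pi fun _ : Fin (r + 1) =>
        (ν : Measure (EuclideanSpace ℝ (Fin n)))), ∀ i, ‖x i‖ ≤ 1 :=
      ae_all_iff.2 fun i => (Measure.quasiMeasurePreserving_eval (fun _ : Fin (r + 1) =>
        (ν : Measure (EuclideanSpace ℝ (Fin n)))) i).ae hν
    filter_upwards [hall] with x hx
    change ((Real.toNNReal (min (volFactor x) M) ^ p : NNReal) : ℝ≥0∞) = _
    rw [min_eq_left (hM x hx), ENNReal.coe_rpow_of_nonneg _ hp.le]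
    rfl
  simp only [key _ (hμ _), key _ hμ₀] at hF
  exact hF

theorem lintegral_volFactor_uniformSphere (r d : ℕ) (hrd : 2 ≤ r + d) {p : ℝ} (hp : 0 < p) :
    ∫⁻ x, ENNReal.ofReal (volFactor x) ^ p
      ∂(Measure.pi fun _ : Fin (r + 1) => uniformSphere (r + d)) =
      ENNReal.ofReal (betaMoment r d 0 p / betaMoment r d 0 0) := by
  have hn : 1 ≤ r + d := by omega
  have hν : ∀ k : ℕ, (0 : ℝ) < 1 / ((k : ℝ) + 1) := fun k => by positivity
  choose C hC1 hC2 using fun k => exists_isProbabilityMeasure_beta hn (hν k)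
  have := isProbabilityMeasure_uniformSphere hn
  let μ : ℕ → ProbabilityMeasure (EuclideanSpace ℝ (Fin (r + d))) := fun k => ⟨_, hC1 k⟩
  let μ₀ : ProbabilityMeasure (EuclideanSpace ℝ (Fin (r + d))) := ⟨uniformSphere (r + d), this⟩
  have hlim : Tendsto μ atTop (𝓝 μ₀) := by
    refine ProbabilityMeasure.tendsto_iff_tendsto_charFun.2 fun t => ?_
    rw [tendsto_iff_norm_sub_tendsto_zero]
    refine squeeze_zero (fun _ => norm_nonneg _)
      (fun k => norm_charFun_sub_uniformSphere_le hn (hν k).le (hC2 k) t) ?_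
    simpa using tendsto_one_div_add_atTop_nhds_zero_nat.const_mul ‖t‖
  have h1 := tendsto_lintegral_volFactor (r := r) hlim
    (fun k => ae_norm_le_one_betaProfile _ _ _) (ae_norm_le_one_uniformSphere _) hp
  refine tendsto_nhds_unique h1 ?_
  obtain ⟨ha, hA⟩ := vertexParam_pos (ν := 0) r d (Or.inr ⟨le_rfl, hrd⟩)
  have hcont : ∀ q : ℝ, 0 ≤ q → Tendsto (fun k : ℕ => betaMoment r d (1 / ((k : ℝ) + 1)) q) atTop
      (𝓝 (betaMoment r d 0 q)) := fun q hq => by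
    refine Tendsto.comp (g := fun z : ℝ × ℝ => betaMoment r d z.1 z.2)
      (f := fun k : ℕ => (1 / ((k : ℝ) + 1), q))
      (continuousAt_betaMoment r d hq ha hA) ?_
    exact tendsto_one_div_add_atTop_nhds_zero_nat.prodMk_nhds tendsto_const_nhds
  refine ((ENNReal.continuous_ofReal.tendsto _).comp ((hcont p hp.le).div (hcont 0 le_rfl)
    (betaMoment_pos r d le_rfl ha hA).ne')).congr fun k => ?_
  have := hC1 k
  exact (lintegral_volFactor_beta (hν k) r d hp).symm

/-- The spherical law has no density, so the null-set argument is unavailable. Positivity is instead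
recovered from the moment formula by letting p → 0. -/
theorem ae_volFactor_pos_uniformSphere (r d : ℕ) (hrd : 2 ≤ r + d) :
    ∀ᵐ x ∂(Measure.pi fun _ : Fin (r + 1) => uniformSphere (r + d)), 0 < volFactor x := by
  have := isProbabilityMeasure_uniformSphere (n := r + d) (by omega)
  obtain ⟨ha, hA⟩ := vertexParam_pos (ν := 0) r d (Or.inr ⟨le_rfl, hrd⟩)
  have hW : Measurable (volFactor : (Fin (r + 1) → EuclideanSpace ℝ (Fin (r + d))) → ℝ) :=
    continuous_volFactor.measurable
  have h := measure_pos_eq_of_moment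
    (μ := Measure.pi fun _ : Fin (r + 1) => uniformSphere (r + d)) hW
    (F := fun p => betaMoment r d 0 p / betaMoment r d 0 0)
    ((ContinuousAt.comp (g := fun q : ℝ × ℝ => betaMoment r d q.1 q.2) (f := fun p => (0, p))
      (continuousAt_betaMoment r d le_rfl ha hA) (by fun_prop)).div_const _).continuousWithinAt
    fun p hp => lintegral_volFactor_uniformSphere r d hrd hp
  rw [div_self (betaMoment_pos r d le_rfl ha hA).ne', ENNReal.ofReal_one,
    ← prob_compl_eq_zero_iff (measurableSet_lt measurable_const hW)] at h
  exact h

/-! ### The volume of a simplex as a Gram determinant -/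

theorem volume_cornerSimplex (r : ℕ) {t : ℝ} (ht : 0 ≤ t) :
    volume {v : Fin r → ℝ | (∀ i, 0 ≤ v i) ∧ ∑ i, v i ≤ t} =
      ENNReal.ofReal (t ^ r / (r.factorial : ℝ)) := by
  induction r generalizing t with
  | zero =>
    have : {v : Fin 0 → ℝ | (∀ i, 0 ≤ v i) ∧ ∑ i, v i ≤ t} = Set.univ := by
      ext v; simp [ht]
    rw [this, volume_pi_fin_zero_univ]
    simp
  | succ r ih =>
    have hS : ∀ (k : ℕ) (t : ℝ), MeasurableSet {v : Fin k → ℝ | (∀ i, 0 ≤ v i) ∧ ∑ i, v i ≤ t} :=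
      fun k t => by
        refine IsClosed.measurableSet ?_
        simp only [Set.ofPred_and, Set.ofPred_forall]
        exact (isClosed_iInter fun i => isClosed_le continuous_const (continuous_apply i)).inter
          (isClosed_le (by fun_prop) continuous_const)
    rw [← lintegral_indicator_one (hS _ t), lintegral_fin_cons (measurable_one.indicator (hS _ t))]
    have h1 : ∀ s : ℝ, ∫⁻ x : Fin r → ℝ, {v : Fin (r + 1) → ℝ | (∀ i, 0 ≤ v i) ∧
        ∑ i, v i ≤ t}.indicator (1 : (Fin (r + 1) → ℝ) → ℝ≥0∞) (Fin.cons s x : Fin (r + 1) → ℝ) =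
        (Set.Icc 0 t).indicator (fun s => ENNReal.ofReal ((t - s) ^ r / (r.factorial : ℝ))) s := by
      intro s
      by_cases hs : s ∈ Set.Icc 0 t
      · rw [Set.indicator_of_mem hs, ← ih (sub_nonneg.2 hs.2), ← lintegral_indicator_one (hS _ _)]
        refine lintegral_congr fun x => ?_
        simp only [Set.indicator, Set.mem_ofPred_eq, Fin.forall_fin_succ, Fin.cons_zero,
          Fin.cons_succ, Fin.sum_univ_succ, hs.1, true_and, le_sub_iff_add_le']
        rfl
      · rw [Set.indicator_of_notMem hs]
        refine (lintegral_congr fun x => ?_).trans lintegral_zero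
        refine Set.indicator_of_notMem (fun h => hs ?_) _
        simp only [Set.mem_ofPred_eq, Fin.forall_fin_succ, Fin.cons_zero,
          Fin.cons_succ, Fin.sum_univ_succ] at h
        exact ⟨h.1.1, by linarith [Finset.sum_nonneg fun i (_ : i ∈ Finset.univ) => h.1.2 i]⟩
    simp only [h1]
    rw [lintegral_indicator measurableSet_Icc, ← ofReal_integral_eq_lintegral_ofReal]
    · rw [integral_Icc_eq_integral_Ioc, ← intervalIntegral.integral_of_le ht,
        intervalIntegral.integral_div,
        intervalIntegral.integral_comp_sub_left (fun s => s ^ r), integral_pow]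
      congr 1
      rw [Nat.factorial_succ]
      push_cast
      field_simp
      simp
    · exact (Continuous.integrableOn_Icc (by fun_prop))
    · filter_upwards [ae_restrict_mem measurableSet_Icc] with s hs
      have := sub_nonneg.2 hs.2
      positivity

/-- The simplex is a translate of the image of the corner simplex, of volume 1/r!, under the linear
map sending basis vectors to edges; the squared volume distortion of that map is the Gram
determinant. -/
theorem factorial_mul_simplexVolume {n r : ℕ} (x : Fin (r + 1) → EuclideanSpace ℝ (Fin n)) :
    (r.factorial : ℝ) * simplexVolume x = volFactor x := by
  let f : EuclideanSpace ℝ (Fin r) →ₗ[ℝ] EuclideanSpace ℝ (Fin n) :=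
    (Fintype.linearCombination ℝ fun i : Fin r => x i.succ - x 0) ∘ₗ
      (WithLp.linearEquiv 2 ℝ (Fin r → ℝ)).toLinearMap
  have hf : ∀ v, f v = ∑ i, v i • (x i.succ - x 0) := fun v => by
    simp [f, Fintype.linearCombination_apply]
  let S : Set (EuclideanSpace ℝ (Fin r)) := {v | (∀ i, 0 ≤ v i) ∧ ∑ i, v i ≤ 1}
  have hS : MeasurableSet {v : Fin r → ℝ | (∀ i, 0 ≤ v i) ∧ ∑ i, v i ≤ 1} := by
    refine IsClosed.measurableSet ?_
    simp only [Set.ofPred_and, Set.ofPred_forall]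
    exact (isClosed_iInter fun i => isClosed_le continuous_const (continuous_apply i)).inter
      (isClosed_le (by fun_prop) continuous_const)
  have hvol : volume S = ENNReal.ofReal (1 / (r.factorial : ℝ)) := by
    rw [← one_pow r, ← volume_cornerSimplex r zero_le_one,
      ← (PiLp.volume_preserving_ofLp (Fin r)).measure_preimage hS.nullMeasurableSet]
    rfl
  have hset : convexHull ℝ (Set.range x) = (fun y => x 0 + y) '' (f '' S) := by
    have h1 : convexHull ℝ (Set.range x) =
        Fintype.linearCombination ℝ x '' stdSimplex ℝ (Fin (r + 1)) := by
      rw [← convexHull_rangle_single_eq_stdSimplex, LinearMap.image_convexHull, ← Set.range_comp]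
      congr 2
      ext i : 1
      simp [Fintype.linearCombination_apply, Pi.single_apply]
    rw [h1]
    ext y
    simp only [Set.mem_image, exists_exists_and_eq_and, S, Set.mem_ofPred_eq]
    constructor
    · rintro ⟨w, hw, rfl⟩
      refine ⟨WithLp.toLp 2 fun i => w i.succ, ⟨fun i => hw.1 _, ?_⟩, ?_⟩
      · have := hw.2
        rw [Fin.sum_univ_succ] at this
        have h0 := hw.1 0
        simp only
        linarith
      · have := hw.2
        rw [Fin.sum_univ_succ] at this
        rw [hf, Fintype.linearCombination_apply, Fin.sum_univ_succ]
        simp only [smul_sub, Finset.sum_sub_distrib, ← Finset.sum_smul]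
        rw [show w 0 = 1 - ∑ i : Fin r, w i.succ by linarith, sub_smul, one_smul]
        abel
    · rintro ⟨v, ⟨hv0, hv1⟩, rfl⟩
      refine ⟨Fin.cons (1 - ∑ i, v i) fun i => v i, ⟨?_, ?_⟩, ?_⟩
      · intro i
        refine Fin.cases ?_ (fun i => ?_) i
        · simpa using hv1
        · simpa using hv0 i
      · simp [Fin.sum_univ_succ]
      · rw [hf, Fintype.linearCombination_apply, Fin.sum_univ_succ]
        simp only [smul_sub, Finset.sum_sub_distrib, ← Finset.sum_smul, Fin.cons_zero,
          Fin.cons_succ, sub_smul, one_smul]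
        abel
  have hdet : f.normDet = volFactor x := by
    have h1 := f.normDet_sq_eq_det_gram (EuclideanSpace.basisFun (Fin r) ℝ)
    have h2 : f.normDet ^ 2 = simplexGram (gramArray fun i => (x i).ofLp) := by
      rw [simplexGram_gramArray]
      refine (by simpa using h1 : f.normDet ^ 2 = _).trans ?_
      congr 1
      ext i j
      simp only [Matrix.gram_apply, hf, edgeMatrix, Matrix.mul_apply, Matrix.transpose_apply,
        Matrix.of_apply]
      simp [PiLp.inner_apply, mul_comm]
    rw [volFactor, ← h2, Real.sqrt_sq f.normDet_nonneg]
  have hH := f.euclideanHausdorffMeasure_image_eq_normDet_mul_volume S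
  rw [finrank_euclideanSpace_fin, hvol] at hH
  have hiso : Isometry fun y : EuclideanSpace ℝ (Fin n) => x 0 + y :=
    (IsometryEquiv.addLeft (x 0)).isometry
  rw [simplexVolume, hset, measureReal_def, hiso.euclideanHausdorffMeasure_image, hH, hdet,
    ENNReal.toReal_mul, ENNReal.toReal_ofReal (volFactor_nonneg x),
    ENNReal.toReal_ofReal (by positivity)]
  field_simp

theorem logVolume_eq {n r : ℕ} (x : Fin (r + 1) → EuclideanSpace ℝ (Fin n)) :
    logVolume x = Real.log (volFactor x) := by
  rw [logVolume, factorial_mul_simplexVolume]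

theorem simplexVolume_pos_iff {n r : ℕ} (x : Fin (r + 1) → EuclideanSpace ℝ (Fin n)) :
    0 < simplexVolume x ↔ 0 < volFactor x := by
  rw [← factorial_mul_simplexVolume, mul_pos_iff_of_pos_left (by positivity)]

/-! ### Characteristic functions from moments -/

theorem AnalyticOnNhd.eqOn_re_pos_of_eq_ofReal {f g : ℂ → ℂ}
    (hf : AnalyticOnNhd ℂ f {z | 0 < z.re}) (hg : AnalyticOnNhd ℂ g {z | 0 < z.re})
    (h : ∀ p : ℝ, 0 < p → f p = g p) : Set.EqOn f g {z | 0 < z.re} := by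
  refine AnalyticOnNhd.eqOn_of_preconnected_of_frequently_eq hf hg
    ((convex_Ioi (0 : ℝ)).linear_preimage Complex.reLm).isPreconnected (z₀ := ((1 : ℝ) : ℂ))
    (by simp) ?_
  have h_real : ∃ᶠ x : ℝ in 𝓝[≠] (1 : ℝ), f x = g x := by
    refine Eventually.frequently ?_
    filter_upwards [nhdsWithin_le_nhds (Ioi_mem_nhds (zero_lt_one (α := ℝ)))] with x hx
    exact h x hx
  rw [frequently_iff_seq_forall] at h_real ⊢
  obtain ⟨xs, hx_tendsto, hx_eq⟩ := h_real
  refine ⟨fun n => xs n, ?_, hx_eq⟩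
  rw [tendsto_nhdsWithin_iff] at hx_tendsto ⊢
  exact ⟨tendsto_ofReal_iff.2 hx_tendsto.1, by simpa using hx_tendsto.2⟩

/-- The complex moment generating function of log W is analytic for Re z > 0 and agrees with G on
the positive axis, hence on the half-plane. Its boundary values follow by dominated convergence,
since |W^z| ≤ 1 + W for 0 < Re z ≤ 1. -/
theorem charFun_log_eq_of_moment {α : Type*} [MeasurableSpace α] {μ : Measure α}
    [IsProbabilityMeasure μ] {W : α → ℝ} (hW : Measurable W) (hpos : ∀ᵐ x ∂μ, 0 < W x)
    {F : ℝ → ℝ} {G : ℂ → ℂ} (hF : ∀ p, 0 < p → 0 ≤ F p)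
    (h : ∀ p : ℝ, 0 < p → ∫⁻ x, ENNReal.ofReal (W x) ^ p ∂μ = ENNReal.ofReal (F p))
    (hG : DifferentiableOn ℂ G {z | 0 < z.re}) (hGF : ∀ p : ℝ, 0 < p → G p = F p) (t : ℝ)
    (hGt : ContinuousAt G (t * Complex.I)) :
    charFun (μ.map fun x => Real.log (W x)) t = G (t * Complex.I) := by
  set Y := fun x => Real.log (W x) with hY
  have hYm : Measurable Y := Real.measurable_log.comp hW
  have hexp : ∀ p : ℝ, 0 < p →
      (fun x => Real.exp (p * Y x)) =ᵐ[μ] fun x => (ENNReal.ofReal (W x) ^ p).toReal := by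
    intro p hp
    filter_upwards [hpos] with x hx
    rw [ENNReal.ofReal_rpow_of_pos hx, ENNReal.toReal_ofReal (by positivity),
      Real.rpow_def_of_pos hx, mul_comm]
  have hWp : ∀ p : ℝ, AEMeasurable (fun x => ENNReal.ofReal (W x) ^ p) μ := fun p =>
    (hW.ennreal_ofReal.pow_const p).aemeasurable
  have hfin : ∀ p : ℝ, 0 < p → ∫⁻ x, ENNReal.ofReal (W x) ^ p ∂μ ≠ ∞ := fun p hp => by
    rw [h p hp]; exact ENNReal.ofReal_ne_top
  have hint : ∀ p : ℝ, 0 < p → Integrable (fun x => Real.exp (p * Y x)) μ := fun p hp =>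
    (integrable_toReal_of_lintegral_ne_top (hWp p) (hfin p hp)).congr (hexp p hp).symm
  have hmgf : ∀ p : ℝ, 0 < p → mgf Y μ p = F p := fun p hp => by
    rw [mgf, integral_congr_ae (hexp p hp), integral_toReal (hWp p)
      (ae_lt_top' (hWp p) (hfin p hp)), h p hp, ENNReal.toReal_ofReal (hF p hp)]
  have hsub : Set.Ioi (0 : ℝ) ⊆ interior (integrableExpSet Y μ) :=
    interior_maximal (fun p hp => hint p hp) isOpen_Ioi
  have heq : Set.EqOn (complexMGF Y μ) G {z | 0 < z.re} := by
    refine AnalyticOnNhd.eqOn_re_pos_of_eq_ofReal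
      (analyticOnNhd_complexMGF.mono fun z hz => hsub hz)
      (hG.analyticOnNhd (isOpen_Ioi.preimage Complex.continuous_re)) fun p hp => ?_
    rw [complexMGF_ofReal, hmgf p hp, hGF p hp]
  rw [← complexMGF_mul_I hYm.aemeasurable]
  have hz : Tendsto (fun k : ℕ => (t * Complex.I + ((1 / ((k : ℝ) + 1) : ℝ) : ℂ))) atTop
      (𝓝 (t * Complex.I)) := by
    have := (Complex.continuous_ofReal.tendsto 0).comp
      (tendsto_one_div_add_atTop_nhds_zero_nat (𝕜 := ℝ))
    simpa using this.const_add ((t : ℂ) * Complex.I)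
  have h1 : Tendsto (fun k : ℕ => complexMGF Y μ (t * Complex.I + ((1 / ((k : ℝ) + 1) : ℝ) : ℂ)))
      atTop (𝓝 (complexMGF Y μ (t * Complex.I))) := by
    refine tendsto_integral_of_dominated_convergence (fun x => 1 + Real.exp (1 * Y x))
      (fun k => Measurable.aestronglyMeasurable (by fun_prop))
      ((integrable_const _).add (hint 1 one_pos)) (fun k => .of_forall fun x => ?_)
      (.of_forall fun x => ?_)
    · have hk : (0 : ℝ) < 1 / ((k : ℝ) + 1) := by positivity
      have hk1 : 1 / ((k : ℝ) + 1) ≤ 1 := by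
        rw [div_le_one (by positivity)]
        have : (0 : ℝ) ≤ k := Nat.cast_nonneg k
        linarith
      rw [Complex.norm_exp]
      have : ((t * Complex.I + ((1 / ((k : ℝ) + 1) : ℝ) : ℂ)) * (Y x : ℂ)).re =
          1 / ((k : ℝ) + 1) * Y x := by
        simp only [Complex.mul_re, Complex.add_re, Complex.ofReal_re, Complex.ofReal_im,
          Complex.I_re, Complex.I_im]
        ring
      rw [this]
      rcases le_total (Y x) 0 with hy | hy
      · have : Real.exp (1 / ((k : ℝ) + 1) * Y x) ≤ 1 :=
          Real.exp_le_one_iff.2 (mul_nonpos_of_nonneg_of_nonpos hk.le hy)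
        linarith [Real.exp_pos (1 * Y x)]
      · have : Real.exp (1 / ((k : ℝ) + 1) * Y x) ≤ Real.exp (1 * Y x) :=
          Real.exp_le_exp.2 (mul_le_mul_of_nonneg_right hk1 hy)
        linarith
    · exact (Complex.continuous_exp.tendsto _).comp (hz.mul_const _)
  refine tendsto_nhds_unique h1 ((hGt.tendsto.comp hz).congr fun k => ?_)
  refine (heq ?_).symm
  have hk : (0 : ℝ) < 1 / ((k : ℝ) + 1) := by positivity
  simp only [Set.mem_ofPred_eq, Complex.add_re, Complex.mul_re, Complex.ofReal_re,
    Complex.ofReal_im, Complex.I_re, Complex.I_im]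
  linarith

/-! ### Continuation of the moment functions to complex arguments. -/

theorem Complex.differentiableAt_Gamma_comp {f : ℂ → ℂ} {z : ℂ} (hf : DifferentiableAt ℂ f z)
    (h : 0 < (f z).re) : DifferentiableAt ℂ (fun w => Complex.Gamma (f w)) z :=
  DifferentiableAt.comp z (g := Complex.Gamma)
    (Complex.differentiableAt_Gamma _ fun m hm => by
      rw [hm] at h
      simp only [Complex.neg_re, Complex.natCast_re] at h
      have : (0 : ℝ) ≤ m := Nat.cast_nonneg m
      linarith) hf

/-- The moment function of Gaussian simplices at complex arguments. -/
noncomputable def gaussMomentC (r d : ℕ) (z : ℂ) : ℂ :=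
  Complex.exp (Real.log (((r : ℝ) + 1) * 2 ^ r) * (z / 2)) *
    ∏ j ∈ Finset.range r, Complex.Gamma (((d + j + 1) / 2 : ℝ) + z / 2)

/-- The moment function of Beta simplices at complex arguments. -/
noncomputable def betaMomentC (r d : ℕ) (ν : ℝ) (z : ℂ) : ℂ :=
  (∏ j ∈ Finset.range r, Complex.Gamma (((d + j + 1) / 2 : ℝ) + z / 2)) /
    Complex.Gamma (((r + d + ν) / 2 : ℝ) + z / 2) ^ (r + 1) *
    (Complex.Gamma (((r + 1) * ((r + d + ν) / 2) - r : ℝ) + (r + 1) * (z / 2)) /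
      Complex.Gamma (((r + 1) * ((r + d + ν) / 2) - r : ℝ) + r * (z / 2)))

theorem gaussMomentC_ofReal (r d : ℕ) (p : ℝ) : gaussMomentC r d p = gaussMoment r d p := by
  have h : (0 : ℝ) < ((r : ℝ) + 1) * 2 ^ r := by positivity
  unfold gaussMomentC gaussMoment
  rw [Real.rpow_def_of_pos h]
  push_cast [← Complex.Gamma_ofReal]
  congr 1
  refine Finset.prod_congr rfl fun j _ => ?_
  ring_nf

theorem betaMomentC_ofReal (r d : ℕ) (ν p : ℝ) : betaMomentC r d ν p = betaMoment r d ν p := by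
  unfold betaMomentC betaMoment
  push_cast [← Complex.Gamma_ofReal]
  congr 2
  refine Finset.prod_congr rfl fun j _ => ?_
  ring_nf

theorem differentiableAt_prod_Gamma (r d : ℕ) {z : ℂ} (hz : 0 ≤ z.re) :
    DifferentiableAt ℂ
      (fun z => ∏ j ∈ Finset.range r, Complex.Gamma (((d + j + 1) / 2 : ℝ) + z / 2)) z := by
  refine DifferentiableAt.fun_finsetProd fun j _ =>
    Complex.differentiableAt_Gamma_comp (by fun_prop) ?_
  have : (z / 2).re = z.re / 2 := by simp
  rw [Complex.add_re, Complex.ofReal_re, this]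
  positivity

theorem differentiableAt_gaussMomentC (r d : ℕ) {z : ℂ} (hz : 0 ≤ z.re) :
    DifferentiableAt ℂ (gaussMomentC r d) z := by
  unfold gaussMomentC
  exact DifferentiableAt.mul (by fun_prop) (differentiableAt_prod_Gamma r d hz)

theorem differentiableAt_betaMomentC (r d : ℕ) {ν : ℝ} {z : ℂ} (hz : 0 ≤ z.re)
    (ha : 0 < r + d + ν) (hA : 0 < (r + 1) * ((r + d + ν) / 2) - r) :
    DifferentiableAt ℂ (betaMomentC r d ν) z := by
  have hz2 : (z / 2).re = z.re / 2 := by simp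
  have h1 : 0 < (((r + d + ν) / 2 : ℝ) + z / 2 : ℂ).re := by
    rw [Complex.add_re, Complex.ofReal_re, hz2]
    positivity
  have h2 : 0 < (((r + 1) * ((r + d + ν) / 2) - r : ℝ) + (r + 1) * (z / 2) : ℂ).re := by
    have : ((r + 1) * (z / 2) : ℂ).re = (r + 1) * (z.re / 2) := by
      simp [Complex.mul_re]
    rw [Complex.add_re, Complex.ofReal_re, this]
    positivity
  have h3 : 0 < (((r + 1) * ((r + d + ν) / 2) - r : ℝ) + r * (z / 2) : ℂ).re := by
    have : (r * (z / 2) : ℂ).re = r * (z.re / 2) := by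
      simp [Complex.mul_re]
    rw [Complex.add_re, Complex.ofReal_re, this]
    positivity
  have d1 := (Complex.differentiableAt_Gamma_comp (z := z)
    (f := fun z => ((r + d + ν) / 2 : ℝ) + z / 2) (by fun_prop) h1).fun_pow (r + 1)
  have d2 := Complex.differentiableAt_Gamma_comp (z := z)
    (f := fun z => ((r + 1) * ((r + d + ν) / 2) - r : ℝ) + (r + 1) * (z / 2)) (by fun_prop) h2
  have d3 := Complex.differentiableAt_Gamma_comp (z := z)
    (f := fun z => ((r + 1) * ((r + d + ν) / 2) - r : ℝ) + r * (z / 2)) (by fun_prop) h3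
  exact ((differentiableAt_prod_Gamma r d hz).fun_div d1
    (pow_ne_zero _ (Complex.Gamma_ne_zero_of_re_pos h1))).fun_mul
    (d2.fun_div d3 (Complex.Gamma_ne_zero_of_re_pos h3))

theorem charFun_log_eq_div {α : Type*} [MeasurableSpace α] {μ : Measure α}
    [IsProbabilityMeasure μ] {W : α → ℝ} (hW : Measurable W) (hpos : ∀ᵐ x ∂μ, 0 < W x)
    {F : ℝ → ℝ} {G : ℂ → ℂ} (hF : ∀ p, 0 ≤ p → 0 < F p)
    (h : ∀ p : ℝ, 0 < p → ∫⁻ x, ENNReal.ofReal (W x) ^ p ∂μ = ENNReal.ofReal (F p / F 0))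
    (hG : ∀ z : ℂ, 0 ≤ z.re → DifferentiableAt ℂ G z) (hGF : ∀ p : ℝ, G p = F p) (t : ℝ) :
    charFun (μ.map fun x => Real.log (W x)) t = G (t * Complex.I) / G 0 := by
  have hF0 := hF 0 le_rfl
  have hG0 : G 0 = F 0 := by simpa using hGF 0
  refine charFun_log_eq_of_moment (G := fun z => G z / G 0) hW hpos
    (fun p hp => (div_pos (hF p hp.le) hF0).le) h
    (fun z hz => ((hG z (le_of_lt hz)).div_const _).differentiableWithinAt) (fun p hp => ?_) t
    ((hG _ (by simp)).div_const _).continuousAt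
  simp only [hGF, hG0]
  push_cast
  rfl

/-! ### The Gamma function on vertical lines -/

/-- The Hurwitz zeta sum `∑ 1 / (a + k) ^ s`. -/
noncomputable def zetaTail (s : ℕ) (a : ℝ) : ℝ := ∑' k : ℕ, 1 / (a + k) ^ s

/-- The third order remainder of `log (1 + i u)`. -/
noncomputable def logRem (u : ℝ) : ℂ :=
  Complex.log (1 + Complex.I * u) - Complex.I * u - (u : ℂ) ^ 2 / 2

/-- The third order remainder of `log Γ (a + i t)`. -/
noncomputable def gammaRem (a t : ℝ) : ℂ := -∑' k : ℕ, logRem (t / (a + k))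

theorem one_add_I_mul_mem_slitPlane (u : ℝ) : 1 + Complex.I * u ∈ Complex.slitPlane := by
  rw [Complex.mem_slitPlane_iff]
  left
  simp

theorem hasDerivAt_logRem (u : ℝ) :
    HasDerivAt logRem (-Complex.I * (u : ℂ) ^ 2 / (1 + Complex.I * u)) u := by
  have h0 : (1 + Complex.I * u : ℂ) ≠ 0 := Complex.slitPlane_ne_zero (one_add_I_mul_mem_slitPlane u)
  have h1 : HasDerivAt (fun x : ℝ => (1 + Complex.I * x : ℂ)) Complex.I u := by
    simpa using ((hasDerivAt_id u).ofReal_comp.const_mul Complex.I).const_add 1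
  have h2 : HasDerivAt (fun x : ℝ => Complex.I * (x : ℂ)) Complex.I u := by
    simpa using (hasDerivAt_id u).ofReal_comp.const_mul Complex.I
  have h3 : HasDerivAt (fun x : ℝ => (x : ℂ) ^ 2 / 2) (u : ℂ) u := by
    have := ((hasDerivAt_id u).ofReal_comp.fun_pow 2).div_const 2
    simpa using this
  refine (((h1.clog_real (one_add_I_mul_mem_slitPlane u)).sub h2).sub h3).congr_deriv ?_
  field_simp
  linear_combination (-(u : ℂ) ) * Complex.I_sq

/-- The derivative has modulus at most u², because |1 + iu| ≥ 1. The two-point form, and not just a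
bound on `logRem u`, is what preserves cancellation between Gamma factors. -/
theorem norm_logRem_sub_le_of_le {u v : ℝ} (h : v ≤ u) :
    ‖logRem u - logRem v‖ ≤ (u ^ 3 - v ^ 3) / 3 := by
  have hd : ∀ x : ℝ, HasDerivAt (fun x => logRem x - logRem v)
      (-Complex.I * (x : ℂ) ^ 2 / (1 + Complex.I * x)) x := fun x => (hasDerivAt_logRem x).sub_const _
  refine image_norm_le_of_norm_deriv_right_le_deriv_boundary (f := fun x => logRem x - logRem v)
    (B := fun x => (x ^ 3 - v ^ 3) / 3) (B' := fun x => x ^ 2) (a := v) (b := u)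
    (fun x _ => (hd x).continuousAt.continuousWithinAt) (fun x _ => (hd x).hasDerivWithinAt)
    (by simp) (fun x => ?_) (fun x _ => ?_) ⟨h, le_rfl⟩
  · have := ((hasDerivAt_pow 3 x).sub_const (v ^ 3)).div_const 3
    refine this.congr_deriv ?_
    push_cast
    ring
  · have h1 : 1 ≤ ‖(1 + Complex.I * x : ℂ)‖ := by
      have := Complex.abs_re_le_norm (1 + Complex.I * x : ℂ)
      simpa using this
    rw [norm_div, norm_mul, norm_neg, Complex.norm_I, one_mul, norm_pow, Complex.norm_real,
      Real.norm_eq_abs, sq_abs]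
    exact div_le_self (sq_nonneg x) h1

theorem norm_logRem_sub_le (u v : ℝ) : ‖logRem u - logRem v‖ ≤ |u ^ 3 - v ^ 3| / 3 := by
  rcases le_total v u with h | h
  · exact (norm_logRem_sub_le_of_le h).trans
      (div_le_div_of_nonneg_right (le_abs_self _) (by norm_num))
  · rw [norm_sub_rev, abs_sub_comm]
    exact (norm_logRem_sub_le_of_le h).trans
      (div_le_div_of_nonneg_right (le_abs_self _) (by norm_num))

theorem norm_logRem_le (u : ℝ) : ‖logRem u‖ ≤ |u| ^ 3 / 3 := by
  have := norm_logRem_sub_le u 0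
  simpa [logRem, abs_pow] using this

theorem one_div_add_le {a : ℝ} (ha : 0 < a) (k : ℕ) :
    1 / (a + k) ≤ max 1 a⁻¹ * (1 / ((k : ℝ) + 1)) := by
  have hk : (0 : ℝ) ≤ k := Nat.cast_nonneg k
  rw [mul_one_div, div_le_div_iff₀ (by positivity) (by positivity), one_mul, mul_add]
  have h1 : a⁻¹ * a = 1 := inv_mul_cancel₀ ha.ne'
  have h2 : a⁻¹ * a ≤ max 1 a⁻¹ * a := mul_le_mul_of_nonneg_right (le_max_right _ _) ha.le
  have h3 : 1 * (k : ℝ) ≤ max 1 a⁻¹ * k := mul_le_mul_of_nonneg_right (le_max_left _ _) hk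
  linarith

theorem summable_zetaTail {a : ℝ} (ha : 0 < a) {s : ℕ} (hs : 2 ≤ s) :
    Summable fun k : ℕ => 1 / (a + k) ^ s := by
  have h1 : Summable fun k : ℕ => 1 / ((k : ℝ) + 1) ^ s := by
    have := (summable_nat_add_iff 1).2 (Real.summable_one_div_nat_pow.2 (by omega : 1 < s))
    simpa using this
  refine Summable.of_nonneg_of_le (fun k => by positivity) (fun k => ?_)
    (h1.mul_left (max 1 a⁻¹ ^ s))
  rw [← one_div_pow, ← one_div_pow, ← mul_pow]
  exact pow_le_pow_left₀ (by positivity) (one_div_add_le ha k) s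

theorem summable_logRem {a : ℝ} (ha : 0 < a) (t : ℝ) :
    Summable fun k : ℕ => logRem (t / (a + k)) := by
  refine Summable.of_norm_bounded ((summable_zetaTail ha (s := 3) (by norm_num)).mul_left
    (|t| ^ 3 / 3)) fun k => (norm_logRem_le _).trans (le_of_eq ?_)
  have hk : 0 < a + k := by positivity
  rw [abs_div, abs_of_pos hk, div_pow]
  field_simp

/-- Comparison with the harmonic sum, where Euler's constant appears. The limit is the digamma value
at a, but only its existence is used. -/
theorem exists_tendsto_log_sub_sum {a : ℝ} (ha : 0 < a) : ∃ c : ℝ,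
    Tendsto (fun n : ℕ => Real.log n - ∑ j ∈ Finset.range (n + 1), 1 / (a + j)) atTop (𝓝 c) := by
  have h1 : Summable fun k : ℕ => 1 / ((k : ℝ) + 1) - 1 / (a + k) := by
    have h2 : Summable fun k : ℕ => 1 / ((k : ℝ) + 1) ^ 2 := by
      have := (summable_nat_add_iff 1).2 (Real.summable_one_div_nat_pow.2 (one_lt_two))
      simpa using this
    refine Summable.of_norm_bounded (h2.mul_left (|a - 1| * max 1 a⁻¹)) fun k => ?_
    have hk : 0 < a + k := by positivity
    have : 1 / ((k : ℝ) + 1) - 1 / (a + k) = (a - 1) * (1 / ((k : ℝ) + 1)) * (1 / (a + k)) := by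
      field_simp
      ring
    rw [this, norm_mul, norm_mul, Real.norm_eq_abs, Real.norm_of_nonneg (by positivity),
      Real.norm_of_nonneg (by positivity)]
    calc |a - 1| * (1 / ((k : ℝ) + 1)) * (1 / (a + k))
        ≤ |a - 1| * (1 / ((k : ℝ) + 1)) * (max 1 a⁻¹ * (1 / ((k : ℝ) + 1))) := by
          gcongr
          exact one_div_add_le ha k
      _ = _ := by rw [← one_div_pow]; ring
  have h3 := (h1.hasSum.tendsto_sum_nat).comp (tendsto_add_atTop_nat 1)
  have h4 := Real.tendsto_harmonic_sub_log
  have h5 : Tendsto (fun n : ℕ => 1 / ((n : ℝ) + 1)) atTop (𝓝 0) :=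
    tendsto_one_div_add_atTop_nhds_zero_nat
  refine ⟨_, ((h3.sub h4).sub h5).congr fun n => ?_⟩
  simp only [Function.comp, Finset.sum_sub_distrib, harmonic, Finset.sum_range_succ]
  push_cast
  simp only [one_div]
  ring

/-- Divide Euler's limit for Γ(a + it) by that for Γ(a). Each factor 1 + it/(a + j) is expanded to
second order with `logRem` as exact remainder; linear terms combine with log n, quadratic ones sum
to ζ(2,a). -/
theorem exists_Gamma_eq_exp {a : ℝ} (ha : 0 < a) : ∃ c : ℝ, ∀ t : ℝ,
    Complex.Gamma (a + t * Complex.I) = Complex.Gamma a *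
      Complex.exp (Complex.I * (c * t : ℝ) - (zetaTail 2 a * t ^ 2 / 2 : ℝ) + gammaRem a t) := by
  obtain ⟨c, hc⟩ := exists_tendsto_log_sub_sum ha
  refine ⟨c, fun t => ?_⟩
  have hGa : Complex.Gamma a ≠ 0 := Complex.Gamma_ne_zero_of_re_pos (by simpa using ha)
  have h1 := (Complex.GammaSeq_tendsto_Gamma (a + t * Complex.I)).div
    (Complex.GammaSeq_tendsto_Gamma a) hGa
  have h2 : Tendsto (fun n : ℕ => Complex.exp (Complex.I *
      (((Real.log n - ∑ j ∈ Finset.range (n + 1), 1 / (a + j)) * t : ℝ) : ℂ) -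
      (((∑ j ∈ Finset.range (n + 1), 1 / (a + j) ^ 2) * t ^ 2 / 2 : ℝ) : ℂ) +
      -∑ j ∈ Finset.range (n + 1), logRem (t / (a + j)))) atTop
      (𝓝 (Complex.exp (Complex.I * (c * t : ℝ) - (zetaTail 2 a * t ^ 2 / 2 : ℝ) +
        gammaRem a t))) := by
    refine (Complex.continuous_exp.tendsto _).comp (Tendsto.add (Tendsto.sub ?_ ?_) ?_)
    · exact ((Complex.continuous_ofReal.tendsto _).comp (hc.mul_const t)).const_mul _
    · refine (Complex.continuous_ofReal.tendsto _).comp (Tendsto.div_const (Tendsto.mul_const _ ?_) _)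
      exact (summable_zetaTail ha le_rfl).hasSum.tendsto_sum_nat.comp (tendsto_add_atTop_nat 1)
    · exact ((summable_logRem ha t).hasSum.tendsto_sum_nat.comp (tendsto_add_atTop_nat 1)).neg
  have h3 := tendsto_nhds_unique h1 (h2.congr' ?_)
  · rw [← h3, mul_div_cancel₀ _ hGa]
  filter_upwards [eventually_ge_atTop 1] with n hn
  have hn0 : (n : ℂ) ≠ 0 := by exact_mod_cast (by omega : n ≠ 0)
  have haj : ∀ j : ℕ, (a + j : ℂ) ≠ 0 := fun j => by
    have : (0 : ℝ) < a + j := by positivity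
    exact_mod_cast this.ne'
  have hexp : ∀ j : ℕ, (a + t * Complex.I + j : ℂ) = (a + j) *
      Complex.exp (Complex.I * (t / (a + j) : ℝ) + ((t / (a + j) : ℝ) : ℂ) ^ 2 / 2 +
        logRem (t / (a + j))) := fun j => by
    have : Complex.I * (t / (a + j) : ℝ) + ((t / (a + j) : ℝ) : ℂ) ^ 2 / 2 + logRem (t / (a + j)) =
        Complex.log (1 + Complex.I * (t / (a + j) : ℝ)) := by
      rw [logRem]; ring
    rw [this, Complex.exp_log (Complex.slitPlane_ne_zero (one_add_I_mul_mem_slitPlane _))]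
    push_cast
    have := haj j
    field_simp
    ring
  have hprod0 : ∏ j ∈ Finset.range (n + 1), (a + j : ℂ) ≠ 0 :=
    Finset.prod_ne_zero_iff.2 fun j _ => haj j
  have hfac : ((n.factorial : ℕ) : ℂ) ≠ 0 := by exact_mod_cast n.factorial_ne_zero
  have hna : (n : ℂ) ^ (a : ℂ) ≠ 0 := by
    rw [Complex.cpow_def_of_ne_zero hn0]; exact Complex.exp_ne_zero _
  simp only [Pi.div_apply, Complex.GammaSeq, hexp, Finset.prod_mul_distrib]
  rw [← Complex.exp_sum, Complex.cpow_add _ _ hn0, Complex.cpow_def_of_ne_zero hn0 (t * Complex.I)]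
  have h4 : (n : ℂ) ^ (a : ℂ) * Complex.exp (Complex.log n * (t * Complex.I)) * (n.factorial : ℂ) /
      ((∏ j ∈ Finset.range (n + 1), (a + j : ℂ)) *
        Complex.exp (∑ j ∈ Finset.range (n + 1), (Complex.I * (t / (a + j) : ℝ) +
          ((t / (a + j) : ℝ) : ℂ) ^ 2 / 2 + logRem (t / (a + j))))) /
      ((n : ℂ) ^ (a : ℂ) * (n.factorial : ℂ) / ∏ j ∈ Finset.range (n + 1), (a + j : ℂ)) =
      Complex.exp (Complex.log n * (t * Complex.I)) / Complex.exp (∑ j ∈ Finset.range (n + 1),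
        (Complex.I * (t / (a + j) : ℝ) + ((t / (a + j) : ℝ) : ℂ) ^ 2 / 2 +
          logRem (t / (a + j)))) := by
    have := Complex.exp_ne_zero (∑ j ∈ Finset.range (n + 1), (Complex.I * (t / (a + j) : ℝ) +
          ((t / (a + j) : ℝ) : ℂ) ^ 2 / 2 + logRem (t / (a + j))))
    field_simp
  rw [h4, ← Complex.exp_sub]
  congr 1
  simp only [Finset.sum_add_distrib, ← Finset.mul_sum]
  rw [← Complex.natCast_log]
  push_cast
  simp only [div_pow, Finset.mul_sum, Finset.sum_mul, Finset.sum_div, sub_mul, mul_sub]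
  have e1 : ∀ j : ℕ, (t : ℂ) ^ 2 / (a + j) ^ 2 / 2 = 1 / (a + j) ^ 2 * t ^ 2 / 2 := fun j => by ring
  have e2 : ∀ j : ℕ, Complex.I * ((t : ℂ) / (a + j)) = Complex.I * (1 / (a + j) * t) := fun j => by
    ring
  simp only [e1, e2]
  ring

theorem norm_gammaRem_sub_le {a b : ℝ} (ha : 0 < a) (hb : 0 < b) (s t : ℝ) {S : ℝ}
    (hS : HasSum (fun k : ℕ => |(s / (a + k)) ^ 3 - (t / (b + k)) ^ 3|) S) :
    ‖gammaRem a s - gammaRem b t‖ ≤ S / 3 := by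
  have h : gammaRem a s - gammaRem b t =
      -∑' k : ℕ, (logRem (s / (a + k)) - logRem (t / (b + k))) := by
    rw [gammaRem, gammaRem, (summable_logRem ha s).tsum_sub (summable_logRem hb t)]
    ring
  rw [h, norm_neg]
  exact tsum_of_norm_bounded (hS.div_const 3) fun k => norm_logRem_sub_le _ _

theorem hasSum_zetaTail {a : ℝ} (ha : 0 < a) {s : ℕ} (hs : 2 ≤ s) :
    HasSum (fun k : ℕ => 1 / (a + k) ^ s) (zetaTail s a) := (summable_zetaTail ha hs).hasSum

theorem norm_gammaRem_sub_le_of_le {a b : ℝ} (hb : 0 < b) (hba : b ≤ a) (t : ℝ) :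
    ‖gammaRem b t - gammaRem a t‖ ≤ (zetaTail 3 b - zetaTail 3 a) / 3 * |t| ^ 3 := by
  have ha := hb.trans_le hba
  have h := (((hasSum_zetaTail hb (s := 3) (by norm_num)).sub
    (hasSum_zetaTail ha (s := 3) (by norm_num))).mul_right (|t| ^ 3))
  have he : (fun k : ℕ => |(t / (b + k)) ^ 3 - (t / (a + k)) ^ 3|) =
      fun k : ℕ => (1 / (b + k) ^ 3 - 1 / (a + k) ^ 3) * |t| ^ 3 := by
    funext k
    have h1 : 0 ≤ 1 / (b + k) ^ 3 - 1 / (a + k) ^ 3 := by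
      rw [sub_nonneg]
      gcongr
    rw [div_pow, div_pow, show t ^ 3 / (b + k) ^ 3 - t ^ 3 / (a + k) ^ 3 =
      (1 / (b + k) ^ 3 - 1 / (a + k) ^ 3) * t ^ 3 by ring, abs_mul, abs_of_nonneg h1, abs_pow]
  exact (norm_gammaRem_sub_le hb ha t t (he ▸ h)).trans (le_of_eq (by ring))

theorem gammaRem_zero (a : ℝ) : gammaRem a 0 = 0 := by
  simp [gammaRem, logRem]

theorem norm_gammaRem_mul_sub_le {a : ℝ} (ha : 0 < a) {x y : ℝ} (hy : 0 ≤ y) (hxy : y ≤ x) (t : ℝ) :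
    ‖gammaRem a (x * t) - gammaRem a (y * t)‖ ≤ (x ^ 3 - y ^ 3) * zetaTail 3 a / 3 * |t| ^ 3 := by
  have h := (hasSum_zetaTail ha (s := 3) (by norm_num)).mul_left ((x ^ 3 - y ^ 3) * |t| ^ 3)
  have he : (fun k : ℕ => |(x * t / (a + k)) ^ 3 - (y * t / (a + k)) ^ 3|) =
      fun k : ℕ => (x ^ 3 - y ^ 3) * |t| ^ 3 * (1 / (a + k) ^ 3) := by
    funext k
    have h1 : 0 ≤ x ^ 3 - y ^ 3 := sub_nonneg.2 (pow_le_pow_left₀ hy hxy 3)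
    have h2 : 0 < a + k := by positivity
    rw [div_pow, div_pow, show (x * t) ^ 3 / (a + k) ^ 3 - (y * t) ^ 3 / (a + k) ^ 3 =
      (x ^ 3 - y ^ 3) * t ^ 3 * (1 / (a + k) ^ 3) by ring, abs_mul, abs_mul, abs_of_nonneg h1,
      abs_pow, abs_of_pos (a := 1 / (a + k) ^ 3) (by positivity)]
  exact (norm_gammaRem_sub_le ha ha _ _ (he ▸ h)).trans (le_of_eq (by ring))

theorem norm_gammaRem_le {a : ℝ} (ha : 0 < a) (t : ℝ) :
    ‖gammaRem a t‖ ≤ zetaTail 3 a / 3 * |t| ^ 3 := by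
  simpa [gammaRem_zero] using norm_gammaRem_mul_sub_le ha le_rfl zero_le_one t

/-! ### Characteristic functions with a cubic logarithmic remainder -/

/-- `φ` is the characteristic function of a normal law with mean `m` and variance `v` up to a
factor whose logarithm is at most `κ |t| ^ 3`. -/
def CubicExp (φ : ℝ → ℂ) (m v κ : ℝ) : Prop := ∃ R : ℝ → ℂ,
  (∀ t : ℝ, φ t = Complex.exp (Complex.I * (m * t : ℝ) - (v * t ^ 2 / 2 : ℝ) + R t)) ∧
    ∀ t : ℝ, ‖R t‖ ≤ κ * |t| ^ 3

theorem CubicExp.comp_mul {φ : ℝ → ℂ} {m v κ : ℝ} (h : CubicExp φ m v κ) (c : ℝ) :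
    CubicExp (fun t => φ (c * t)) (c * m) (c ^ 2 * v) (|c| ^ 3 * κ) := by
  obtain ⟨R, hR, hb⟩ := h
  refine ⟨fun t => R (c * t), fun t => ?_, fun t => (hb _).trans (le_of_eq ?_)⟩
  · simp only [hR]
    congr 3
    · push_cast; ring
    · push_cast; ring
  · rw [abs_mul]; ring

theorem CubicExp.mul_exp {φ : ℝ → ℂ} {m v κ : ℝ} (h : CubicExp φ m v κ) (c : ℝ) :
    CubicExp (fun t => Complex.exp (Complex.I * (c * t : ℝ)) * φ t) (c + m) v κ := by
  obtain ⟨R, hR, hb⟩ := h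
  refine ⟨R, fun t => ?_, hb⟩
  simp only [hR]
  rw [← Complex.exp_add]
  congr 1
  push_cast
  ring

theorem CubicExp.nonneg {φ : ℝ → ℂ} {m v κ : ℝ} (h : CubicExp φ m v κ) : 0 ≤ κ := by
  obtain ⟨R, -, hb⟩ := h
  simpa using (norm_nonneg _).trans (hb 1)

/-- On |t| ≤ 1 the exponent is at most D t² in modulus. The radius 1/D keeps it below 1, where |e^w
- 1 - w| ≤ |w|² applies. -/
theorem CubicExp.exists_bound {φ : ℝ → ℂ} {v κ : ℝ} (h : CubicExp φ 0 v κ) : ∃ C δ : ℝ,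
    0 ≤ C ∧ 0 < δ ∧ δ ≤ 1 ∧ ∀ t : ℝ, |t| ≤ δ → ‖φ t - (1 - v * t ^ 2 / 2)‖ ≤ C * |t| ^ 3 := by
  have hκ := h.nonneg
  obtain ⟨R, hR, hb⟩ := h
  set D : ℝ := |v| / 2 + κ + 1 with hD
  have hD1 : 1 ≤ D := by
    have := abs_nonneg v
    rw [hD]; linarith
  refine ⟨D ^ 2 + κ, 1 / D, by positivity, by positivity, by
    rw [div_le_one (by positivity)]; exact hD1, fun t ht => ?_⟩
  have ht1 : |t| ≤ 1 := ht.trans (by rw [div_le_one (by positivity)]; exact hD1)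
  have ht0 := abs_nonneg t
  set w : ℂ := -(v * t ^ 2 / 2 : ℝ) + R t with hw
  have h3 : |t| ^ 3 ≤ |t| ^ 2 := pow_le_pow_of_le_one ht0 ht1 (by norm_num)
  have hwn : ‖w‖ ≤ D * |t| ^ 2 := by
    refine (norm_add_le _ _).trans ?_
    rw [norm_neg, Complex.norm_real, Real.norm_eq_abs, abs_div, abs_mul, abs_pow, abs_two]
    have := hb t
    have h4 : κ * |t| ^ 3 ≤ κ * |t| ^ 2 := mul_le_mul_of_nonneg_left h3 hκ
    have h5 : 0 ≤ |t| ^ 2 := by positivity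
    rw [hD]
    nlinarith
  have hw1 : ‖w‖ ≤ 1 := by
    refine hwn.trans ?_
    calc D * |t| ^ 2 = (D * |t|) * |t| := by ring
      _ ≤ (D * (1 / D)) * 1 := by gcongr
      _ = 1 := by field_simp
  have hφ : φ t - (1 - v * t ^ 2 / 2) = (Complex.exp w - 1 - w) + R t := by
    rw [hR, hw]
    push_cast
    rw [zero_mul, mul_zero, zero_sub]
    ring
  rw [hφ]
  refine (norm_add_le _ _).trans ?_
  have h6 := Complex.norm_exp_sub_one_sub_id_le hw1
  have h7 : ‖w‖ ^ 2 ≤ D ^ 2 * |t| ^ 3 := by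
    calc ‖w‖ ^ 2 ≤ (D * |t| ^ 2) ^ 2 := pow_le_pow_left₀ (norm_nonneg _) hwn 2
      _ = D ^ 2 * |t| ^ 4 := by ring
      _ ≤ D ^ 2 * |t| ^ 3 := by
        gcongr ?_ * ?_
        exact pow_le_pow_of_le_one ht0 ht1 (by norm_num)
  linarith [hb t]

/-- The functions (2 - 2 cos(ux))/u² are nonnegative and tend to x² as u → 0. Their integrals are
bounded through the real part of the characteristic function, so Fatou's lemma bounds the second
moment. -/
theorem memLp_two_of_charFun_bound {μ : Measure ℝ} [IsProbabilityMeasure μ] {C δ : ℝ}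
    (hδ : 0 < δ) (h : ∀ t : ℝ, |t| ≤ δ → ‖charFun μ t - 1‖ ≤ C * t ^ 2) : MemLp id 2 μ := by
  rw [memLp_two_iff_integrable_sq (by fun_prop)]
  refine ⟨by fun_prop, ?_⟩
  let u : ℕ → ℝ := fun k => δ * (1 / ((k : ℝ) + 1))
  have hu0 : ∀ k, 0 < u k := fun k => by positivity
  have hu1 : ∀ k, |u k| ≤ δ := fun k => by
    rw [abs_of_pos (hu0 k)]
    refine mul_le_of_le_one_right hδ.le ?_
    rw [div_le_one (by positivity)]
    linarith [(Nat.cast_nonneg k : (0 : ℝ) ≤ k)]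
  have hulim : Tendsto u atTop (𝓝 0) := by
    have := (tendsto_one_div_add_atTop_nhds_zero_nat (𝕜 := ℝ)).const_mul δ
    rwa [mul_zero] at this
  let f : ℕ → ℝ → ℝ := fun k x => (2 - 2 * Real.cos (u k * x)) / u k ^ 2
  have hf0 : ∀ k x, 0 ≤ f k x := fun k x =>
    div_nonneg (by linarith [Real.cos_le_one (u k * x)]) (sq_nonneg _)
  have hcos : ∀ k, Integrable (fun x => Real.cos (u k * x)) μ := fun k =>
    Integrable.of_bound (C := 1) (by fun_prop) (.of_forall fun x => Real.abs_cos_le_one _)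
  have hfi : ∀ k, Integrable (f k) μ := fun k =>
    ((integrable_const _).sub ((hcos k).const_mul 2)).div_const _
  have hre : ∀ t : ℝ, (charFun μ t).re = ∫ x, Real.cos (t * x) ∂μ := fun t => by
    rw [charFun_apply_real]
    have hint : Integrable (fun x : ℝ => Complex.exp (t * x * Complex.I)) μ :=
      Integrable.of_bound (C := 1) (by fun_prop) (.of_forall fun x => by
        rw [← Complex.ofReal_mul, Complex.norm_exp_ofReal_mul_I])
    have := integral_re hint
    simp only [RCLike.re_eq_complex_re] at this
    rw [← this]
    refine integral_congr_ae (.of_forall fun x => ?_)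
    simp only
    rw [← Complex.ofReal_mul, Complex.exp_ofReal_mul_I_re]
  have hfint : ∀ k, ∫ x, f k x ∂μ ≤ 2 * C := fun k => by
    have h1 := h (u k) (hu1 k)
    have h2 := (Complex.abs_re_le_norm (charFun μ (u k) - 1)).trans h1
    rw [Complex.sub_re, hre, Complex.one_re, abs_le] at h2
    simp only [f]
    rw [integral_div, integral_sub (integrable_const _) ((hcos k).const_mul 2), integral_const_mul,
      div_le_iff₀ (pow_pos (hu0 k) 2)]
    simp only [integral_const, probReal_univ, smul_eq_mul, one_mul]
    linarith [h2.1]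
  have hlim : ∀ x, Tendsto (fun k => f k x) atTop (𝓝 (x ^ 2)) := fun x => by
    have hsinc : ∀ k, f k x = x ^ 2 * Real.sinc (u k * x / 2) ^ 2 := fun k => by
      rcases eq_or_ne x 0 with rfl | hx
      · simp [f]
      · have hne : u k * x / 2 ≠ 0 := by
          have := (hu0 k).ne'
          positivity
        have h1 : Real.cos (u k * x) = 1 - 2 * Real.sin (u k * x / 2) ^ 2 := by
          have := Real.cos_two_mul (u k * x / 2)
          have h2 := Real.sin_sq_add_cos_sq (u k * x / 2)
          rw [show 2 * (u k * x / 2) = u k * x by ring] at this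
          linarith
        have h3 := (hu0 k).ne'
        simp only [f]
        rw [Real.sinc_of_ne_zero hne, h1]
        field_simp
        ring
    simp only [hsinc]
    have : Tendsto (fun k => Real.sinc (u k * x / 2)) atTop (𝓝 1) := by
      rw [← Real.sinc_zero]
      refine (Real.continuous_sinc.tendsto 0).comp ?_
      simpa using (hulim.mul_const x).div_const 2
    simpa using (this.pow 2).const_mul (x ^ 2)
  have hfatou : ∫⁻ x, ENNReal.ofReal (x ^ 2) ∂μ ≤ ENNReal.ofReal (2 * C) := by
    calc ∫⁻ x, ENNReal.ofReal (x ^ 2) ∂μ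
        = ∫⁻ x, liminf (fun k => ENNReal.ofReal (f k x)) atTop ∂μ := by
          refine lintegral_congr fun x => ?_
          exact ((ENNReal.continuous_ofReal.tendsto _).comp (hlim x)).liminf_eq.symm
      _ ≤ liminf (fun k => ∫⁻ x, ENNReal.ofReal (f k x) ∂μ) atTop :=
          lintegral_liminf_le fun k => by fun_prop
      _ ≤ liminf (fun _ : ℕ => ENNReal.ofReal (2 * C)) atTop := by
          refine liminf_le_liminf (.of_forall fun k => ?_)
          rw [← ofReal_integral_eq_lintegral_ofReal (hfi k) (.of_forall (hf0 k))]
          exact ENNReal.ofReal_le_ofReal (hfint k)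
      _ = _ := liminf_const _
  refine (lintegral_congr fun x => ?_).trans_lt (hfatou.trans_lt ENNReal.ofReal_lt_top)
  simp only [id]
  rw [Real.enorm_eq_ofReal (sq_nonneg x)]

theorem eq_zero_of_isLittleO_const_mul_pow {c : ℝ} {k : ℕ}
    (h : (fun t : ℝ => c * t ^ k) =o[𝓝 0] fun t => t ^ k) : c = 0 := by
  by_contra hc
  have h1 := (Asymptotics.isLittleO_const_mul_left_iff hc).1 h
  refine Asymptotics.isLittleO_irrefl ?_ h1
  have : ∃ᶠ t : ℝ in 𝓝 0, t ≠ 0 := by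
    have : ∃ᶠ t : ℝ in 𝓝[≠] 0, t ≠ 0 := Eventually.frequently self_mem_nhdsWithin
    exact this.filter_mono nhdsWithin_le_nhds
  exact this.mono fun t ht => pow_ne_zero _ ht

/-- Once the second moment is finite, the characteristic function has a Taylor expansion with the
true moments. Comparing it with the cubic bound, the imaginary part gives the mean and the real part
the second moment. -/
theorem CubicExp.moments_of_centered {μ : Measure ℝ} [IsProbabilityMeasure μ] {v κ : ℝ}
    (h : CubicExp (charFun μ) 0 v κ) :
    MemLp id 2 μ ∧ ∫ x, x ∂μ = 0 ∧ ∫ x, x ^ 2 ∂μ = v := by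
  obtain ⟨C, δ, hC, hδ, hδ1, hb⟩ := h.exists_bound
  have hL2 : MemLp id 2 μ := by
    refine memLp_two_of_charFun_bound (C := C + |v| / 2) hδ fun t ht => ?_
    have h1 : charFun μ t - 1 = (charFun μ t - (1 - v * t ^ 2 / 2)) - (v * t ^ 2 / 2 : ℝ) := by
      push_cast; ring
    rw [h1]
    refine (norm_sub_le _ _).trans ?_
    have h2 : |t| ^ 3 ≤ |t| ^ 2 :=
      pow_le_pow_of_le_one (abs_nonneg t) (ht.trans hδ1) (by norm_num)
    have h3 := hb t ht
    rw [Complex.norm_real, Real.norm_eq_abs, abs_div, abs_mul, abs_pow, abs_two, ← sq_abs t]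
    nlinarith [mul_le_mul_of_nonneg_left h2 hC]
  have hT := taylorWithinEval_charFun_two_zero (P := μ) (X := id) aemeasurable_id
    (by simpa using hL2)
  simp only [Measure.map_id] at hT
  have h1 : (fun t : ℝ => charFun μ t - (1 + (∫ x, id x ∂μ : ℝ) * t * Complex.I -
      (∫ x, (id ^ 2 : ℝ → ℝ) x ∂μ : ℝ) * t ^ 2 / 2)) =o[𝓝 0] fun t : ℝ => t ^ 2 := by
    simp_rw [← hT]
    convert! taylor_isLittleO_univ (n := 2) (x₀ := (0 : ℝ)) (f := charFun μ)
      (contDiff_charFun hL2) using 1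
    simp
  have h2 : (fun t : ℝ => charFun μ t - (1 - v * t ^ 2 / 2)) =o[𝓝 0] fun t : ℝ => t ^ 2 := by
    have hO : (fun t : ℝ => charFun μ t - (1 - v * t ^ 2 / 2)) =O[𝓝 0] fun t : ℝ => t ^ 3 := by
      refine Asymptotics.IsBigO.of_bound C ?_
      filter_upwards [Metric.closedBall_mem_nhds (0 : ℝ) hδ] with t ht
      rw [Real.norm_eq_abs, abs_pow]
      exact hb t (by simpa using ht)
    exact hO.trans_isLittleO (Asymptotics.isLittleO_pow_pow (by norm_num))
  have h3 := h2.sub h1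
  simp only [id, Pi.pow_apply] at h3
  set e1 := ∫ x, x ∂μ with he1
  set e2 := ∫ x, x ^ 2 ∂μ with he2
  have hX : ∀ t : ℝ, charFun μ t - (1 - v * t ^ 2 / 2) -
      (charFun μ t - (1 + e1 * t * Complex.I - e2 * t ^ 2 / 2)) =
      (((v - e2) / 2 * t ^ 2 : ℝ) : ℂ) + ((e1 * t ^ 1 : ℝ) : ℂ) * Complex.I := fun t => by
    push_cast; ring
  simp only [hX] at h3
  have him : (fun t : ℝ => e1 * t ^ 1) =o[𝓝 0] fun t : ℝ => t ^ 2 := by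
    refine Asymptotics.IsLittleO.of_norm_left (Asymptotics.IsBigO.trans_isLittleO ?_ h3.norm_left)
    refine Asymptotics.IsBigO.of_bound 1 (.of_forall fun t => ?_)
    rw [one_mul, norm_norm, norm_norm]
    refine le_trans (le_of_eq ?_) (Complex.abs_im_le_norm _)
    rw [Real.norm_eq_abs, Complex.add_im, Complex.ofReal_im, Complex.im_ofReal_mul, Complex.I_im,
      zero_add, mul_one]
  have hre : (fun t : ℝ => (v - e2) / 2 * t ^ 2) =o[𝓝 0] fun t : ℝ => t ^ 2 := by
    refine Asymptotics.IsLittleO.of_norm_left (Asymptotics.IsBigO.trans_isLittleO ?_ h3.norm_left)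
    refine Asymptotics.IsBigO.of_bound 1 (.of_forall fun t => ?_)
    rw [one_mul, norm_norm, norm_norm]
    refine le_trans (le_of_eq ?_) (Complex.abs_re_le_norm _)
    rw [Real.norm_eq_abs, Complex.add_re, Complex.ofReal_re, Complex.re_ofReal_mul, Complex.I_re,
      mul_zero, add_zero]
  have hz1 := eq_zero_of_isLittleO_const_mul_pow
    (him.trans_isBigO (Asymptotics.isLittleO_pow_pow (by norm_num)).isBigO)
  have hz2 := eq_zero_of_isLittleO_const_mul_pow hre
  exact ⟨hL2, hz1, by linarith⟩

theorem charFun_map_sub_const {Ω : Type*} [MeasurableSpace Ω] {P : Measure Ω}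
    {X : Ω → ℝ} (hX : AEMeasurable X P) (m t : ℝ) :
    charFun (P.map fun ω => X ω - m) t =
      Complex.exp (Complex.I * (-m * t : ℝ)) * charFun (P.map X) t := by
  rw [charFun_apply_real, charFun_apply_real, integral_map (by fun_prop) (by fun_prop),
    integral_map hX (by fun_prop), ← integral_const_mul]
  refine integral_congr_ae (.of_forall fun ω => ?_)
  simp only
  rw [← Complex.exp_add]
  congr 1
  push_cast
  ring

theorem CubicExp.moments {Ω : Type*} [MeasurableSpace Ω] {P : Measure Ω} [IsProbabilityMeasure P]
    {X : Ω → ℝ} (hX : AEMeasurable X P) {m v κ : ℝ} (h : CubicExp (charFun (P.map X)) m v κ) :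
    MemLp X 2 P ∧ ∫ ω, X ω ∂P = m ∧ variance X P = v := by
  have hXm : AEMeasurable (fun ω => X ω - m) P := by fun_prop
  have := Measure.isProbabilityMeasure_map hXm
  have hc : CubicExp (charFun (P.map fun ω => X ω - m)) 0 v κ := by
    have := h.mul_exp (-m)
    rw [neg_add_cancel] at this
    convert this using 1
    exact funext fun t => charFun_map_sub_const hX m t
  obtain ⟨h1, h2, h3⟩ := hc.moments_of_centered
  have hL2 : MemLp (fun ω => X ω - m) 2 P := by
    have := (memLp_map_measure_iff (by fun_prop) hXm).1 h1
    exact this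
  rw [integral_map hXm (by fun_prop)] at h2 h3
  have hXL2 : MemLp X 2 P := by
    have := hL2.add (memLp_const m)
    refine this.congr_norm hX.aestronglyMeasurable (.of_forall fun ω => ?_)
    simp
  have hXi : Integrable X P := hXL2.integrable one_le_two
  have hm : ∫ ω, X ω ∂P = m := by
    rw [integral_sub hXi (integrable_const _)] at h2
    simp at h2
    linarith
  exact ⟨hXL2, hm, by rw [variance_eq_integral hX, hm, h3]⟩

/-- Standardising turns the quadratic term into t²/2 exactly and divides κ by v^{3/2}; smallness of
the remaining exponent allows |e^w - 1| ≤ 2|w|. -/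
theorem CubicExp.norm_charFun_standardize_sub_le {Ω : Type*} [MeasurableSpace Ω] {P : Measure Ω}
    {X : Ω → ℝ} (hX : AEMeasurable X P) {m v κ : ℝ} (h : CubicExp (charFun (P.map X)) m v κ)
    (hv : 0 < v) (t : ℝ) (ht : κ / √v ^ 3 * |t| ^ 3 ≤ 1) :
    ‖charFun (P.map fun ω => (X ω - m) / √v) t - Complex.exp (-(t : ℂ) ^ 2 / 2)‖ ≤
      2 * (κ / √v ^ 3 * |t| ^ 3) := by
  obtain ⟨R, hR, hb⟩ := h
  have hs : 0 < √v := Real.sqrt_pos.2 hv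
  have h1 : charFun (P.map fun ω => (X ω - m) / √v) t =
      charFun (P.map fun ω => X ω - m) (t / √v) := by
    rw [charFun_apply_real, charFun_apply_real, integral_map (by fun_prop) (by fun_prop),
      integral_map (by fun_prop) (by fun_prop)]
    refine integral_congr_ae (.of_forall fun ω => ?_)
    simp only
    congr 1
    push_cast
    ring
  have h2 : charFun (P.map fun ω => (X ω - m) / √v) t =
      Complex.exp (-(t : ℂ) ^ 2 / 2) * Complex.exp (R (t / √v)) := by
    rw [h1, charFun_map_sub_const hX, hR, ← Complex.exp_add, ← Complex.exp_add]
    congr 1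
    have h3 : v * (t / √v) ^ 2 = t ^ 2 := by
      rw [div_pow, Real.sq_sqrt hv.le]
      field_simp
    rw [h3]
    push_cast
    ring
  have h4 : ‖R (t / √v)‖ ≤ κ / √v ^ 3 * |t| ^ 3 := by
    refine (hb _).trans (le_of_eq ?_)
    rw [abs_div, abs_of_pos hs, div_pow]
    ring
  have h5 : ‖Complex.exp (-(t : ℂ) ^ 2 / 2)‖ ≤ 1 := by
    rw [Complex.norm_exp]
    have : (-(t : ℂ) ^ 2 / 2).re = -t ^ 2 / 2 := by
      rw [show (-(t : ℂ) ^ 2 / 2) = ((-t ^ 2 / 2 : ℝ) : ℂ) by push_cast; rfl, Complex.ofReal_re]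
    rw [this, Real.exp_le_one_iff]
    nlinarith [sq_nonneg t]
  rw [h2, ← mul_sub_one, norm_mul]
  have h6 := Complex.norm_exp_sub_one_le (h4.trans ht)
  calc _ ≤ 1 * (2 * ‖R (t / √v)‖) := by gcongr
    _ ≤ _ := by linarith

/-- A central limit theorem: if the remainders are negligible compared with the variances, the
standardised variables are asymptotically normal. -/
theorem tendstoInDistribution_of_cubicExp {Ω : ℕ → Type*} [∀ n, MeasurableSpace (Ω n)]
    {P : (n : ℕ) → Measure (Ω n)} [∀ n, IsProbabilityMeasure (P n)] {X : (n : ℕ) → Ω n → ℝ}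
    (hX : ∀ n, AEMeasurable (X n) (P n)) {m v κ : ℕ → ℝ}
    (h : ∀ᶠ n in atTop, CubicExp (charFun ((P n).map (X n))) (m n) (v n) (κ n) ∧ 0 < v n)
    (hlim : Tendsto (fun n => κ n / √(v n) ^ 3) atTop (𝓝 0)) :
    TendstoInDistribution
      (fun n ω => (X n ω - ∫ ω', X n ω' ∂(P n)) / √(variance (X n) (P n)))
      atTop (id : ℝ → ℝ) P (gaussianReal 0 1) where
  forall_aemeasurable n := by
    have := hX n
    fun_prop
  tendsto := by
    refine ProbabilityMeasure.tendsto_iff_tendsto_charFun.2 fun t => ?_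
    simp only [ProbabilityMeasure.coe_mk, Measure.map_id, charFun_gaussianReal]
    rw [tendsto_iff_norm_sub_tendsto_zero]
    have hlim2 := hlim.mul_const (|t| ^ 3)
    rw [zero_mul] at hlim2
    have hlim3 := hlim2.const_mul 2
    rw [mul_zero] at hlim3
    refine squeeze_zero' (.of_forall fun _ => norm_nonneg _) ?_ hlim3
    filter_upwards [h, hlim2.eventually (ge_mem_nhds zero_lt_one)] with n hn ht
    obtain ⟨-, h2, h3⟩ := hn.1.moments (hX n)
    rw [h2, h3]
    convert hn.1.norm_charFun_standardize_sub_le (hX n) hn.2 t ht using 3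
    congr 1
    simp
    ring_nf

/-! ### The log-volume has a nearly Gaussian characteristic function -/

/-- The variance of twice the log-volume of Gaussian simplices. -/
noncomputable def gaussVar (r d : ℕ) : ℝ :=
  ∑ j ∈ Finset.range r, zetaTail 2 ((d + j + 1) / 2)

/-- A bound for the logarithmic remainder in the Gaussian model. -/
noncomputable def gaussRemBound (r d : ℕ) : ℝ :=
  ∑ j ∈ Finset.range r, zetaTail 3 ((d + j + 1) / 2) / 3

/-- The variance of twice the log-volume of Beta simplices. -/
noncomputable def betaVar (r d : ℕ) (ν : ℝ) : ℝ :=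
  ∑ j ∈ Finset.range r, (zetaTail 2 ((d + j + 1) / 2) - zetaTail 2 ((r + d + ν) / 2)) -
    zetaTail 2 ((r + d + ν) / 2) + (2 * r + 1) * zetaTail 2 ((r + 1) * ((r + d + ν) / 2) - r)

/-- A bound for the logarithmic remainder in the Beta model. -/
noncomputable def betaRemBound (r d : ℕ) (ν : ℝ) : ℝ :=
  ∑ j ∈ Finset.range r, (zetaTail 3 ((d + j + 1) / 2) - zetaTail 3 ((r + d + ν) / 2)) / 3 +
    zetaTail 3 ((r + d + ν) / 2) / 3 +
      ((r + 1) ^ 3 - r ^ 3) * zetaTail 3 ((r + 1) * ((r + d + ν) / 2) - r) / 3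

theorem exists_prod_Gamma_eq_exp (r d : ℕ) : ∃ c : ℝ, ∀ t : ℝ,
    ∏ j ∈ Finset.range r, Complex.Gamma (((d + j + 1) / 2 : ℝ) + t * Complex.I) =
      (∏ j ∈ Finset.range r, Complex.Gamma ((d + j + 1) / 2 : ℝ)) *
        Complex.exp (Complex.I * (c * t : ℝ) - (gaussVar r d * t ^ 2 / 2 : ℝ) +
          ∑ j ∈ Finset.range r, gammaRem ((d + j + 1) / 2) t) := by
  have hb : ∀ j : ℕ, (0 : ℝ) < (d + j + 1) / 2 := fun j => by positivity
  choose c hc using fun j => exists_Gamma_eq_exp (hb j)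
  refine ⟨∑ j ∈ Finset.range r, c j, fun t => ?_⟩
  simp only [hc, Finset.prod_mul_distrib, ← Complex.exp_sum]
  congr 2
  rw [Finset.sum_add_distrib, Finset.sum_sub_distrib, ← Finset.mul_sum, gaussVar]
  push_cast
  simp only [Finset.sum_mul, Finset.sum_div]

/-- The Gamma factors depend on z/2, so the expansion is made in u = t/2. Undoing this rescaling
produces the factors 1/4 and 1/8; the power of (r + 1)2ʳ only shifts the mean. -/
theorem exists_cubicExp_gauss (r d : ℕ) : ∃ m : ℝ,
    CubicExp (fun t => gaussMomentC r d (t * Complex.I) / gaussMomentC r d 0) m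
      (gaussVar r d / 4) (gaussRemBound r d / 8) := by
  obtain ⟨c, hc⟩ := exists_prod_Gamma_eq_exp r d
  set l := Real.log (((r : ℝ) + 1) * 2 ^ r) with hl
  have hprod : ∏ j ∈ Finset.range r, Complex.Gamma ((d + j + 1) / 2 : ℝ) ≠ 0 :=
    Finset.prod_ne_zero_iff.2 fun j _ => Complex.Gamma_ne_zero_of_re_pos (by
      rw [Complex.ofReal_re]; positivity)
  have h : CubicExp (fun u : ℝ => Complex.exp (Complex.I * (l * u : ℝ)) *
      Complex.exp (Complex.I * (c * u : ℝ) - (gaussVar r d * u ^ 2 / 2 : ℝ) +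
          ∑ j ∈ Finset.range r, gammaRem ((d + j + 1) / 2) u)) (l + c) (gaussVar r d)
      (gaussRemBound r d) := by
    refine CubicExp.mul_exp ⟨_, fun t => rfl, fun t => ?_⟩ l
    rw [gaussRemBound, Finset.sum_mul]
    exact norm_sum_le_of_le _ fun j _ => norm_gammaRem_le (by positivity) t
  refine ⟨1 / 2 * (l + c), ?_⟩
  have h2 := h.comp_mul (1 / 2)
  rw [show ((1 : ℝ) / 2) ^ 2 * gaussVar r d = gaussVar r d / 4 by ring,
    show |(1 : ℝ) / 2| ^ 3 * gaussRemBound r d = gaussRemBound r d / 8 by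
      rw [abs_of_pos (by norm_num)]; ring] at h2
  convert h2 using 1
  funext t
  have e1 : (t * Complex.I / 2 : ℂ) = ((1 / 2 * t : ℝ) : ℂ) * Complex.I := by push_cast; ring
  rw [gaussMomentC, gaussMomentC, e1, hc]
  simp only [zero_div, mul_zero, add_zero, Complex.exp_zero, one_mul]
  rw [mul_div_assoc, mul_div_cancel_left₀ _ hprod, ← hl]
  congr 2
  push_cast
  ring

theorem exists_cubicExp_beta (r d : ℕ) {ν : ℝ} (hν : 0 ≤ ν) (ha : 0 < (r : ℝ) + d + ν)
    (hA : 0 < ((r : ℝ) + 1) * ((r + d + ν) / 2) - r) : ∃ m : ℝ,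
    CubicExp (fun t => betaMomentC r d ν (t * Complex.I) / betaMomentC r d ν 0) m
      (betaVar r d ν / 4) (betaRemBound r d ν / 8) := by
  obtain ⟨c, hc⟩ := exists_prod_Gamma_eq_exp r d
  have ha2 : 0 < ((r : ℝ) + d + ν) / 2 := by positivity
  obtain ⟨ca, hca⟩ := exists_Gamma_eq_exp ha2
  obtain ⟨cA, hcA⟩ := exists_Gamma_eq_exp hA
  set a := ((r : ℝ) + d + ν) / 2 with haDef
  set A := ((r : ℝ) + 1) * a - r with hADef
  have hprod : ∏ j ∈ Finset.range r, Complex.Gamma ((d + j + 1) / 2 : ℝ) ≠ 0 :=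
    Finset.prod_ne_zero_iff.2 fun j _ => Complex.Gamma_ne_zero_of_re_pos (by
      rw [Complex.ofReal_re]; positivity)
  have hGa : Complex.Gamma a ≠ 0 := Complex.Gamma_ne_zero_of_re_pos (by rwa [Complex.ofReal_re])
  have hGA : Complex.Gamma A ≠ 0 := Complex.Gamma_ne_zero_of_re_pos (by rwa [Complex.ofReal_re])
  have hr : (0 : ℝ) ≤ r := Nat.cast_nonneg r
  have hd : (0 : ℝ) ≤ d := Nat.cast_nonneg d
  -- Pair each of the r numerator Gammas with one of the r + 1 copies of Γ(a + z/2), leaving a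
  -- single copy over, and pair the two Gammas based at A with each other.
  set R : ℝ → ℂ := fun u => ∑ j ∈ Finset.range r, (gammaRem ((d + j + 1) / 2) u - gammaRem a u) -
    gammaRem a u + (gammaRem A ((r + 1) * u) - gammaRem A (r * u)) with hR
  have h : CubicExp (fun u : ℝ => Complex.exp (Complex.I * ((c - (r + 1) * ca + cA) * u : ℝ) -
      (betaVar r d ν * u ^ 2 / 2 : ℝ) + R u)) (c - (r + 1) * ca + cA) (betaVar r d ν)
      (betaRemBound r d ν) := by
    refine ⟨R, fun t => rfl, fun t => ?_⟩
    have h1 : ‖∑ j ∈ Finset.range r, (gammaRem ((d + j + 1) / 2) t - gammaRem a t)‖ ≤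
        ∑ j ∈ Finset.range r, (zetaTail 3 ((d + j + 1) / 2) - zetaTail 3 a) / 3 * |t| ^ 3 := by
      refine norm_sum_le_of_le _ fun j hj => norm_gammaRem_sub_le_of_le (by positivity) ?_ t
      have : (j : ℝ) + 1 ≤ r := by exact_mod_cast Finset.mem_range.1 hj
      rw [haDef]
      linarith
    have h2 := norm_gammaRem_le ha2 t
    have h3 := norm_gammaRem_mul_sub_le hA (x := r + 1) (y := r) hr (by linarith) t
    rw [← Finset.sum_mul] at h1
    refine (norm_add_le _ _).trans ((add_le_add_left (norm_sub_le _ _) _).trans ?_)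
    refine (add_le_add (add_le_add h1 h2) h3).trans (le_of_eq ?_)
    rw [betaRemBound, ← haDef, ← hADef]
    ring
  refine ⟨1 / 2 * (c - (r + 1) * ca + cA), ?_⟩
  have h2 := h.comp_mul (1 / 2)
  rw [show ((1 : ℝ) / 2) ^ 2 * betaVar r d ν = betaVar r d ν / 4 by ring,
    show |(1 : ℝ) / 2| ^ 3 * betaRemBound r d ν = betaRemBound r d ν / 8 by
      rw [abs_of_pos (by norm_num)]; ring] at h2
  convert h2 using 1
  funext t
  set u : ℝ := 1 / 2 * t with hu
  have e1 : (t * Complex.I / 2 : ℂ) = (u : ℂ) * Complex.I := by rw [hu]; push_cast; ring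
  have e2 : ((r + 1) * ((u : ℂ) * Complex.I)) = (((r + 1) * u : ℝ) : ℂ) * Complex.I := by
    push_cast; ring
  have e3 : (r * ((u : ℂ) * Complex.I)) = ((r * u : ℝ) : ℂ) * Complex.I := by
    push_cast; ring
  rw [betaMomentC, betaMomentC, e1, ← haDef, ← hADef, e2, e3, hc, hca, hcA, hcA]
  simp only [zero_div, mul_zero, add_zero]
  set E1 := Complex.exp (Complex.I * (c * u : ℝ) - (gaussVar r d * u ^ 2 / 2 : ℝ) +
    ∑ j ∈ Finset.range r, gammaRem ((d + j + 1) / 2) u) with hE1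
  set w2 := Complex.I * (ca * u : ℝ) - (zetaTail 2 a * u ^ 2 / 2 : ℝ) + gammaRem a u with hw2
  set w3 := Complex.I * (cA * ((r + 1) * u) : ℝ) - (zetaTail 2 A * ((r + 1) * u) ^ 2 / 2 : ℝ) +
    gammaRem A ((r + 1) * u) with hw3
  set w4 := Complex.I * (cA * (r * u) : ℝ) - (zetaTail 2 A * (r * u) ^ 2 / 2 : ℝ) +
    gammaRem A (r * u) with hw4
  have h5 : (∏ j ∈ Finset.range r, Complex.Gamma ((d + j + 1) / 2 : ℝ)) * E1 /
      (Complex.Gamma a * Complex.exp w2) ^ (r + 1) *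
      (Complex.Gamma A * Complex.exp w3 / (Complex.Gamma A * Complex.exp w4)) /
      ((∏ j ∈ Finset.range r, Complex.Gamma ((d + j + 1) / 2 : ℝ)) / Complex.Gamma a ^ (r + 1) *
        (Complex.Gamma A / Complex.Gamma A)) =
      E1 * (Complex.exp w2 ^ (r + 1))⁻¹ * (Complex.exp w3 * (Complex.exp w4)⁻¹) := by
    have := Complex.exp_ne_zero w4
    have := Complex.exp_ne_zero w2
    rw [mul_pow]
    field_simp
  rw [h5, ← Complex.exp_nat_mul, ← Complex.exp_neg, ← Complex.exp_neg, hE1, ← Complex.exp_add,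
    ← Complex.exp_add, ← Complex.exp_add]
  congr 1
  have h6 : betaVar r d ν = gaussVar r d - (r + 1) * zetaTail 2 a + (2 * r + 1) * zetaTail 2 A := by
    rw [betaVar, gaussVar, Finset.sum_sub_distrib, Finset.sum_const, Finset.card_range,
      nsmul_eq_mul, ← haDef, ← hADef]
    ring
  simp only [hR, hw2, hw3, hw4, h6, Finset.sum_sub_distrib, Finset.sum_const, Finset.card_range,
    nsmul_eq_mul]
  push_cast
  ring

/-! ### Variance bounds -/

theorem hasSum_sub_succ {f : ℕ → ℝ} (hf : Antitone f) (h0 : Tendsto f atTop (𝓝 0)) :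
    HasSum (fun k => f k - f (k + 1)) (f 0) := by
  rw [hasSum_iff_tendsto_nat_of_nonneg fun k => sub_nonneg.2 (hf k.le_succ)]
  simp only [Finset.sum_range_sub']
  simpa using h0.const_sub (f 0)

theorem hasSum_one_div_sub_succ {a : ℝ} (ha : 0 < a) :
    HasSum (fun k : ℕ => 1 / (a + k) - 1 / (a + (k + 1 : ℕ))) (1 / a) := by
  have hanti : Antitone fun k : ℕ => 1 / (a + k) := fun i j hij => by
    have : (i : ℝ) ≤ j := by exact_mod_cast hij
    simp only
    gcongr
  have hlim : Tendsto (fun k : ℕ => 1 / (a + k)) atTop (𝓝 0) :=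
    tendsto_const_nhds.div_atTop (tendsto_atTop_add_const_left _ a tendsto_natCast_atTop_atTop)
  simpa using hasSum_sub_succ hanti hlim

theorem one_div_le_zetaTail_two {a : ℝ} (ha : 0 < a) : 1 / a ≤ zetaTail 2 a := by
  refine hasSum_le (fun k => ?_) (hasSum_one_div_sub_succ ha) (hasSum_zetaTail ha le_rfl)
  have hk : 0 < a + k := by positivity
  push_cast
  rw [div_sub_div _ _ hk.ne' (by positivity), div_le_div_iff₀ (by positivity) (by positivity)]
  nlinarith

/-- Telescoping with the midpoint shift: 1/x² ≤ 1/(x - 1/2) - 1/(x + 1/2). -/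
theorem zetaTail_two_le {a : ℝ} (ha : 1 / 2 < a) : zetaTail 2 a ≤ 1 / (a - 1 / 2) := by
  refine hasSum_le (fun k => ?_) (hasSum_zetaTail (by linarith) le_rfl)
    (hasSum_one_div_sub_succ (a := a - 1 / 2) (by linarith))
  have hk : (0 : ℝ) ≤ k := Nat.cast_nonneg k
  have h1 : 0 < a - 1 / 2 + k := by linarith
  have h2 : 0 < a - 1 / 2 + (k + 1) := by linarith
  push_cast
  rw [div_sub_div _ _ h1.ne' h2.ne', div_le_div_iff₀ (pow_pos (by linarith) 2) (by positivity)]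
  nlinarith

theorem zetaTail_two_anti {a b : ℝ} (hb : 0 < b) (hba : b ≤ a) : zetaTail 2 a ≤ zetaTail 2 b :=
  hasSum_le (fun k => by gcongr) (hasSum_zetaTail (hb.trans_le hba) le_rfl)
    (hasSum_zetaTail hb le_rfl)

theorem zetaTail_three_le {b : ℝ} (hb : 0 < b) : zetaTail 3 b ≤ 1 / b * zetaTail 2 b := by
  refine hasSum_le (fun k => ?_) (hasSum_zetaTail hb (by norm_num))
    ((hasSum_zetaTail hb le_rfl).mul_left (1 / b))
  have hk : (0 : ℝ) ≤ k := Nat.cast_nonneg k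
  rw [pow_succ', ← one_div_mul_one_div]
  gcongr
  linarith

/-- Termwise, x³ - y³ ≤ (3/2)x(x² - y²) for 0 ≤ y ≤ x, and x ≤ 1/b₀. Differences of third-order sums
are thus controlled by the second-order differences that occur in the variance. -/
theorem zetaTail_three_sub_le {a b b₀ : ℝ} (hb₀ : 0 < b₀) (hb : b₀ ≤ b) (hba : b ≤ a) :
    zetaTail 3 b - zetaTail 3 a ≤ 3 / 2 * (1 / b₀) * (zetaTail 2 b - zetaTail 2 a) := by
  have hb' := hb₀.trans_le hb
  have ha' := hb'.trans_le hba
  refine hasSum_le (fun k => ?_)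
    ((hasSum_zetaTail hb' (by norm_num)).sub (hasSum_zetaTail ha' (by norm_num)))
    (((hasSum_zetaTail hb' le_rfl).sub (hasSum_zetaTail ha' le_rfl)).mul_left _)
  have hk : (0 : ℝ) ≤ k := Nat.cast_nonneg k
  have hy : 0 < 1 / (a + k) := by positivity
  have hyx : 1 / (a + k) ≤ 1 / (b + k) := by gcongr
  have hx0 : 1 / (b + k) ≤ 1 / b₀ := one_div_le_one_div_of_le hb₀ (by linarith)
  simp only [← one_div_pow (_ + _)]
  generalize 1 / (a + k) = y at *
  generalize 1 / (b + k) = x at *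
  generalize 1 / b₀ = z at *
  have h1 : x ^ 3 - y ^ 3 ≤ 3 / 2 * x * (x ^ 2 - y ^ 2) := by
    nlinarith [mul_nonneg (sub_nonneg.2 hyx) (mul_nonneg (sub_nonneg.2 hyx) (by linarith : 0 ≤ x)),
      mul_nonneg (sub_nonneg.2 hyx) (mul_nonneg (sub_nonneg.2 hyx) hy.le)]
  have h2 : 0 ≤ x ^ 2 - y ^ 2 := by nlinarith
  nlinarith [mul_le_mul_of_nonneg_right hx0 h2]

theorem log_div_le_sum_one_div (r d : ℕ) :
    Real.log ((d + r + 1) / (d + 1)) ≤ ∑ j ∈ Finset.range r, 1 / ((d : ℝ) + j + 1) := by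
  induction r with
  | zero => simp [div_self (by positivity : (d : ℝ) + 1 ≠ 0)]
  | succ r ih =>
    rw [Finset.sum_range_succ]
    have h1 : ((d : ℝ) + (r + 1 : ℕ) + 1) / (d + 1) =
        (d + r + 1) / (d + 1) * (1 + 1 / (d + r + 1)) := by
      push_cast
      field_simp
      ring
    rw [h1, Real.log_mul (by positivity) (by positivity)]
    have h2 := Real.log_le_sub_one_of_pos (x := 1 + 1 / ((d : ℝ) + r + 1)) (by positivity)
    linarith

theorem two_mul_log_le_gaussVar (r d : ℕ) :
    2 * Real.log ((d + r + 1) / (d + 1)) ≤ gaussVar r d := by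
  refine (mul_le_mul_of_nonneg_left (log_div_le_sum_one_div r d) zero_le_two).trans ?_
  rw [Finset.mul_sum, gaussVar]
  refine Finset.sum_le_sum fun j _ => ?_
  refine (le_of_eq ?_).trans (one_div_le_zetaTail_two (a := ((d : ℝ) + j + 1) / 2) (by positivity))
  field_simp

theorem one_div_le_gaussVar {r : ℕ} (hr : 1 ≤ r) (d : ℕ) : 2 / ((r : ℝ) + d) ≤ gaussVar r d := by
  have hr' : (1 : ℝ) ≤ r := by exact_mod_cast hr
  have hmem : r - 1 ∈ Finset.range r := Finset.mem_range.2 (by omega)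
  refine le_trans ?_ (Finset.single_le_sum (f := fun j : ℕ => zetaTail 2 (((d : ℝ) + j + 1) / 2))
    (fun j _ => (by positivity : (0 : ℝ) ≤ 1 / (((d : ℝ) + j + 1) / 2)).trans
      (one_div_le_zetaTail_two (by positivity))) hmem)
  refine le_trans (le_of_eq ?_) (one_div_le_zetaTail_two (by positivity))
  rw [Nat.cast_sub hr]
  have : (d : ℝ) + (r - (1 : ℕ)) + 1 = r + d := by push_cast; ring
  rw [this]
  field_simp

theorem gaussRemBound_le (r d : ℕ) : gaussRemBound r d ≤ gaussVar r d / ((d : ℝ) + 1) := by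
  rw [gaussRemBound, gaussVar, Finset.sum_div]
  refine Finset.sum_le_sum fun j _ => ?_
  have hb : 0 < ((d : ℝ) + j + 1) / 2 := by positivity
  have h0 : 0 ≤ zetaTail 2 (((d : ℝ) + j + 1) / 2) :=
    (by positivity : (0 : ℝ) ≤ 1 / (((d : ℝ) + j + 1) / 2)).trans (one_div_le_zetaTail_two hb)
  have h1 := zetaTail_three_le hb
  have h2 : 1 / (((d : ℝ) + j + 1) / 2) ≤ 2 / (d + 1) := by
    rw [one_div_div]
    have : (0 : ℝ) ≤ j := Nat.cast_nonneg j
    gcongr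
    linarith
  have h3 := mul_le_mul_of_nonneg_right h2 h0
  have h4 : 0 ≤ zetaTail 2 (((d : ℝ) + j + 1) / 2) / (d + 1) := by positivity
  calc _ ≤ (2 / ((d : ℝ) + 1) * zetaTail 2 (((d : ℝ) + j + 1) / 2)) / 3 := by linarith
    _ = 2 / 3 * (zetaTail 2 (((d : ℝ) + j + 1) / 2) / (d + 1)) := by ring
    _ ≤ _ := by linarith

theorem sum_zetaTail_sub_nonneg (r d : ℕ) {ν : ℝ} (hν : 0 ≤ ν) :
    ∀ j ∈ Finset.range r, 0 ≤ zetaTail 2 (((d : ℝ) + j + 1) / 2) - zetaTail 2 ((r + d + ν) / 2) :=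
  fun j hj => by
  have : (j : ℝ) + 1 ≤ r := by exact_mod_cast Finset.mem_range.1 hj
  exact sub_nonneg.2 (zetaTail_two_anti (by positivity) (by linarith))

/-- The unpaired -ζ(2,a) is about -1/a for large a, while (2r + 1)ζ(2,A) is at least (2r + 1)/((r +
1)a) ≥ 3/(2a). A multiple of 1/a therefore survives even when the sum vanishes, as it does for r =
1, ν = 0. -/
theorem add_one_div_le_betaVar {r d : ℕ} (hr : 1 ≤ r) (hrd : 2 ≤ r + d) {ν : ℝ} (hν : 0 ≤ ν) :
    ∑ j ∈ Finset.range r, (zetaTail 2 (((d : ℝ) + j + 1) / 2) - zetaTail 2 ((r + d + ν) / 2)) +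
      1 / (4 * ((r + d + ν) / 2)) ≤ betaVar r d ν := by
  have hr' : (1 : ℝ) ≤ r := by exact_mod_cast hr
  have hrd' : (2 : ℝ) ≤ r + d := by exact_mod_cast hrd
  rw [betaVar]
  set a := ((r : ℝ) + d + ν) / 2 with ha
  have ha1 : 1 ≤ a := by rw [ha]; linarith
  have hra : 1 ≤ r * a := by nlinarith
  have hA : 0 < (r + 1) * a - r := by nlinarith
  have h1 := zetaTail_two_le (a := a) (by linarith)
  have h2 := mul_le_mul_of_nonneg_left (one_div_le_zetaTail_two hA)
    (by positivity : (0 : ℝ) ≤ 2 * r + 1)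
  have h3 : 1 / (4 * a) ≤ (2 * r + 1) * (1 / ((r + 1) * a - r)) - 1 / (a - 1 / 2) := by
    have ha2 : 0 < a - 1 / 2 := by linarith
    rw [mul_one_div, div_sub_div _ _ hA.ne' ha2.ne', div_le_div_iff₀ (by positivity) (by positivity)]
    nlinarith [mul_nonneg (sub_nonneg.2 hra) (by linarith : 0 ≤ a), mul_nonneg (by linarith : 0 ≤ a - 1) (by linarith : (0 : ℝ) ≤ r - 1)]
  linarith

/-- The subtracted terms cost at most rζ(2,a) ≤ r/(a - 1/2) ≤ 4, so the logarithmic growth of the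
Gaussian variance persists. -/
theorem two_mul_log_sub_le_betaVar {r d : ℕ} (hr : 1 ≤ r) (hrd : 2 ≤ r + d) {ν : ℝ} (hν : 0 ≤ ν) :
    2 * Real.log ((d + r + 1) / (d + 1)) - 4 ≤ betaVar r d ν := by
  have hr' : (1 : ℝ) ≤ r := by exact_mod_cast hr
  have hrd' : (2 : ℝ) ≤ r + d := by exact_mod_cast hrd
  have hd : (0 : ℝ) ≤ d := Nat.cast_nonneg d
  have h1 := add_one_div_le_betaVar hr hrd hν
  have h2 := two_mul_log_le_gaussVar r d
  have h3 : ∑ j ∈ Finset.range r, (zetaTail 2 (((d : ℝ) + j + 1) / 2) -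
      zetaTail 2 ((r + d + ν) / 2)) = gaussVar r d - r * zetaTail 2 ((r + d + ν) / 2) := by
    rw [gaussVar, Finset.sum_sub_distrib, Finset.sum_const, Finset.card_range, nsmul_eq_mul]
  have h4 : r * zetaTail 2 ((r + d + ν) / 2) ≤ 4 := by
    have := mul_le_mul_of_nonneg_left (zetaTail_two_le (a := (r + d + ν) / 2) (by linarith))
      (by linarith : (0 : ℝ) ≤ r)
    refine this.trans ?_
    rw [mul_one_div, div_le_iff₀ (by linarith)]
    linarith
  have h5 : 0 < 1 / (4 * ((r + d + ν) / 2)) := by positivity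
  linarith

/-- The paired terms are absorbed by v/(d + 1). The leftover copy gives 2/(3a²), and the pair based
at A gives 8/a² since A ≥ (r + 1)a/2 when a ≥ 2; their sum is below 9/a². -/
theorem betaRemBound_le {r d : ℕ} (hr : 1 ≤ r) (hrd : 4 ≤ r + d) {ν : ℝ} (hν : 0 ≤ ν) :
    betaRemBound r d ν ≤ betaVar r d ν / ((d : ℝ) + 1) + 9 / ((r + d + ν) / 2) ^ 2 := by
  have hr' : (1 : ℝ) ≤ r := by exact_mod_cast hr
  have hrd' : (4 : ℝ) ≤ r + d := by exact_mod_cast hrd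
  have h1 := add_one_div_le_betaVar hr (by omega : 2 ≤ r + d) hν
  have hsum : ∑ j ∈ Finset.range r, (zetaTail 3 (((d : ℝ) + j + 1) / 2) -
      zetaTail 3 ((r + d + ν) / 2)) / 3 ≤ (∑ j ∈ Finset.range r,
        (zetaTail 2 (((d : ℝ) + j + 1) / 2) - zetaTail 2 ((r + d + ν) / 2))) / (d + 1) := by
    rw [Finset.sum_div]
    refine Finset.sum_le_sum fun j hj => ?_
    have hj1 : (j : ℝ) + 1 ≤ r := by exact_mod_cast Finset.mem_range.1 hj
    have hj0 : (0 : ℝ) ≤ j := Nat.cast_nonneg j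
    have := zetaTail_three_sub_le (a := (r + d + ν) / 2) (b := ((d : ℝ) + j + 1) / 2)
      (b₀ := ((d : ℝ) + 1) / 2) (by positivity) (by linarith) (by linarith)
    calc _ ≤ 3 / 2 * (1 / (((d : ℝ) + 1) / 2)) * (zetaTail 2 (((d : ℝ) + j + 1) / 2) -
          zetaTail 2 ((r + d + ν) / 2)) / 3 := by linarith
      _ = _ := by field_simp
  rw [betaRemBound]
  set a := ((r : ℝ) + d + ν) / 2 with ha
  have ha2 : 2 ≤ a := by rw [ha]; linarith
  set A := (r + 1) * a - r with hA
  have hAa : (r + 1) * a / 2 ≤ A := by rw [hA]; nlinarith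
  have hA2 : 2 ≤ A := by nlinarith
  have h3 : ∀ x : ℝ, 2 ≤ x → zetaTail 3 x ≤ 2 / x ^ 2 := fun x hx => by
    have h4 := zetaTail_two_le (a := x) (by linarith)
    have h5 : 1 / (x - 1 / 2) ≤ 2 / x := by
      rw [div_le_div_iff₀ (by linarith) (by linarith)]
      linarith
    calc zetaTail 3 x ≤ 1 / x * zetaTail 2 x := zetaTail_three_le (by linarith)
      _ ≤ 1 / x * (2 / x) := by gcongr; linarith
      _ = 2 / x ^ 2 := by rw [div_mul_div_comm, one_mul, sq]
  have h6 : ((r + 1) ^ 3 - r ^ 3) * zetaTail 3 A ≤ 24 / a ^ 2 := by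
    have h7 : ((r : ℝ) + 1) ^ 3 - r ^ 3 ≤ 3 * (r + 1) ^ 2 := by nlinarith
    have h8 : 2 / A ^ 2 ≤ 2 / ((r + 1) * a / 2) ^ 2 := by gcongr
    calc _ ≤ (3 * ((r : ℝ) + 1) ^ 2) * (2 / ((r + 1) * a / 2) ^ 2) := by
          refine mul_le_mul h7 ((h3 A hA2).trans h8) ?_ (by positivity)
          exact tsum_nonneg fun k => by positivity
      _ = 24 / a ^ 2 := by field_simp; norm_num
  have h9 := h3 a ha2
  have h10 : (∑ j ∈ Finset.range r, (zetaTail 2 (((d : ℝ) + j + 1) / 2) - zetaTail 2 a)) / (d + 1) ≤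
      betaVar r d ν / (d + 1) := by
    have : 0 < 1 / (4 * a) := by positivity
    gcongr
    linarith
  have e1 : (9 : ℝ) / a ^ 2 = 9 * (1 / a ^ 2) := by ring
  have e2 : (2 : ℝ) / a ^ 2 = 2 * (1 / a ^ 2) := by ring
  have e3 : (24 : ℝ) / a ^ 2 = 24 * (1 / a ^ 2) := by ring
  have : 0 < 1 / a ^ 2 := by positivity
  rw [e2] at h9
  rw [e3] at h6
  rw [e1]
  linarith

/-! ### The central limit theorem -/

/-- The cases split at s = n^{3/4}. Above it s²v ≥ n^{3/2}·c/n; below it (n + 1)/s ≥ n^{1/4} makes v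
itself at least (1/2) log n - 4. -/
theorem min_le_sq_mul_of_le {n s v c : ℝ} (hn : 1 ≤ n) (hs : 1 ≤ s) (hv : 0 < v) (hc : 0 < c)
    (h1 : c / n ≤ v) (h2 : 2 * Real.log ((n + 1) / s) - 4 ≤ v) :
    min (c * √n) (1 / 2 * Real.log n - 4) ≤ s ^ 2 * v := by
  have hn0 : 0 < n := by linarith
  rcases le_total (n ^ (3 / 4 : ℝ)) s with h | h
  · refine (min_le_left _ _).trans ?_
    have h3 : (n ^ (3 / 4 : ℝ)) ^ 2 = n * √n := by
      rw [← Real.rpow_natCast, ← Real.rpow_mul hn0.le, Real.sqrt_eq_rpow,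
        ← Real.rpow_one_add' hn0.le (by norm_num)]
      norm_num
    calc c * √n = n * √n * (c / n) := by field_simp
      _ = (n ^ (3 / 4 : ℝ)) ^ 2 * (c / n) := by rw [h3]
      _ ≤ s ^ 2 * v := by gcongr
  · refine (min_le_right _ _).trans ?_
    have h3 : 1 / 4 * Real.log n ≤ Real.log ((n + 1) / s) := by
      have h4 : n ^ (1 / 4 : ℝ) ≤ (n + 1) / s := by
        rw [le_div_iff₀ (by linarith)]
        calc n ^ (1 / 4 : ℝ) * s ≤ n ^ (1 / 4 : ℝ) * n ^ (3 / 4 : ℝ) := by gcongr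
          _ = n := by rw [← Real.rpow_add hn0]; norm_num
          _ ≤ n + 1 := by linarith
      have := Real.log_le_log (by positivity) h4
      rwa [Real.log_rpow hn0] at this
    have h5 : 1 * v ≤ s ^ 2 * v := by
      gcongr
      exact one_le_pow₀ hs
    linarith

/-- The main part of κ/v^{3/2} is 1/((d + 1)√v), and (d + 1)²v → ∞ at a rate independent of how d
varies with n. The term q holds the part of the remainder not dominated by the variance. -/
theorem tendsto_remainder_ratio {v κ q : ℕ → ℝ} {d : ℕ → ℕ} {c : ℝ} (hc : 0 < c)
    (h : ∀ᶠ n : ℕ in atTop, 0 < v n ∧ 0 ≤ κ n ∧ c / n ≤ v n ∧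
      2 * Real.log ((n + 1) / (d n + 1)) - 4 ≤ v n ∧ κ n ≤ v n / (d n + 1) + q n)
    (hq : Tendsto (fun n => q n / √(v n) ^ 3) atTop (𝓝 0)) :
    Tendsto (fun n => κ n / √(v n) ^ 3) atTop (𝓝 0) := by
  set g : ℕ → ℝ := fun n => min (c * √(n : ℝ)) (1 / 2 * Real.log n - 4) with hg
  have hgt : Tendsto g atTop atTop := by
    have h1 : Tendsto (fun n : ℕ => c * √(n : ℝ)) atTop atTop :=
      (Real.tendsto_sqrt_atTop.comp tendsto_natCast_atTop_atTop).const_mul_atTop hc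
    have h2 : Tendsto (fun n : ℕ => 1 / 2 * Real.log n - 4) atTop atTop :=
      tendsto_atTop_add_const_right _ _
        ((Real.tendsto_log_atTop.comp tendsto_natCast_atTop_atTop).const_mul_atTop (by norm_num))
    refine tendsto_atTop.2 fun b => ?_
    filter_upwards [h1.eventually_ge_atTop b, h2.eventually_ge_atTop b] with n x y
    exact le_min x y
  have h1 : Tendsto (fun n => 1 / √(g n) + q n / √(v n) ^ 3) atTop (𝓝 0) := by
    have := (tendsto_const_nhds (x := (1 : ℝ))).div_atTop (Real.tendsto_sqrt_atTop.comp hgt)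
    simpa using this.add hq
  refine squeeze_zero' ?_ ?_ h1
  · filter_upwards [h] with n hn
    have := hn.2.1
    positivity
  · filter_upwards [h, hgt.eventually_gt_atTop 0, eventually_ge_atTop 1] with n hn hgn hn1
    obtain ⟨hv, hκ, ha, hb, hκle⟩ := hn
    have hs : (1 : ℝ) ≤ d n + 1 := by linarith [(Nat.cast_nonneg (d n) : (0 : ℝ) ≤ d n)]
    have hmin := min_le_sq_mul_of_le (by exact_mod_cast hn1) hs hv hc ha hb
    have hsv : 0 < √(v n) := Real.sqrt_pos.2 hv
    have h2 : √(g n) ≤ (d n + 1) * √(v n) := by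
      rw [← Real.sqrt_sq (by linarith : (0 : ℝ) ≤ d n + 1), ← Real.sqrt_mul (sq_nonneg _)]
      exact Real.sqrt_le_sqrt hmin
    have h3 : v n / (d n + 1) / √(v n) ^ 3 = 1 / ((d n + 1) * √(v n)) := by
      nth_rewrite 1 [← Real.sq_sqrt hv.le]
      field_simp
    calc κ n / √(v n) ^ 3 ≤ (v n / (d n + 1) + q n) / √(v n) ^ 3 := by gcongr
      _ = 1 / ((d n + 1) * √(v n)) + q n / √(v n) ^ 3 := by rw [add_div, h3]
      _ ≤ _ := by
        have := Real.sqrt_pos.2 hgn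
        gcongr

/-- The variance of twice the log-volume. -/
noncomputable def PointModel.logVar (M : PointModel) (r d : ℕ) : ℝ :=
  match M with
  | .gaussian => gaussVar r d
  | .beta ν _ => betaVar r d ν
  | .spherical => betaVar r d 0

/-- A bound for the logarithmic remainder of the characteristic function of twice the
log-volume. -/
noncomputable def PointModel.remBound (M : PointModel) (r d : ℕ) : ℝ :=
  match M with
  | .gaussian => gaussRemBound r d
  | .beta ν _ => betaRemBound r d ν
  | .spherical => betaRemBound r d 0

theorem betaVar_pos {r d : ℕ} (hr : 1 ≤ r) (hrd : 2 ≤ r + d) {ν : ℝ} (hν : 0 ≤ ν) :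
    0 < betaVar r d ν := by
  have hrd' : (2 : ℝ) ≤ r + d := by exact_mod_cast hrd
  have h1 := add_one_div_le_betaVar hr hrd hν
  have h2 := Finset.sum_nonneg (sum_zetaTail_sub_nonneg r d hν)
  have h3 : 0 < 1 / (4 * ((r + d + ν) / 2)) := by
    have : 0 < r + d + ν := by linarith
    positivity
  linarith

theorem PointModel.logVar_pos (M : PointModel) {r d : ℕ} (hr : 1 ≤ r) (hrd : 2 ≤ r + d) :
    0 < M.logVar r d := by
  cases M with
  | gaussian =>
    refine lt_of_lt_of_le ?_ (one_div_le_gaussVar hr d)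
    positivity
  | beta ν hν => exact betaVar_pos hr hrd hν.le
  | spherical => exact betaVar_pos hr hrd le_rfl

/-- With a = (n + ν)/2 the extra term is 9/a², while v ≥ 1/(4a); its ratio to v^{3/2} is at most
72/√a. -/
theorem tendsto_betaRemBound_ratio {ν : ℝ} (hν : 0 ≤ ν) {r d : ℕ → ℕ} (hr : ∀ n, 1 ≤ n → 1 ≤ r n)
    (hrd : ∀ n, 1 ≤ n → r n + d n = n) (hκ : ∀ᶠ n in atTop, 0 ≤ betaRemBound (r n) (d n) ν) :
    Tendsto (fun n => betaRemBound (r n) (d n) ν / √(betaVar (r n) (d n) ν) ^ 3) atTop (𝓝 0) := by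
  refine tendsto_remainder_ratio (d := d) (q := fun n => 9 / ((n + ν) / 2) ^ 2)
    (c := 1 / (2 * (1 + ν))) (by positivity) ?_ ?_
  · filter_upwards [eventually_ge_atTop 4, hκ] with n hn hκn
    have h1 : r n + d n = n := hrd n (by omega)
    have hr1 := hr n (by omega)
    have h1' : (r n : ℝ) + d n = n := by exact_mod_cast h1
    have hn' : (4 : ℝ) ≤ n := by exact_mod_cast hn
    have h2 := add_one_div_le_betaVar hr1 (by omega : 2 ≤ r n + d n) hν
    have h3 := Finset.sum_nonneg (sum_zetaTail_sub_nonneg (r n) (d n) hν)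
    refine ⟨betaVar_pos hr1 (by omega) hν, hκn, ?_, ?_, ?_⟩
    · refine le_trans ?_ ((le_add_of_nonneg_left h3).trans h2)
      rw [h1', div_div, div_le_div_iff₀ (by positivity) (by positivity)]
      nlinarith
    · have := two_mul_log_sub_le_betaVar hr1 (by omega : 2 ≤ r n + d n) hν
      rwa [show (d n : ℝ) + r n + 1 = n + 1 by linarith] at this
    · have := betaRemBound_le hr1 (by omega : 4 ≤ r n + d n) hν
      rwa [h1'] at this
  · have hlim : Tendsto (fun n : ℕ => 72 / √(((n : ℝ) + ν) / 2)) atTop (𝓝 0) := by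
      refine tendsto_const_nhds.div_atTop (Real.tendsto_sqrt_atTop.comp ?_)
      exact (tendsto_atTop_add_const_right _ ν tendsto_natCast_atTop_atTop).atTop_div_const two_pos
    refine squeeze_zero' (.of_forall fun n => by positivity) ?_ hlim
    filter_upwards [eventually_ge_atTop 2] with n hn
    have h1 : r n + d n = n := hrd n (by omega)
    have hr1 := hr n (by omega)
    have h1' : (r n : ℝ) + d n = n := by exact_mod_cast h1
    have h2 := add_one_div_le_betaVar hr1 (by omega : 2 ≤ r n + d n) hν
    have h3 := Finset.sum_nonneg (sum_zetaTail_sub_nonneg (r n) (d n) hν)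
    have h4 := (le_add_of_nonneg_left h3).trans h2
    rw [h1'] at h4
    have hn' : (2 : ℝ) ≤ n := by exact_mod_cast hn
    set a := ((n : ℝ) + ν) / 2 with ha
    have ha0 : 0 < a := by rw [ha]; linarith
    have hb : 0 < √a := Real.sqrt_pos.2 ha0
    have h5 : 1 / (2 * √a) ≤ √(betaVar (r n) (d n) ν) := by
      refine Real.le_sqrt_of_sq_le ?_
      rw [div_pow, mul_pow, Real.sq_sqrt ha0.le]
      linarith
    calc 9 / a ^ 2 / √(betaVar (r n) (d n) ν) ^ 3 ≤ 9 / a ^ 2 / (1 / (2 * √a)) ^ 3 := by gcongr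
      _ = 72 / √a := by
        rw [show a ^ 2 = √a ^ 4 by rw [show √a ^ 4 = (√a ^ 2) ^ 2 by ring, Real.sq_sqrt ha0.le]]
        field_simp
        norm_num

theorem PointModel.tendsto_remBound_ratio (M : PointModel) {r d : ℕ → ℕ}
    (hr : ∀ n, 1 ≤ n → 1 ≤ r n) (hrd : ∀ n, 1 ≤ n → r n + d n = n)
    (hκ : ∀ᶠ n in atTop, 0 ≤ M.remBound (r n) (d n)) :
    Tendsto (fun n => M.remBound (r n) (d n) / √(M.logVar (r n) (d n)) ^ 3) atTop (𝓝 0) := by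
  cases M with
  | gaussian =>
    refine tendsto_remainder_ratio (d := d) (q := fun _ => 0) (c := 2) two_pos ?_ (by simp)
    filter_upwards [eventually_ge_atTop 2, hκ] with n hn hκn
    have h1 : r n + d n = n := hrd n (by omega)
    have hr1 := hr n (by omega)
    have h1' : (r n : ℝ) + d n = n := by exact_mod_cast h1
    refine ⟨PointModel.logVar_pos .gaussian hr1 (by omega), hκn, ?_, ?_, ?_⟩
    · have := one_div_le_gaussVar hr1 (d n)
      rwa [h1'] at this
    · have := two_mul_log_le_gaussVar (r n) (d n)
      rw [show (d n : ℝ) + r n + 1 = n + 1 by linarith] at this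
      change _ ≤ gaussVar _ _
      linarith
    · rw [add_zero]
      exact gaussRemBound_le _ _
  | beta ν hν => exact tendsto_betaRemBound_ratio hν.le hr hrd hκ
  | spherical => exact tendsto_betaRemBound_ratio le_rfl hr hrd hκ

theorem PointModel.exists_cubicExp_log_volFactor (M : PointModel) {r d : ℕ} (hrd : 2 ≤ r + d)
    [IsProbabilityMeasure (M.law (r + d))] :
    (∀ᵐ x ∂(Measure.pi fun _ : Fin (r + 1) => M.law (r + d)), 0 < volFactor x) ∧
    ∃ m, CubicExp (charFun ((Measure.pi fun _ : Fin (r + 1) => M.law (r + d)).map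
      fun x => Real.log (volFactor x))) m (M.logVar r d / 4) (M.remBound r d / 8) := by
  have hW : Measurable (volFactor : (Fin (r + 1) → EuclideanSpace ℝ (Fin (r + d))) → ℝ) :=
    continuous_volFactor.measurable
  -- Common to the Beta and spherical models: the latter has the Beta moment formula with ν = 0, so
  -- only that formula and positivity of the volume are needed.
  have hbeta : ∀ ν : ℝ, 0 ≤ ν → ∀ (μ : Measure (EuclideanSpace ℝ (Fin (r + d))))
      [IsProbabilityMeasure μ],
      (∀ᵐ x ∂(Measure.pi fun _ : Fin (r + 1) => μ), 0 < volFactor x) →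
      (∀ p : ℝ, 0 < p → ∫⁻ x, ENNReal.ofReal (volFactor x) ^ p
        ∂(Measure.pi fun _ : Fin (r + 1) => μ) =
          ENNReal.ofReal (betaMoment r d ν p / betaMoment r d ν 0)) →
      ∃ m, CubicExp (charFun ((Measure.pi fun _ : Fin (r + 1) => μ).map
        fun x => Real.log (volFactor x))) m (betaVar r d ν / 4) (betaRemBound r d ν / 8) := by
    intro ν hν μ _ hpos hmom
    obtain ⟨ha, hA⟩ := vertexParam_pos (ν := ν) r d (Or.inr ⟨hν, hrd⟩)
    obtain ⟨m, hm⟩ := exists_cubicExp_beta r d hν ha hA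
    refine ⟨m, ?_⟩
    convert hm using 1
    funext t
    exact charFun_log_eq_div hW hpos (fun p hp => betaMoment_pos r d hp ha hA) hmom
      (fun z hz => differentiableAt_betaMomentC r d hz ha hA) (betaMomentC_ofReal r d ν) t
  cases M with
  | gaussian =>
    refine ⟨ae_volFactor_pos_stdGaussian r d, ?_⟩
    obtain ⟨m, hm⟩ := exists_cubicExp_gauss r d
    refine ⟨m, ?_⟩
    change CubicExp (charFun ((Measure.pi fun _ : Fin (r + 1) =>
      stdGaussian (EuclideanSpace ℝ (Fin (r + d)))).map
      fun x => Real.log (volFactor x))) m (gaussVar r d / 4) (gaussRemBound r d / 8)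
    convert hm using 1
    funext t
    exact charFun_log_eq_div hW (ae_volFactor_pos_stdGaussian r d)
      (fun p hp => gaussMoment_pos r d hp) (fun p hp => lintegral_volFactor_stdGaussian r d hp)
      (fun z hz => differentiableAt_gaussMomentC r d hz) (gaussMomentC_ofReal r d) t
  | beta ν hν =>
    obtain ⟨C, hC⟩ := exists_betaBall_eq_profileLaw (r + d) ν
    have hprob : IsProbabilityMeasure (betaBall (r + d) ν) := ‹_›
    change (∀ᵐ x ∂(Measure.pi fun _ : Fin (r + 1) => betaBall (r + d) ν), 0 < volFactor x) ∧
      ∃ m, CubicExp (charFun ((Measure.pi fun _ : Fin (r + 1) => betaBall (r + d) ν).map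
      fun x => Real.log (volFactor x))) m (betaVar r d ν / 4) (betaRemBound r d ν / 8)
    rw [hC] at hprob ⊢
    have hpos := ae_volFactor_pos_profileLaw (sliceProfile_beta (ν / 2 - 1)).measurable (C := C) r d
    exact ⟨hpos, hbeta ν hν.le _ hpos fun p hp => lintegral_volFactor_beta hν r d hp⟩
  | spherical =>
    have hprob : IsProbabilityMeasure (uniformSphere (r + d)) := ‹_›
    have hpos := ae_volFactor_pos_uniformSphere r d hrd
    exact ⟨hpos, hbeta 0 le_rfl _ hpos fun p hp => lintegral_volFactor_uniformSphere r d hrd hp⟩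

theorem PointModel.exists_cubicExp_logVolume (M : PointModel) {n r : ℕ} (hr : r ≤ n) (hn : 2 ≤ n)
    {Ω : Type*} [MeasurableSpace Ω] {P : Measure Ω} [IsProbabilityMeasure P]
    {X : Fin (r + 1) → Ω → EuclideanSpace ℝ (Fin n)} (hlaw : ∀ i, HasLaw (X i) (M.law n) P)
    (hindep : iIndepFun X P) :
    (∀ᵐ ω ∂P, 0 < volFactor fun i => X i ω) ∧
    ∃ m, CubicExp (charFun (P.map fun ω => Real.log (volFactor fun i => X i ω))) m
      (M.logVar r (n - r) / 4) (M.remBound r (n - r) / 8) := by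
  obtain ⟨d, rfl⟩ := Nat.exists_eq_add_of_le hr
  rw [Nat.add_sub_cancel_left]
  have hXi : ∀ i, AEMeasurable (X i) P := fun i => (hlaw i).aemeasurable
  have hX : AEMeasurable (fun ω i => X i ω) P := aemeasurable_pi_lambda _ hXi
  have hmap : P.map (fun ω i => X i ω) = Measure.pi fun _ => M.law (r + d) := by
    rw [(iIndepFun_iff_map_fun_eq_pi_map hXi).1 hindep]
    congr 1
    exact funext fun i => (hlaw i).map_eq
  have hprob : IsProbabilityMeasure (M.law (r + d)) := by
    rw [← (hlaw 0).map_eq]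
    exact Measure.isProbabilityMeasure_map (hXi 0)
  have hW : Measurable (volFactor : (Fin (r + 1) → EuclideanSpace ℝ (Fin (r + d))) → ℝ) :=
    continuous_volFactor.measurable
  obtain ⟨h1, m, h2⟩ := M.exists_cubicExp_log_volFactor hn
  rw [← hmap] at h1 h2
  refine ⟨ae_of_ae_map hX h1, m, ?_⟩
  have hlogW : Measurable fun x : Fin (r + 1) → EuclideanSpace ℝ (Fin (r + d)) =>
    Real.log (volFactor x) := Real.measurable_log.comp hW
  rwa [AEMeasurable.map_map_of_aemeasurable hlogW.aemeasurable hX] at h2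

theorem mainTheorem4 (M : PointModel)
    (r : ℕ → ℕ) (hr : ∀ n, 1 ≤ n → 1 ≤ r n ∧ r n ≤ n)
    {Ω : ℕ → Type*} [∀ n, MeasurableSpace (Ω n)]
    (P : (n : ℕ) → Measure (Ω n)) [∀ n, IsProbabilityMeasure (P n)]
    (X : (n : ℕ) → Fin (r n + 1) → Ω n → EuclideanSpace ℝ (Fin n))
    (hlaw : ∀ n, 1 ≤ n → ∀ i, HasLaw (X n i) (M.law n) (P n))
    (hindep : ∀ n, 1 ≤ n → iIndepFun (X n) (P n))
    (L : (n : ℕ) → Ω n → ℝ) (hL : ∀ n ω, L n ω = logVolume (fun i => X n i ω)) :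
    (∀ n, 2 ≤ n →
      (∀ᵐ ω ∂(P n), 0 < simplexVolume (fun i => X n i ω)) ∧
      MemLp (L n) 2 (P n) ∧ 0 < variance (L n) (P n)) ∧
    TendstoInDistribution
      (fun n ω => (L n ω - ∫ ω', L n ω' ∂(P n)) / √(variance (L n) (P n)))
      atTop (id : ℝ → ℝ) P (gaussianReal 0 1) := by
  have hL' : ∀ n, L n = fun ω => Real.log (volFactor fun i => X n i ω) := fun n =>
    funext fun ω => by rw [hL, logVolume_eq]
  have hLm : ∀ n, AEMeasurable (L n) (P n) := fun n => by
    rcases Nat.eq_zero_or_pos n with rfl | hn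
    -- No law is prescribed for n = 0, but ℝ⁰ is a single point, so the log-volume is constant.
    · have : L 0 = fun _ => logVolume (n := 0) (r := r 0) 0 := funext fun ω => by
        rw [hL]
        congr 1
        exact Subsingleton.elim _ _
      rw [this]
      exact aemeasurable_const
    · rw [hL']
      have hlogW : Measurable fun x : Fin (r n + 1) → EuclideanSpace ℝ (Fin n) =>
        Real.log (volFactor x) := Real.measurable_log.comp continuous_volFactor.measurable
      exact hlogW.comp_aemeasurable
        (aemeasurable_pi_lambda (fun ω i => X n i ω) fun i => (hlaw n hn i).aemeasurable)
  have key : ∀ n, 2 ≤ n → (∀ᵐ ω ∂(P n), 0 < volFactor fun i => X n i ω) ∧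
      ∃ m, CubicExp (charFun ((P n).map (L n))) m (M.logVar (r n) (n - r n) / 4)
        (M.remBound (r n) (n - r n) / 8) := fun n hn => by
    rw [hL']
    exact M.exists_cubicExp_logVolume (hr n (by omega)).2 hn (hlaw n (by omega))
      (hindep n (by omega))
  have hpos : ∀ n, 2 ≤ n → 0 < M.logVar (r n) (n - r n) := fun n hn => by
    obtain ⟨h1, h2⟩ := hr n (by omega)
    exact M.logVar_pos h1 (by omega)
  refine ⟨fun n hn => ?_, ?_⟩
  · obtain ⟨h1, m, h2⟩ := key n hn
    obtain ⟨h3, -, h4⟩ := h2.moments (hLm n)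
    refine ⟨h1.mono fun ω hω => (simplexVolume_pos_iff _).2 hω, h3, ?_⟩
    rw [h4]
    exact div_pos (hpos n hn) four_pos
  · have hm : ∀ n, ∃ m, 2 ≤ n → CubicExp (charFun ((P n).map (L n))) m
        (M.logVar (r n) (n - r n) / 4) (M.remBound (r n) (n - r n) / 8) := fun n => by
      by_cases hn : 2 ≤ n
      · obtain ⟨-, m, h⟩ := key n hn
        exact ⟨m, fun _ => h⟩
      · exact ⟨0, fun h => absurd h hn⟩
    choose m hm using hm
    refine tendstoInDistribution_of_cubicExp hLm (m := m)
      (v := fun n => M.logVar (r n) (n - r n) / 4) (κ := fun n => M.remBound (r n) (n - r n) / 8)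
      ?_ ?_
    · filter_upwards [eventually_ge_atTop 2] with n hn
      exact ⟨hm n hn, div_pos (hpos n hn) four_pos⟩
    · have hκ : ∀ᶠ n in atTop, 0 ≤ M.remBound (r n) (n - r n) := by
        filter_upwards [eventually_ge_atTop 2] with n hn
        have := (hm n hn).nonneg
        linarith
      refine (M.tendsto_remBound_ratio (fun n hn => (hr n hn).1)
        (fun n hn => Nat.add_sub_cancel' (hr n hn).2) hκ).congr fun n => ?_
      -- The factors from variance/4 and remainder/8 cancel because √4³ = 8.
      rw [show (4 : ℝ) = 2 ^ 2 by norm_num, Real.sqrt_div' _ (by norm_num),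
        Real.sqrt_sq zero_le_two, div_pow, div_div_eq_mul_div]
      ring
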